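/- Conventions. A graph is a connected, compact, (at most) 1-dimensional CW complex; its vertices are its 0-cells and its edges are its 1-cells. An isomorphism of graphs is a piecewise smooth homeomorphism mapping the vertex set onto the vertex set. For a smooth map $c:M\to C$ from a smooth closed manifold to a 1-dimensional manifold with finitely many singular values, the Reeb space $W_c$ is the quotient of $M$ by the relation "lying in the same connected component of a fibre $c^{-1}(y)$". The Reeb graph of $c$ is $W_c$ with vertices those points whose preimage in $M$ contains a singular point of $c$. The map $c$ is Morse if at each singular point it has the form $\sum_{j\le m-k} x_j^2-\sum_{j>m-k}x_j^2$, with $0\le k\le m/2$, in suitable local coordinates of $M$ and of $C$. A real algebraic function on a semi-algebraic set $S\subset\mathbb{R}^k$ is a smooth function $q:S\to\mathbb{R}$ satisfying a polynomial equation $\sum_{l=0}^{d}p_l(x)q(x)^l=0$ on $S$ with $d\ge 1$ and real polynomials $p_l$, where $p_d$ does not vanish identically on any non-empty open subset of $S$; a real algebraic map is a map whose components are real algebraic functions. Theorem. Let $G$ be a graph with exactly $i+1>2$ vertices $v_1,\dots,v_{i+1}$, and put $v_{i+2}:=v_1$. Suppose that the closure of each edge of $G$ connects $v_j$ and $v_{j+1}$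 for some $1\le j\le i+1$. Let $a_j$ be the number of edges whose closures connect $v_j$ and $v_{j+1}$, and suppose that $a_j>0$ for all $1\le j\le i+1$, and that $(a_j,a_{j+1})\ne(1,1)$ for $1\le j\le i$ and $(a_{i+1},a_1)\neq(1,1)$. Let $0<r<1$, let $N(C)=\{x\in\mathbb{R}^2 : 1-r\le\|x\|\le 1+r\}$, let $C=S^1$ be the unit circle, and let $\pi:N(C)\to C$, $\pi(x)=x/\|x\|$. Then for every integer $m>1$ there exist an $m$-dimensional closed (compact, without boundary) connected manifold $M\subset\mathbb{R}^{m+1}$ that is the zero set of a real polynomial of degree $2\sum_{j=1}^{i+1}(a_j-1)+4$ whose gradient does not vanish at any point of $M$, and a real algebraic map $f:M\to N(C)$ such that $\pi\circ f:M\to C$ is Morse and its Reeb graph is isomorphic to $G$. -/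

import Mathlib

open Set Topology
open scoped ContDiff

noncomputable section

/-! ### Smooth maps, coordinates and singular points on subsets of Euclidean spaces -/

/-- A map is smooth on a subset `S` if, near each point of `S`, it is the restriction of a
`C^∞` map defined on an open set of the ambient space. -/
def SmoothOnSet {E F : Type*} [NormedAddCommGroup E] [NormedSpace ℝ E]
    [NormedAddCommGroup F] [NormedSpace ℝ F] (f : E → F) (S : Set E) : Prop :=
  ∀ p ∈ S, ∃ (U : Set E) (g : E → F), IsOpen U ∧ p ∈ U ∧ ContDiffOn ℝ ∞ g U ∧ EqOn f g (U ∩ S)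

/-- `φ`, restricted to the open set `U` of the model space `H`, is a diffeomorphism onto a
relatively open subset `V ∩ S` of `S`, with smooth inverse `ψ`. Equivalently, the inverse of `φ`
is a smooth local coordinate system of `S` with domain `V ∩ S`. -/
def IsLocalParam {H E : Type*} [NormedAddCommGroup H] [NormedSpace ℝ H]
    [NormedAddCommGroup E] [NormedSpace ℝ E] (S : Set E) (U : Set H) (φ : H → E) : Prop :=
  IsOpen U ∧ ContDiffOn ℝ ∞ φ U ∧
    ∃ (V : Set E) (ψ : E → H), IsOpen V ∧ ContDiffOn ℝ ∞ ψ V ∧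
      MapsTo φ U (V ∩ S) ∧ MapsTo ψ (V ∩ S) U ∧
      (∀ u ∈ U, ψ (φ u) = u) ∧ (∀ x ∈ V ∩ S, φ (ψ x) = x)

/-- `p` is a singular point of the smooth map `c` from the `d`-dimensional manifold `S` to a curve:
in local coordinates of `S` around `p`, the differential of `c` has rank smaller than `1`. -/
def IsSingularPoint {E F : Type*} [NormedAddCommGroup E] [NormedSpace ℝ E]
    [NormedAddCommGroup F] [NormedSpace ℝ F] (S : Set E) (d : ℕ) (c : E → F) (p : E) : Prop :=
  ∃ (U : Set (EuclideanSpace ℝ (Fin d))) (φ : EuclideanSpace ℝ (Fin d) → E)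
    (u : EuclideanSpace ℝ (Fin d)),
    IsLocalParam S U φ ∧ u ∈ U ∧ φ u = p ∧ fderiv ℝ (fun z => c (φ z)) u = 0

/-- The quadratic form `x₁² + ⋯ + x_{d-k}² - x_{d-k+1}² - ⋯ - x_d²` of index `k`. -/
def morseForm (d k : ℕ) (x : EuclideanSpace ℝ (Fin d)) : ℝ :=
  ∑ j : Fin d, if (j : ℕ) < d - k then x j ^ 2 else -(x j ^ 2)

/-- `c` is a Morse function from the `d`-dimensional manifold `S` (without boundary) to the curve
`C`: it is smooth and at each singular point it is, for suitable local coordinates of `S` and of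
`C`, a quadratic form of index at most `d / 2`. -/
def IsMorseFunction {E F : Type*} [NormedAddCommGroup E] [NormedSpace ℝ E]
    [NormedAddCommGroup F] [NormedSpace ℝ F] (S : Set E) (d : ℕ) (C : Set F) (c : E → F) : Prop :=
  SmoothOnSet c S ∧ MapsTo c S C ∧
    ∀ p ∈ S, IsSingularPoint S d c p →
      ∃ (k : ℕ) (U : Set (EuclideanSpace ℝ (Fin d))) (φ : EuclideanSpace ℝ (Fin d) → E)
        (W : Set ℝ) (χ : ℝ → F),
        2 * k ≤ d ∧
        IsLocalParam S U φ ∧ 0 ∈ U ∧ φ 0 = p ∧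
        IsLocalParam C W χ ∧ 0 ∈ W ∧ χ 0 = c p ∧
        ∀ x ∈ U, morseForm d k x ∈ W ∧ c (φ x) = χ (morseForm d k x)

/-! ### Real algebraic objects -/

/-- The zero set in `ℝᵏ` of a real polynomial. -/
def polyZeroSet {k : ℕ} (P : MvPolynomial (Fin k) ℝ) : Set (EuclideanSpace ℝ (Fin k)) :=
  {x | MvPolynomial.eval (fun j => x j) P = 0}

/-- The zero set of `P` is non-singular: the differential of `P` has rank `1` at each of its
zeros. A non-empty non-singular zero set of one polynomial in `ℝ^(m+1)` is an `m`-dimensional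
regular real algebraic manifold. -/
def IsNonsingularPoly {k : ℕ} (P : MvPolynomial (Fin k) ℝ) : Prop :=
  ∀ x ∈ polyZeroSet P, ∃ j : Fin k, MvPolynomial.eval (fun l => x l) (MvPolynomial.pderiv j P) ≠ 0

/-- `q` is a real algebraic function on `S ⊆ ℝᵏ`: it is smooth and satisfies on `S` a polynomial
equation of positive degree whose coefficients are polynomials in `k` variables and whose leading
coefficient is not identically zero on any non-empty relatively open subset of `S`. -/
def IsRealAlgebraicFunction {k : ℕ} (S : Set (EuclideanSpace ℝ (Fin k)))
    (q : EuclideanSpace ℝ (Fin k) → ℝ) : Prop :=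
  SmoothOnSet q S ∧
    ∃ P : Polynomial (MvPolynomial (Fin k) ℝ), 0 < P.natDegree ∧
      S ⊆ closure {x | x ∈ S ∧ MvPolynomial.eval (fun j => x j) P.leadingCoeff ≠ 0} ∧
      ∀ x ∈ S, (P.map (MvPolynomial.eval (fun j => x j))).eval (q x) = 0

/-- A real algebraic map on `S ⊆ ℝᵏ`: each of its components is a real algebraic function. -/
def IsRealAlgebraicMap {k l : ℕ} (S : Set (EuclideanSpace ℝ (Fin k)))
    (f : EuclideanSpace ℝ (Fin k) → EuclideanSpace ℝ (Fin l)) : Prop :=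
  ∀ j : Fin l, IsRealAlgebraicFunction S (fun x => f x j)

/-- The annulus `N(C) = {x ∈ ℝ² | 1 - r ≤ ‖x‖ ≤ 1 + r}` around the unit circle `C`. -/
def planeAnnulus (r : ℝ) : Set (EuclideanSpace ℝ (Fin 2)) :=
  {x | 1 - r ≤ ‖x‖ ∧ ‖x‖ ≤ 1 + r}

/-- The radial projection `x ↦ x / ‖x‖`. -/
def radialProj (x : EuclideanSpace ℝ (Fin 2)) : EuclideanSpace ℝ (Fin 2) := ‖x‖⁻¹ • x

/-- The unit circle in `ℝ²`. -/
def unitCircle : Set (EuclideanSpace ℝ (Fin 2)) := {x | ‖x‖ = 1}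

/-! ### Reeb spaces and Reeb graphs -/

/-- Two points are equivalent if they lie in the same connected component of a fibre of `c`. -/
def reebSetoid {M Y : Type*} [TopologicalSpace M] (c : M → Y) : Setoid M where
  r x y := c x = c y ∧ y ∈ connectedComponentIn (c ⁻¹' {c x}) x
  iseqv := by
    refine ⟨fun x => ⟨rfl, mem_connectedComponentIn rfl⟩, ?_, ?_⟩
    · rintro x y ⟨h, hy⟩
      refine ⟨h.symm, ?_⟩
      rw [← h, ← connectedComponentIn_eq hy]
      exact mem_connectedComponentIn rfl
    · rintro x y z ⟨h, hy⟩ ⟨h', hz⟩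
      refine ⟨h.trans h', ?_⟩
      rw [connectedComponentIn_eq hy, h]
      exact hz

/-- The Reeb space of `c`, with the quotient topology. -/
abbrev ReebSpace {M Y : Type*} [TopologicalSpace M] (c : M → Y) : Type _ :=
  Quotient (reebSetoid c)

/-- The map induced by `c` on its Reeb space. -/
def reebMap {M Y : Type*} [TopologicalSpace M] (c : M → Y) : ReebSpace c → Y :=
  Quotient.lift c (fun _ _ h => h.1)

/-- The vertices of the Reeb graph of `c` on the `d`-dimensional manifold `S`: the components of
fibres that contain a singular point of `c`. -/
def reebVertices {E F : Type*} [NormedAddCommGroup E] [NormedSpace ℝ E]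
    [NormedAddCommGroup F] [NormedSpace ℝ F] (S : Set E) (d : ℕ) (c : E → F) :
    Set (ReebSpace (S.domRestrict c)) :=
  {w | ∃ p : S, (Quotient.mk _ p : ReebSpace (S.domRestrict c)) = w ∧ IsSingularPoint S d c p}

/-- A connected, compact CW complex without cells of dimension greater than one. -/
structure IsCWGraph (X : Type*) [TopologicalSpace X] [CWComplex (univ : Set X)] : Prop where
  connected : ConnectedSpace X
  compact : CompactSpace X
  dim_le_one : ∀ n, 2 ≤ n → IsEmpty (RelCWComplex.cell (univ : Set X) n)

/-- The curve `γ : [-1, 1] → F` is piecewise smooth and regular: away from finitely many break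
points `T` it is smooth with non-vanishing (one-sided at the ends) derivative. -/
def IsPiecewiseRegular {F : Type*} [NormedAddCommGroup F] [NormedSpace ℝ F] (γ : ℝ → F) : Prop :=
  ∃ T : Finset ℝ, ∀ s t : ℝ, -1 ≤ s → s < t → t ≤ 1 → (∀ τ ∈ T, τ ∉ Ioo s t) →
    ContDiffOn ℝ ∞ γ (Icc s t) ∧ ∀ τ ∈ Icc s t, derivWithin γ (Icc s t) τ ≠ 0

/-- The Reeb graph of the function `c` from the `d`-dimensional manifold `S` to a curve is
isomorphic to the graph `X`. The set of singular values is finite, and there is a homeomorphism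
from the Reeb space to `X` that maps the set of vertices onto the set of vertices and is piecewise
smooth on edges. Here each closed edge of `X` is parametrized by its characteristic map on
`[-1, 1]`, and the smooth structure on the edges of the Reeb graph is the one for which the induced
map to the curve is a local diffeomorphism. -/
def ReebGraphIsomorphic {E F : Type*} [NormedAddCommGroup E] [NormedSpace ℝ E]
    [NormedAddCommGroup F] [NormedSpace ℝ F] (S : Set E) (d : ℕ) (c : E → F)
    (X : Type*) [TopologicalSpace X] [CWComplex (univ : Set X)] : Prop :=
  (c '' {p | p ∈ S ∧ IsSingularPoint S d c p}).Finite ∧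
    ∃ h : ReebSpace (S.domRestrict c) ≃ₜ X,
      h '' reebVertices S d c =
        ⋃ z : RelCWComplex.cell (univ : Set X) 0, RelCWComplex.closedCell 0 z ∧
      ∀ e : RelCWComplex.cell (univ : Set X) 1,
        IsPiecewiseRegular
          (fun t : ℝ => reebMap (S.domRestrict c) (h.symm (RelCWComplex.map 1 e (fun _ => t))))

end

/-!
The plane is divided into `n = i + 1` equal sectors, one for each pair of consecutive vertices of the
graph. For a sector with angle `2 δ`, let `u` be the coordinate along its bisector. The conic
`(1 - c u)² = (u² - cos² δ |x|²) / 64` lies in the closed sector, close to the line `c u = 1`, and is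
tangent to both sides of the sector. In the `j`-th sector, `a j - 1` such conics are drawn, all of
them with different levels `c`, so that the closed holes bounded by them are pairwise disjoint
(`Hole.eq_of_form_nonpos`). Let `Q` be the product of the quadratic polynomials of all holes and of
two circles bounding an annulus that contains them. It is non-negative exactly on the annulus without
the open holes
(`regionFun_nonneg_iff`), and its gradient does not vanish on the boundary of this region. The manifold
is `M = {(x, y) | Q x = |y|²}` with `y` in the complement of the plane; its degree is
`2 ∑ (a j - 1) + 4`. The map to the annulus `N(C)` forgets `y` and squeezes the plane along the rays
from the origin, so its composition with the projection to the circle is the angle of `x`.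

Singular points. Along the boundary of the region, the radius is a smooth function of the angle except
at the points of tangency, and over the interior of the region the angle is clearly regular. So all
singular points lie over points of tangency (`exists_hole_of_isSingularPoint`). Near such a point write
`Q = G q` with `q` the polynomial of the hole. Then `Y = y / (√G |x|)` and `s = (1 - c u) / |x|` are
local coordinates of `M`, and dividing `|y|² = G q` by `G |x|²` gives
`|Y|² - s² = (cos² δ - (u / |x|)²) / 64`. The right hand side is a local coordinate of the circle, so
these are Morse charts of index `1` (`Hole.isLocalParam_chart`). Every ray between two sectors
contains a point of tangency, because `(a j, a (j + 1)) ≠ (1, 1)`.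

The Reeb graph. On a ray inside the `j`-th sector, the holes leave `a j` disjoint segments, one in each
of the channels between them, and their outer ends are boundary points of the region
(`exists_channel_end`). The preimages in `M` of the segments are connected, so they are the components
of the fibre. On a ray between two sectors the region is a whole segment, so that the fibre is
connected. Sending the points over the `l`-th channel of the `j`-th sector to the `l`-th edge between
the vertices `j` and `j + 1`, by a parameter of the angle, defines a continuous surjection of `M` onto
the graph, whose fibres are the components of the fibres of the angle
(`NecklaceParam.toGraph_eq_iff`). By compactness it induces a homeomorphism of the Reeb space with the
graph, and `M` is connected since the graph and the fibres are. The singular points lie exactly over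
the rays between the sectors, that is over the vertices.
-/

noncomputable section

/-! ### The sectors of a regular polygon -/

/-- Half the opening angle of each of the `i + 1` equal sectors of the plane. -/
def halfAngle (i : ℕ) : ℝ := Real.pi / (i + 1)

/-- The angle of the bisecting ray of the `j`-th sector. -/
def bisectorAngle {i : ℕ} (j : Fin (i + 1)) : ℝ := (2 * (j : ℕ) + 1) * halfAngle i

/-- The first ray of the `j`-th sector; its second ray is the first ray of the next sector. -/
def sectorRay {i : ℕ} (j : Fin (i + 1)) : EuclideanSpace ℝ (Fin 2) :=
  !₂[Real.cos (2 * (j : ℕ) * halfAngle i), Real.sin (2 * (j : ℕ) * halfAngle i)]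

/-- The coordinate of the plane along the bisector of the `j`-th sector. -/
def alongCoord {i : ℕ} (j : Fin (i + 1)) (x : EuclideanSpace ℝ (Fin 2)) : ℝ :=
  Real.cos (bisectorAngle j) * x 0 + Real.sin (bisectorAngle j) * x 1

/-- The coordinate of the plane orthogonal to the bisector of the `j`-th sector. -/
def acrossCoord {i : ℕ} (j : Fin (i + 1)) (x : EuclideanSpace ℝ (Fin 2)) : ℝ :=
  Real.cos (bisectorAngle j) * x 1 - Real.sin (bisectorAngle j) * x 0

/-- The point of the plane with the given coordinates along and across the bisector. -/
def ofSectorCoords {i : ℕ} (j : Fin (i + 1)) (u v : ℝ) : EuclideanSpace ℝ (Fin 2) :=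
  !₂[Real.cos (bisectorAngle j) * u - Real.sin (bisectorAngle j) * v,
    Real.sin (bisectorAngle j) * u + Real.cos (bisectorAngle j) * v]

section SectorCoords

variable {i : ℕ} (j : Fin (i + 1))

lemma norm_sq_plane (x : EuclideanSpace ℝ (Fin 2)) : ‖x‖ ^ 2 = x 0 ^ 2 + x 1 ^ 2 := by
  simp [EuclideanSpace.norm_sq_eq]

lemma norm_sq_eq_coords (x : EuclideanSpace ℝ (Fin 2)) :
    ‖x‖ ^ 2 = alongCoord j x ^ 2 + acrossCoord j x ^ 2 := by
  rw [norm_sq_plane, alongCoord, acrossCoord]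
  linear_combination -(x 0 ^ 2 + x 1 ^ 2) * Real.sin_sq_add_cos_sq (bisectorAngle j)

@[simp] lemma ofSectorCoords_apply_zero (u v : ℝ) : ofSectorCoords j u v 0 =
    Real.cos (bisectorAngle j) * u - Real.sin (bisectorAngle j) * v := rfl

@[simp] lemma ofSectorCoords_apply_one (u v : ℝ) : ofSectorCoords j u v 1 =
    Real.sin (bisectorAngle j) * u + Real.cos (bisectorAngle j) * v := rfl

@[simp] lemma sectorRay_apply_zero :
    sectorRay j 0 = Real.cos (2 * (j : ℕ) * halfAngle i) := rfl

@[simp] lemma sectorRay_apply_one :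
    sectorRay j 1 = Real.sin (2 * (j : ℕ) * halfAngle i) := rfl

@[simp] lemma alongCoord_ofSectorCoords (u v : ℝ) : alongCoord j (ofSectorCoords j u v) = u := by
  simp only [alongCoord, ofSectorCoords, PiLp.toLp_apply, Matrix.cons_val_zero, Matrix.cons_val_one]
  linear_combination u * Real.sin_sq_add_cos_sq (bisectorAngle j)

@[simp] lemma acrossCoord_ofSectorCoords (u v : ℝ) : acrossCoord j (ofSectorCoords j u v) = v := by
  simp only [acrossCoord, ofSectorCoords, PiLp.toLp_apply, Matrix.cons_val_zero,
    Matrix.cons_val_one]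
  linear_combination v * Real.sin_sq_add_cos_sq (bisectorAngle j)

@[simp] lemma ofSectorCoords_coords (x : EuclideanSpace ℝ (Fin 2)) :
    ofSectorCoords j (alongCoord j x) (acrossCoord j x) = x := by
  ext k
  fin_cases k
  · simp only [alongCoord, acrossCoord, Fin.zero_eta, ofSectorCoords_apply_zero]
    linear_combination x 0 * Real.sin_sq_add_cos_sq (bisectorAngle j)
  · simp only [alongCoord, acrossCoord, Fin.mk_one, ofSectorCoords_apply_one]
    linear_combination x 1 * Real.sin_sq_add_cos_sq (bisectorAngle j)

lemma alongCoord_smul (t : ℝ) (x : EuclideanSpace ℝ (Fin 2)) :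
    alongCoord j (t • x) = t * alongCoord j x := by
  simp only [alongCoord, PiLp.smul_apply, smul_eq_mul]; ring

lemma acrossCoord_smul (t : ℝ) (x : EuclideanSpace ℝ (Fin 2)) :
    acrossCoord j (t • x) = t * acrossCoord j x := by
  simp only [acrossCoord, PiLp.smul_apply, smul_eq_mul]; ring

lemma contDiff_alongCoord : ContDiff ℝ ∞ (alongCoord j) := by
  unfold alongCoord; fun_prop

lemma contDiff_acrossCoord : ContDiff ℝ ∞ (acrossCoord j) := by
  unfold acrossCoord; fun_prop

lemma continuous_alongCoord : Continuous (alongCoord j) := (contDiff_alongCoord j).continuous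

lemma continuous_acrossCoord : Continuous (acrossCoord j) := (contDiff_acrossCoord j).continuous

lemma contDiff_ofSectorCoords : ContDiff ℝ ∞ (fun p : ℝ × ℝ => ofSectorCoords j p.1 p.2) := by
  rw [contDiff_euclidean]
  intro k
  fin_cases k <;> simp only [ofSectorCoords, PiLp.toLp_apply, Fin.zero_eta, Fin.mk_one,
      Matrix.cons_val_zero, Matrix.cons_val_one] <;> fun_prop

lemma norm_ofSectorCoords_sq (u v : ℝ) : ‖ofSectorCoords j u v‖ ^ 2 = u ^ 2 + v ^ 2 := by
  rw [norm_sq_eq_coords j]; simp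

lemma eq_of_coords_eq {x y : EuclideanSpace ℝ (Fin 2)} (h₁ : alongCoord j x = alongCoord j y)
    (h₂ : acrossCoord j x = acrossCoord j y) : x = y := by
  rw [← ofSectorCoords_coords j x, ← ofSectorCoords_coords j y, h₁, h₂]

lemma alongCoord_le_norm (x : EuclideanSpace ℝ (Fin 2)) : alongCoord j x ≤ ‖x‖ := by
  refine abs_le_of_sq_le_sq' ?_ (norm_nonneg x) |>.2
  nlinarith [norm_sq_eq_coords j x, sq_nonneg (acrossCoord j x)]

end SectorCoords

section SectorRays

variable {i : ℕ}

lemma halfAngle_pos (i : ℕ) : 0 < halfAngle i := by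
  unfold halfAngle; positivity

lemma succ_mul_halfAngle (i : ℕ) : ((i : ℝ) + 1) * halfAngle i = Real.pi := by
  unfold halfAngle; field_simp

lemma halfAngle_le (hi : 2 ≤ i) : halfAngle i ≤ Real.pi / 3 := by
  have h := succ_mul_halfAngle i
  have : (2 : ℝ) ≤ i := by exact_mod_cast hi
  nlinarith [halfAngle_pos i]

lemma half_le_cos_halfAngle (hi : 2 ≤ i) : 1 / 2 ≤ Real.cos (halfAngle i) := by
  rw [← Real.cos_pi_div_three]
  exact Real.cos_le_cos_of_nonneg_of_le_pi (halfAngle_pos i).le (by linarith [Real.pi_pos])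
    (halfAngle_le hi)

lemma sin_halfAngle_pos (hi : 2 ≤ i) : 0 < Real.sin (halfAngle i) :=
  Real.sin_pos_of_pos_of_lt_pi (halfAngle_pos i)
    (by linarith [halfAngle_le hi, Real.pi_pos])

lemma norm_sectorRay (j : Fin (i + 1)) : ‖sectorRay j‖ = 1 := by
  have : ‖sectorRay j‖ ^ 2 = 1 := by
    rw [norm_sq_plane]
    simp [sectorRay]
  nlinarith [norm_nonneg (sectorRay j)]

lemma sectorRay_eq (j : Fin (i + 1)) :
    sectorRay j = ofSectorCoords j (Real.cos (halfAngle i)) (-Real.sin (halfAngle i)) := by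
  have h : 2 * ((j : ℕ) : ℝ) * halfAngle i = bisectorAngle j - halfAngle i := by
    unfold bisectorAngle; ring
  ext k
  fin_cases k
  · rw [Fin.zero_eta, sectorRay_apply_zero, ofSectorCoords_apply_zero, h, Real.cos_sub]
    ring
  · rw [Fin.mk_one, sectorRay_apply_one, ofSectorCoords_apply_one, h, Real.sin_sub]
    ring

lemma sectorRay_succ_eq (j : Fin (i + 1)) :
    sectorRay (j + 1) =
      ofSectorCoords j (Real.cos (halfAngle i)) (Real.sin (halfAngle i)) := by
  obtain ⟨r, hr⟩ : ∃ r : ℤ, 2 * (((j + 1 : Fin (i + 1)) : ℕ) : ℝ) * halfAngle i =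
      (bisectorAngle j + halfAngle i) + r * (2 * Real.pi) := by
    have hs := succ_mul_halfAngle i
    by_cases hj : j = Fin.last i
    · subst hj
      refine ⟨-1, ?_⟩
      rw [Fin.last_add_one]
      simp only [bisectorAngle, Fin.val_last, Fin.val_zero]
      push_cast
      linear_combination -2 * hs
    · refine ⟨0, ?_⟩
      rw [Fin.val_add_one_of_lt (Fin.lt_last_iff_ne_last.2 hj)]
      simp only [bisectorAngle]
      push_cast
      ring
  ext k
  fin_cases k
  · rw [Fin.zero_eta, sectorRay_apply_zero, ofSectorCoords_apply_zero, hr,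
      Real.cos_add_int_mul_two_pi, Real.cos_add]
  · rw [Fin.mk_one, sectorRay_apply_one, ofSectorCoords_apply_one, hr,
      Real.sin_add_int_mul_two_pi, Real.sin_add]

lemma alongCoord_polar (j : Fin (i + 1)) (r θ : ℝ) :
    alongCoord j !₂[r * Real.cos θ, r * Real.sin θ] = r * Real.cos (θ - bisectorAngle j) := by
  simp only [alongCoord, Matrix.cons_val_zero, Matrix.cons_val_one, Real.cos_sub]
  ring

lemma exists_polar (x : EuclideanSpace ℝ (Fin 2)) :
    ∃ θ : ℝ, x = !₂[‖x‖ * Real.cos θ, ‖x‖ * Real.sin θ] := by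
  set z : ℂ := ⟨x 0, x 1⟩ with hz
  have hn : ‖z‖ = ‖x‖ := by
    have h1 : ‖z‖ ^ 2 = ‖x‖ ^ 2 := by
      rw [norm_sq_plane, Complex.sq_norm, Complex.normSq_apply]; ring
    exact (sq_eq_sq₀ (norm_nonneg _) (norm_nonneg _)).1 h1
  refine ⟨z.arg, ?_⟩
  ext k
  fin_cases k
  · change x 0 = ‖x‖ * Real.cos z.arg
    rw [← hn, Complex.norm_mul_cos_arg]
  · change x 1 = ‖x‖ * Real.sin z.arg
    rw [← hn, Complex.norm_mul_sin_arg]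

/-- The closed sectors cover the plane. Each of them is the cone around its bisector described by the
inequality `cos δ * ‖x‖ ≤ u`, where `δ` is half its angle and `u` the coordinate along the bisector. -/
lemma exists_mem_sector (x : EuclideanSpace ℝ (Fin 2)) :
    ∃ j : Fin (i + 1), Real.cos (halfAngle i) * ‖x‖ ≤ alongCoord j x := by
  obtain ⟨θ, hθ⟩ := exists_polar x
  have hδ := halfAngle_pos i
  have hs := succ_mul_halfAngle i
  set r : ℤ := ⌊θ / (2 * halfAngle i)⌋ with hr
  have h1 : (r : ℝ) * (2 * halfAngle i) ≤ θ := (le_div_iff₀ (by positivity)).1 (Int.floor_le _)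
  have h2 : θ < (r + 1) * (2 * halfAngle i) :=
    (div_lt_iff₀ (by positivity)).1 (Int.lt_floor_add_one _)
  have hm0 : 0 ≤ r % ((i : ℤ) + 1) := Int.emod_nonneg _ (by positivity)
  have hm1 : r % ((i : ℤ) + 1) < (i : ℤ) + 1 := Int.emod_lt_of_pos _ (by positivity)
  obtain ⟨j, hj⟩ : ∃ j : ℕ, (j : ℤ) = r % ((i : ℤ) + 1) := ⟨_, Int.toNat_of_nonneg hm0⟩
  have hjr : (r : ℝ) = j + (i + 1) * (r / ((i : ℤ) + 1) : ℤ) := by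
    have := Int.emod_add_mul_ediv r ((i : ℤ) + 1)
    rw [← hj] at this
    exact_mod_cast this.symm
  set e : ℤ := r / ((i : ℤ) + 1)
  refine ⟨⟨j, by omega⟩, ?_⟩
  have hang : θ - bisectorAngle (⟨j, by omega⟩ : Fin (i + 1)) =
      (θ - (2 * r + 1) * halfAngle i) + e * (2 * Real.pi) := by
    simp only [bisectorAngle]
    rw [hjr]
    linear_combination (2 * (e : ℝ)) * hs
  rw [show alongCoord (⟨j, by omega⟩ : Fin (i + 1)) x =
    ‖x‖ * Real.cos (θ - bisectorAngle (⟨j, by omega⟩ : Fin (i + 1))) by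
      conv_lhs => rw [hθ]
      exact alongCoord_polar _ _ _]
  rw [hang, Real.cos_add_int_mul_two_pi, mul_comm]
  refine mul_le_mul_of_nonneg_left ?_ (norm_nonneg _)
  rw [← Real.cos_abs (θ - _)]
  refine Real.cos_le_cos_of_nonneg_of_le_pi (abs_nonneg _) ?_ (abs_le.2 ⟨by linarith, by linarith⟩)
  have : (0 : ℝ) ≤ i := by positivity
  nlinarith

/-- An open sector is disjoint from the other closed sectors. -/
lemma sector_unique {j j' : Fin (i + 1)} {x : EuclideanSpace ℝ (Fin 2)}
    (h : Real.cos (halfAngle i) * ‖x‖ < alongCoord j x)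
    (h' : Real.cos (halfAngle i) * ‖x‖ ≤ alongCoord j' x) : j = j' := by
  by_contra hne
  have hδ := halfAngle_pos i
  have hs := succ_mul_halfAngle i
  have hx : 0 < ‖x‖ := by
    rcases (norm_nonneg x).eq_or_lt with h0 | h0
    · have := alongCoord_le_norm j x
      rw [← h0] at h this
      linarith
    · exact h0
  have hδπ : halfAngle i ≤ Real.pi := by
    have : (0 : ℝ) ≤ i := by positivity
    nlinarith
  obtain ⟨θ, hθ⟩ := exists_polar x
  -- Reduce the angle to the bisector modulo a full turn to `[-π, π)`.
  obtain ⟨α, hα0, hα1, e, hα⟩ : ∃ α : ℝ, -Real.pi ≤ α ∧ α ≤ Real.pi ∧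
      ∃ e : ℤ, θ - bisectorAngle j = α + e * (2 * Real.pi) := by
    have hp : (0 : ℝ) < 2 * Real.pi := by positivity
    have hI := toIcoMod_mem_Ico hp (-Real.pi) (θ - bisectorAngle j)
    refine ⟨toIcoMod hp (-Real.pi) (θ - bisectorAngle j), hI.1, by linarith [hI.2],
      toIcoDiv hp (-Real.pi) (θ - bisectorAngle j), ?_⟩
    have := toIcoMod_add_toIcoDiv_zsmul hp (-Real.pi) (θ - bisectorAngle j)
    rw [zsmul_eq_mul] at this
    exact this.symm
  have e1 : alongCoord j x = ‖x‖ * Real.cos α := by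
    conv_lhs => rw [hθ]
    rw [alongCoord_polar, hα, Real.cos_add_int_mul_two_pi]
  have hang : θ - bisectorAngle j' =
      (α + 2 * ((j : ℕ) - (j' : ℕ) : ℝ) * halfAngle i) + e * (2 * Real.pi) := by
    have : bisectorAngle j' = bisectorAngle j - 2 * ((j : ℕ) - (j' : ℕ) : ℝ) * halfAngle i := by
      simp only [bisectorAngle]; ring
    linarith
  have e2 : alongCoord j' x =
      ‖x‖ * Real.cos (α + 2 * ((j : ℕ) - (j' : ℕ) : ℝ) * halfAngle i) := by
    conv_lhs => rw [hθ]
    rw [alongCoord_polar, hang, Real.cos_add_int_mul_two_pi]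
  rw [e1, mul_comm] at h
  rw [e2, mul_comm] at h'
  replace h := lt_of_mul_lt_mul_left h hx.le
  replace h' := le_of_mul_le_mul_left h' hx
  have hα2 : |α| < halfAngle i := by
    by_contra hcon
    push Not at hcon
    rw [← Real.cos_abs α] at h
    exact absurd (Real.cos_le_cos_of_nonneg_of_le_pi hδ.le (abs_le.2 ⟨hα0, hα1⟩) hcon)
      (not_le.2 h)
  obtain ⟨hα3, hα4⟩ := abs_lt.1 hα2
  -- It suffices to treat a positive difference of the indices, by symmetry.
  have key : ∀ (d : ℕ) (β : ℝ), 1 ≤ d → d ≤ i → |β| < halfAngle i →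
      Real.cos (β + 2 * d * halfAngle i) < Real.cos (halfAngle i) := by
    intro d β hd1 hd2 hβ
    obtain ⟨hβ1, hβ2⟩ := abs_lt.1 hβ
    have hd1' : (1 : ℝ) ≤ d := by exact_mod_cast hd1
    have hd2' : (d : ℝ) ≤ i := by exact_mod_cast hd2
    rcases le_total (β + 2 * d * halfAngle i) Real.pi with hle | hle
    · exact Real.cos_lt_cos_of_nonneg_of_le_pi hδ.le hle (by nlinarith)
    · rw [← Real.cos_two_pi_sub (β + 2 * d * halfAngle i)]
      exact Real.cos_lt_cos_of_nonneg_of_le_pi hδ.le (by linarith) (by nlinarith)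
  have hjj : (j : ℕ) ≠ (j' : ℕ) := fun h => hne (Fin.ext h)
  rcases lt_or_gt_of_ne hjj with hlt | hlt
  · have := key ((j' : ℕ) - (j : ℕ)) (-α) (by omega) (by omega) (by rwa [abs_neg])
    rw [Nat.cast_sub hlt.le, ← Real.cos_neg] at this
    have h3 : -(-α + 2 * (((j' : ℕ) : ℝ) - ((j : ℕ) : ℝ)) * halfAngle i) =
      α + 2 * ((j : ℕ) - (j' : ℕ) : ℝ) * halfAngle i := by ring
    rw [h3] at this
    linarith
  · have := key ((j : ℕ) - (j' : ℕ)) α (by omega) (by omega) hα2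
    rw [Nat.cast_sub hlt.le] at this
    linarith

lemma alongCoord_sectorRay (j : Fin (i + 1)) :
    alongCoord j (sectorRay j) = Real.cos (halfAngle i) := by
  rw [sectorRay_eq, alongCoord_ofSectorCoords]

lemma acrossCoord_sectorRay (j : Fin (i + 1)) :
    acrossCoord j (sectorRay j) = -Real.sin (halfAngle i) := by
  rw [sectorRay_eq, acrossCoord_ofSectorCoords]

lemma alongCoord_sectorRay_succ (j : Fin (i + 1)) :
    alongCoord j (sectorRay (j + 1)) = Real.cos (halfAngle i) := by
  rw [sectorRay_succ_eq, alongCoord_ofSectorCoords]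

lemma acrossCoord_sectorRay_succ (j : Fin (i + 1)) :
    acrossCoord j (sectorRay (j + 1)) = Real.sin (halfAngle i) := by
  rw [sectorRay_succ_eq, acrossCoord_ofSectorCoords]

/-- The rays avoid all open sectors. -/
lemma alongCoord_sectorRay_le (j j' : Fin (i + 1)) :
    alongCoord j' (sectorRay j) ≤ Real.cos (halfAngle i) := by
  by_contra h
  push Not at h
  have := sector_unique (x := sectorRay j) (j := j') (j' := j) (by simpa [norm_sectorRay] using h)
    (by simp [norm_sectorRay, alongCoord_sectorRay])
  subst this
  exact absurd (alongCoord_sectorRay j') h.ne'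

/-- The boundary of a sector consists of its two rays. -/
lemma eq_smul_sectorRay (j : Fin (i + 1)) {x : EuclideanSpace ℝ (Fin 2)}
    (h : alongCoord j x = Real.cos (halfAngle i) * ‖x‖) :
    x = ‖x‖ • sectorRay j ∨ x = ‖x‖ • sectorRay (j + 1) := by
  have h1 := norm_sq_eq_coords j x
  have h2 : acrossCoord j x ^ 2 = (Real.sin (halfAngle i) * ‖x‖) ^ 2 := by
    rw [h] at h1
    linear_combination -h1 - ‖x‖ ^ 2 * Real.sin_sq_add_cos_sq (halfAngle i)
  rcases sq_eq_sq_iff_eq_or_eq_neg.1 h2 with h3 | h3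
  · right
    apply eq_of_coords_eq j
    · rw [alongCoord_smul, alongCoord_sectorRay_succ, h, mul_comm]
    · rw [acrossCoord_smul, acrossCoord_sectorRay_succ, h3, mul_comm]
  · left
    apply eq_of_coords_eq j
    · rw [alongCoord_smul, alongCoord_sectorRay, h, mul_comm]
    · rw [acrossCoord_smul, acrossCoord_sectorRay, h3]; ring

lemma sectorRay_injective : Function.Injective (sectorRay (i := i)) := by
  intro j j' h
  by_contra hne
  have hs := succ_mul_halfAngle i
  have hδ := halfAngle_pos i
  have hcos : Real.cos (2 * (j : ℕ) * halfAngle i - 2 * (j' : ℕ) * halfAngle i) = 1 := by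
    have h0 : sectorRay j 0 = sectorRay j' 0 := by rw [h]
    have h1 : sectorRay j 1 = sectorRay j' 1 := by rw [h]
    simp only [sectorRay, PiLp.toLp_apply, Matrix.cons_val_zero, Matrix.cons_val_one] at h0 h1
    rw [Real.cos_sub, h0, h1]
    linear_combination Real.sin_sq_add_cos_sq (2 * (j' : ℕ) * halfAngle i)
  have hj1 : ((j : ℕ) : ℝ) ≤ i := by exact_mod_cast Nat.lt_succ_iff.1 j.2
  have hj2 : ((j' : ℕ) : ℝ) ≤ i := by exact_mod_cast Nat.lt_succ_iff.1 j'.2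
  have h0 : (0 : ℝ) ≤ ((j : ℕ) : ℝ) := by positivity
  have h0' : (0 : ℝ) ≤ ((j' : ℕ) : ℝ) := by positivity
  have h5 := (Real.cos_eq_one_iff_of_lt_of_lt (by nlinarith) (by nlinarith)).1 hcos
  apply hne
  have h6 : ((j : ℕ) : ℝ) = ((j' : ℕ) : ℝ) := by nlinarith
  exact Fin.ext (by exact_mod_cast h6)

end SectorRays

/-! ### Conics tangent to the sides of a sector, and the planar region -/

/-- The level of the `k`-th hole of the `j`-th sector. Different holes have different levels. -/
def level {i : ℕ} (j : Fin (i + 1)) (k : ℕ) : ℝ := k * (i + 1) + (j : ℕ) + 1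

/-- The quadratic polynomial `(1 - c u)² - (u² - cos² δ |x|²) / 64`, where `u` is the coordinate
along the bisector of the `j`-th sector and `δ` half the angle of the sector. Its zero set is a conic
tangent to the sides of the sector at their points with `c u = 1`. The factor `1 / 64` keeps it so
close to the line `c u = 1` that the conics used below are disjoint. -/
def holeForm {i : ℕ} (j : Fin (i + 1)) (c : ℝ) (x : EuclideanSpace ℝ (Fin 2)) : ℝ :=
  (1 - c * alongCoord j x) ^ 2 -
    (alongCoord j x ^ 2 - Real.cos (halfAngle i) ^ 2 * ‖x‖ ^ 2) / 64

/-- The holes: there are `a j - 1` of them in the `j`-th sector. -/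
abbrev Hole {i : ℕ} (a : Fin (i + 1) → ℕ) : Type := Σ j : Fin (i + 1), Fin (a j - 1)

/-- The level of a hole. -/
def Hole.lev {i : ℕ} {a : Fin (i + 1) → ℕ} (h : Hole a) : ℝ := level h.1 h.2

/-- The quadratic polynomial that is negative exactly inside the given hole. -/
def Hole.form {i : ℕ} {a : Fin (i + 1) → ℕ} (h : Hole a) (x : EuclideanSpace ℝ (Fin 2)) : ℝ :=
  holeForm h.1 h.lev x

/-- The inverse of the inner radius of an annulus containing all holes. -/
def innerBound {i : ℕ} (a : Fin (i + 1) → ℕ) : ℝ := 2 + ∑ h : Hole a, h.lev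

/-- The polynomial function that is non-negative exactly on the region between two concentric circles
with all the holes removed. The holes are interior to the annulus of radii `(innerBound a)⁻¹` and
`4`. -/
def regionFun {i : ℕ} (a : Fin (i + 1) → ℕ) (x : EuclideanSpace ℝ (Fin 2)) : ℝ :=
  (16 - ‖x‖ ^ 2) * (innerBound a ^ 2 * ‖x‖ ^ 2 - 1) * ∏ h : Hole a, h.form x

section Holes

variable {i : ℕ} {a : Fin (i + 1) → ℕ}

lemma one_le_level (j : Fin (i + 1)) (k : ℕ) : 1 ≤ level j k := by
  unfold level
  have : (0 : ℝ) ≤ k * (i + 1) + (j : ℕ) := by positivity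
  linarith

lemma level_add_one_le (j : Fin (i + 1)) {k k' : ℕ} (h : k < k') :
    level j k + 1 ≤ level j k' := by
  unfold level
  have h1 : (k : ℝ) + 1 ≤ k' := by exact_mod_cast h
  have h2 : (0 : ℝ) ≤ i := by positivity
  nlinarith

lemma level_mono (j : Fin (i + 1)) {k k' : ℕ} (h : k ≤ k') : level j k ≤ level j k' := by
  rcases h.eq_or_lt with rfl | h
  · exact le_rfl
  · linarith [level_add_one_le j h]

lemma level_injective {j j' : Fin (i + 1)} {k k' : ℕ} (h : level j k = level j' k') :
    j = j' ∧ k = k' := by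
  have h1 : k * (i + 1) + (j : ℕ) = k' * (i + 1) + (j' : ℕ) := by
    unfold level at h
    have : (k : ℝ) * (i + 1) + (j : ℕ) = k' * (i + 1) + (j' : ℕ) := by linarith
    exact_mod_cast this
  have hk : k = k' := by
    have e1 : (k * (i + 1) + (j : ℕ)) / (i + 1) = k := by
      rw [add_comm, Nat.add_mul_div_right _ _ (Nat.succ_pos i), Nat.div_eq_of_lt j.2, zero_add]
    have e2 : (k' * (i + 1) + (j' : ℕ)) / (i + 1) = k' := by
      rw [add_comm, Nat.add_mul_div_right _ _ (Nat.succ_pos i), Nat.div_eq_of_lt j'.2, zero_add]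
    rw [← e1, ← e2, h1]
  subst hk
  exact ⟨Fin.ext (by omega), rfl⟩

lemma Hole.one_le_lev (h : Hole a) : 1 ≤ h.lev := one_le_level _ _

lemma Hole.lev_add_two_le (h : Hole a) : h.lev + 2 ≤ innerBound a := by
  have := Finset.single_le_sum (f := fun h : Hole a => h.lev)
    (fun h _ => zero_le_one.trans h.one_le_lev) (Finset.mem_univ h)
  unfold innerBound
  linarith

lemma two_le_innerBound (a : Fin (i + 1) → ℕ) : 2 ≤ innerBound a := by
  have := Finset.sum_nonneg (s := Finset.univ) (f := fun h : Hole a => h.lev)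
    (fun h _ => zero_le_one.trans h.one_le_lev)
  unfold innerBound
  linarith

/-- The closed hole lies in the closed sector, close to the line `c u = 1`. -/
lemma of_holeForm_nonpos {j : Fin (i + 1)} {c : ℝ} (hc : 1 ≤ c) {x : EuclideanSpace ℝ (Fin 2)}
    (h : holeForm j c x ≤ 0) :
    0 < alongCoord j x ∧ Real.cos (halfAngle i) * ‖x‖ ≤ alongCoord j x ∧
      8 * |1 - c * alongCoord j x| ≤ alongCoord j x := by
  unfold holeForm at h
  set u := alongCoord j x
  have h1 : (8 * (1 - c * u)) ^ 2 ≤ u ^ 2 := by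
    nlinarith [sq_nonneg (Real.cos (halfAngle i) * ‖x‖)]
  have h2 := sq_le_sq.1 h1
  have hu : 0 < u := by
    by_contra hu
    push Not at hu
    rw [abs_of_nonpos hu] at h2
    have := (le_abs_self _).trans h2
    nlinarith
  rw [abs_of_pos hu, abs_mul, abs_of_pos (by norm_num : (0 : ℝ) < 8)] at h2
  refine ⟨hu, abs_le_of_sq_le_sq' ?_ hu.le |>.2, h2⟩
  nlinarith [sq_nonneg (1 - c * u)]

/-- The open hole lies in the open sector. -/
lemma of_holeForm_neg {j : Fin (i + 1)} {c : ℝ} (hc : 1 ≤ c) {x : EuclideanSpace ℝ (Fin 2)}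
    (h : holeForm j c x < 0) : Real.cos (halfAngle i) * ‖x‖ < alongCoord j x := by
  obtain ⟨hu, h1, -⟩ := of_holeForm_nonpos hc h.le
  refine lt_of_le_of_ne h1 fun h2 => ?_
  unfold holeForm at h
  rw [← h2] at h
  nlinarith [sq_nonneg (1 - c * (Real.cos (halfAngle i) * ‖x‖))]

/-- On the boundary of the sector, a conic passes only through its points of tangency. -/
lemma of_holeForm_eq_zero {j : Fin (i + 1)} {c : ℝ} {x : EuclideanSpace ℝ (Fin 2)}
    (h : holeForm j c x = 0) (hx : alongCoord j x = Real.cos (halfAngle i) * ‖x‖) :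
    c * alongCoord j x = 1 := by
  unfold holeForm at h
  rw [hx] at h ⊢
  nlinarith

/-- The closed holes are pairwise disjoint. -/
lemma Hole.eq_of_form_nonpos {h h' : Hole a} {x : EuclideanSpace ℝ (Fin 2)}
    (hx : h.form x ≤ 0) (hx' : h'.form x ≤ 0) : h = h' := by
  obtain ⟨h1, h2, h3⟩ := of_holeForm_nonpos h.one_le_lev hx
  obtain ⟨h1', h2', h3'⟩ := of_holeForm_nonpos h'.one_le_lev hx'
  obtain ⟨j, k⟩ := h
  obtain ⟨j', k'⟩ := h'
  simp only [Hole.form, Hole.lev] at *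
  by_cases hj : j = j'
  · subst hj
    congr 1
    by_contra hk
    have hk' : (k : ℕ) ≠ k' := fun h => hk (Fin.ext h)
    obtain ⟨h4, h5⟩ := abs_le.1 (show |1 - level j k * alongCoord j x| ≤ alongCoord j x / 8 by
      linarith)
    obtain ⟨h6, h7⟩ := abs_le.1 (show |1 - level j k' * alongCoord j x| ≤ alongCoord j x / 8 by
      linarith)
    rcases lt_or_gt_of_ne hk' with hlt | hlt
    · nlinarith [level_add_one_le j hlt]
    · nlinarith [level_add_one_le j hlt]
  · exfalso
    have e1 : alongCoord j x = Real.cos (halfAngle i) * ‖x‖ := by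
      by_contra hne
      exact hj (sector_unique (lt_of_le_of_ne h2 (Ne.symm hne)) h2')
    have e2 : alongCoord j' x = Real.cos (halfAngle i) * ‖x‖ := by
      by_contra hne
      exact hj (sector_unique (lt_of_le_of_ne h2' (Ne.symm hne)) h2).symm
    have key : ∀ (j : Fin (i + 1)) (c : ℝ), holeForm j c x ≤ 0 →
        alongCoord j x = Real.cos (halfAngle i) * ‖x‖ → c * alongCoord j x = 1 := by
      intro j c hc hx
      refine of_holeForm_eq_zero (le_antisymm hc ?_) hx
      unfold holeForm
      rw [hx]
      nlinarith [sq_nonneg (1 - c * (Real.cos (halfAngle i) * ‖x‖))]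
    have e3 := key _ _ hx e1
    have e4 := key _ _ hx' e2
    rw [e2, ← e1] at e4
    exact hj (level_injective (mul_right_cancel₀ h1.ne' (e3.trans e4.symm))).1

/-- The closed holes lie strictly between the two circles. -/
lemma Hole.bounds_of_form_nonpos (hi : 2 ≤ i) {h : Hole a} {x : EuclideanSpace ℝ (Fin 2)}
    (hx : h.form x ≤ 0) : 1 < innerBound a * ‖x‖ ∧ ‖x‖ < 4 := by
  obtain ⟨h1, h2, h3⟩ := of_holeForm_nonpos h.one_le_lev hx
  have hc := h.one_le_lev
  have hB := h.lev_add_two_le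
  have hn := alongCoord_le_norm h.1 x
  have hK := half_le_cos_halfAngle hi
  obtain ⟨h4, h5⟩ := abs_le.1 (show |1 - h.lev * alongCoord h.1 x| ≤ alongCoord h.1 x / 8 by
      linarith)
  have h0 := norm_nonneg x
  have hB0 : 0 ≤ innerBound a := by linarith
  constructor
  · have : (h.lev + 2) * alongCoord h.1 x ≤ innerBound a * ‖x‖ := by gcongr
    nlinarith
  · nlinarith

lemma mul_pos_iff_annulus (a : Fin (i + 1) → ℕ) (x : EuclideanSpace ℝ (Fin 2)) :
    0 ≤ (16 - ‖x‖ ^ 2) * (innerBound a ^ 2 * ‖x‖ ^ 2 - 1) ↔ 1 ≤ innerBound a * ‖x‖ ∧ ‖x‖ ≤ 4 := by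
  have hB := two_le_innerBound a
  have h0 := norm_nonneg x
  have e1 : 0 ≤ 16 - ‖x‖ ^ 2 ↔ ‖x‖ ≤ 4 := by
    constructor <;> intro h <;> nlinarith
  have e2 : 0 ≤ innerBound a ^ 2 * ‖x‖ ^ 2 - 1 ↔ 1 ≤ innerBound a * ‖x‖ := by
    rw [← mul_pow]
    have : 0 ≤ innerBound a * ‖x‖ := by positivity
    constructor <;> intro h <;> nlinarith
  rw [mul_nonneg_iff, e1, e2]
  constructor
  · rintro (⟨h1, h2⟩ | ⟨h1, h2⟩)
    · exact ⟨h2, h1⟩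
    · nlinarith
  · rintro ⟨h1, h2⟩
    exact Or.inl ⟨h2, h1⟩

lemma circles_pos (hi : 2 ≤ i) {h : Hole a} {x : EuclideanSpace ℝ (Fin 2)} (hx : h.form x ≤ 0) :
    0 < (16 - ‖x‖ ^ 2) * (innerBound a ^ 2 * ‖x‖ ^ 2 - 1) := by
  obtain ⟨h1, h2⟩ := Hole.bounds_of_form_nonpos hi hx
  have h0 := norm_nonneg x
  refine mul_pos (by nlinarith) ?_
  rw [← mul_pow]
  nlinarith

/-- The product of all the factors of `regionFun` except the one of the given hole. -/
def Hole.cofactor (h : Hole a) (x : EuclideanSpace ℝ (Fin 2)) : ℝ :=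
  (16 - ‖x‖ ^ 2) * (innerBound a ^ 2 * ‖x‖ ^ 2 - 1) *
    ∏ h' ∈ (Finset.univ : Finset (Hole a)).erase h, h'.form x

lemma regionFun_eq_cofactor_mul (h : Hole a) (x : EuclideanSpace ℝ (Fin 2)) :
    regionFun a x = h.cofactor x * h.form x := by
  unfold regionFun Hole.cofactor
  rw [← Finset.prod_erase_mul _ _ (Finset.mem_univ h)]
  ring

lemma Hole.cofactor_pos (hi : 2 ≤ i) {h : Hole a} {x : EuclideanSpace ℝ (Fin 2)}
    (hx : h.form x ≤ 0) : 0 < h.cofactor x := by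
  refine mul_pos (circles_pos hi hx) (Finset.prod_pos fun h' hh' => ?_)
  by_contra hcon
  exact Finset.ne_of_mem_erase hh' (Hole.eq_of_form_nonpos (not_lt.1 hcon) hx)

/-- The region in which `regionFun` is non-negative. -/
lemma regionFun_nonneg_iff (hi : 2 ≤ i) (x : EuclideanSpace ℝ (Fin 2)) :
    0 ≤ regionFun a x ↔ (1 ≤ innerBound a * ‖x‖ ∧ ‖x‖ ≤ 4) ∧ ∀ h : Hole a, 0 ≤ h.form x := by
  constructor
  · intro hQ
    have hall : ∀ h : Hole a, 0 ≤ h.form x := by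
      intro h
      by_contra hcon
      push Not at hcon
      rw [regionFun_eq_cofactor_mul h] at hQ
      nlinarith [Hole.cofactor_pos hi hcon.le]
    refine ⟨?_, hall⟩
    by_cases hz : ∃ h : Hole a, h.form x = 0
    · obtain ⟨h, hh⟩ := hz
      obtain ⟨h1, h2⟩ := Hole.bounds_of_form_nonpos hi hh.le
      exact ⟨h1.le, h2.le⟩
    · push Not at hz
      have hpos : 0 < ∏ h : Hole a, h.form x :=
        Finset.prod_pos fun h _ => lt_of_le_of_ne (hall h) (Ne.symm (hz h))
      exact (mul_pos_iff_annulus a x).1 (nonneg_of_mul_nonneg_left hQ hpos)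
  · rintro ⟨h1, h2⟩
    exact mul_nonneg ((mul_pos_iff_annulus a x).2 h1) (Finset.prod_nonneg fun h _ => h2 h)

lemma continuous_holeForm (j : Fin (i + 1)) (c : ℝ) : Continuous (holeForm j c) := by
  have := continuous_alongCoord j
  unfold holeForm
  fun_prop

lemma contDiff_holeForm (j : Fin (i + 1)) (c : ℝ) : ContDiff ℝ ∞ (holeForm j c) := by
  have := contDiff_alongCoord j
  have h2 : ContDiff ℝ ∞ fun x : EuclideanSpace ℝ (Fin 2) => ‖x‖ ^ 2 := contDiff_norm_sq ℝ
  unfold holeForm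
  fun_prop

lemma contDiff_circles (a : Fin (i + 1) → ℕ) :
    ContDiff ℝ ∞ fun x : EuclideanSpace ℝ (Fin 2) =>
      (16 - ‖x‖ ^ 2) * (innerBound a ^ 2 * ‖x‖ ^ 2 - 1) := by
  have h2 : ContDiff ℝ ∞ fun x : EuclideanSpace ℝ (Fin 2) => ‖x‖ ^ 2 := contDiff_norm_sq ℝ
  fun_prop

lemma contDiff_regionFun (a : Fin (i + 1) → ℕ) : ContDiff ℝ ∞ (regionFun a) :=
  (contDiff_circles a).mul (contDiff_prod fun _ _ => contDiff_holeForm _ _)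

lemma Hole.contDiff_cofactor (h : Hole a) : ContDiff ℝ ∞ h.cofactor :=
  (contDiff_circles a).mul (contDiff_prod fun _ _ => contDiff_holeForm _ _)

end Holes

/-! ### The channels between the holes -/

/-- The closed part of the `j`-th sector between the `(l - 1)`-st and the `l`-th hole, counted towards
the origin. -/
def InChannel {i : ℕ} (a : Fin (i + 1) → ℕ) (j : Fin (i + 1)) (l : ℕ)
    (x : EuclideanSpace ℝ (Fin 2)) : Prop :=
  Real.cos (halfAngle i) * ‖x‖ ≤ alongCoord j x ∧ ∀ k < a j - 1,
    (k < l → level j k * alongCoord j x ≤ 1) ∧ (l ≤ k → 1 ≤ level j k * alongCoord j x)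

section Channels

variable {i : ℕ} {a : Fin (i + 1) → ℕ}

lemma isClosed_inChannel (j : Fin (i + 1)) (l : ℕ) : IsClosed {x | InChannel a j l x} := by
  have h1 := continuous_alongCoord j
  have h2 : {x | InChannel a j l x} = {x | Real.cos (halfAngle i) * ‖x‖ ≤ alongCoord j x} ∩
      ⋂ k, ⋂ (_ : k < a j - 1), ((⋂ (_ : k < l), {x | level j k * alongCoord j x ≤ 1}) ∩
        ⋂ (_ : l ≤ k), {x | 1 ≤ level j k * alongCoord j x}) := by
    ext x
    simp [InChannel]
  rw [h2]
  refine (isClosed_le (by fun_prop) h1).inter (isClosed_iInter fun k => isClosed_iInter fun _ =>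
    (isClosed_iInter fun _ => isClosed_le (by fun_prop) (by fun_prop)).inter
      (isClosed_iInter fun _ => isClosed_le (by fun_prop) (by fun_prop)))

/-- The channels cover the closed sector. -/
lemma exists_inChannel (ha : ∀ j, 0 < a j) {j : Fin (i + 1)} {x : EuclideanSpace ℝ (Fin 2)}
    (hx : Real.cos (halfAngle i) * ‖x‖ ≤ alongCoord j x) (hx0 : 0 ≤ alongCoord j x) :
    ∃ l : Fin (a j), InChannel a j l x := by
  classical
  have hex : ∃ l : ℕ, a j - 1 ≤ l ∨ 1 ≤ level j l * alongCoord j x := ⟨_, Or.inl le_rfl⟩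
  have hmin : Nat.find hex ≤ a j - 1 := Nat.find_min' hex (Or.inl le_rfl)
  refine ⟨⟨Nat.find hex, by have := ha j; omega⟩, hx, fun k hk => ⟨fun hkl => ?_, fun hkl => ?_⟩⟩
  · have := Nat.find_min hex hkl
    push Not at this
    exact this.2.le
  · have h1 : 1 ≤ level j (Nat.find hex) * alongCoord j x := by
      rcases Nat.find_spec hex with h | h
      · simp only at hkl
        omega
      · exact h
    exact h1.trans (mul_le_mul_of_nonneg_right (level_mono j hkl) hx0)

/-- Two channels of the same sector meet only on its boundary and in the holes. -/
lemma InChannel.eq_of_lt (hi : 2 ≤ i) {j : Fin (i + 1)} {l l' : ℕ} {x : EuclideanSpace ℝ (Fin 2)}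
    (h : InChannel a j l x) (h' : InChannel a j l' x) (hl : l < l') (hl' : l' < a j)
    (hx : ∀ h : Hole a, 0 ≤ h.form x) :
    alongCoord j x = Real.cos (halfAngle i) * ‖x‖ := by
  have hk : l < a j - 1 := by omega
  have h1 : level j l * alongCoord j x = 1 :=
    le_antisymm ((h'.2 l hk).1 hl) ((h.2 l hk).2 le_rfl)
  have h2 := hx ⟨j, ⟨l, hk⟩⟩
  simp only [Hole.form, Hole.lev, holeForm] at h2
  rw [h1] at h2
  refine le_antisymm ?_ h.1
  by_contra hcon
  push Not at hcon
  have hK : 0 ≤ Real.cos (halfAngle i) * ‖x‖ :=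
    mul_nonneg (by linarith [half_le_cos_halfAngle hi]) (norm_nonneg x)
  nlinarith

/-- In the closed `j`-th sector, only the holes of this sector matter. -/
lemma Hole.form_nonneg_of_ne {j : Fin (i + 1)} {x : EuclideanSpace ℝ (Fin 2)}
    (hx : Real.cos (halfAngle i) * ‖x‖ ≤ alongCoord j x) {h : Hole a} (hh : h.1 ≠ j) :
    0 ≤ h.form x := by
  by_contra hcon
  push Not at hcon
  exact hh (sector_unique (of_holeForm_neg h.one_le_lev hcon) hx)

/-- On the rays between the sectors, the region is the whole segment between the circles. -/
lemma regionFun_sectorRay_nonneg (hi : 2 ≤ i) (j : Fin (i + 1)) {ρ : ℝ}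
    (h1 : 1 ≤ innerBound a * ρ) (h4 : ρ ≤ 4) : 0 ≤ regionFun a (ρ • sectorRay j) := by
  have hρ : 0 ≤ ρ := by
    by_contra hcon
    push Not at hcon
    nlinarith [two_le_innerBound a]
  have hn : ‖ρ • sectorRay j‖ = ρ := by
    rw [norm_smul, norm_sectorRay, mul_one, Real.norm_of_nonneg hρ]
  rw [regionFun_nonneg_iff hi, hn]
  refine ⟨⟨h1, h4⟩, fun h => ?_⟩
  by_contra hcon
  push Not at hcon
  have h2 := of_holeForm_neg h.one_le_lev hcon
  rw [hn, alongCoord_smul, mul_comm] at h2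
  exact absurd (alongCoord_sectorRay_le j h.1) (not_le.2 (lt_of_mul_lt_mul_left h2 hρ))

/-- On a ray of the closed `j`-th sector, the points of the region in a channel form an interval,
described by linear inequalities. Here `n` is the coordinate along the bisector of the unit vector
of the ray, and the `k`-th hole meets the ray where `|1 - level j k * n * ρ| < w * ρ`. -/
lemma channel_ray_iff (hi : 2 ≤ i) {j : Fin (i + 1)} {l : ℕ} {z : EuclideanSpace ℝ (Fin 2)}
    (hz : ‖z‖ = 1) (hzj : Real.cos (halfAngle i) ≤ alongCoord j z) {w : ℝ} (hw : 0 ≤ w)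
    (hw2 : w ^ 2 = (alongCoord j z ^ 2 - Real.cos (halfAngle i) ^ 2) / 64) {ρ : ℝ} (hρ : 0 < ρ) :
    (InChannel a j l (ρ • z) ∧ 0 ≤ regionFun a (ρ • z)) ↔
      (1 ≤ innerBound a * ρ ∧ ρ ≤ 4) ∧ ∀ k < a j - 1,
        (k < l → (level j k * alongCoord j z + w) * ρ ≤ 1) ∧
        (l ≤ k → 1 ≤ (level j k * alongCoord j z - w) * ρ) := by
  have hn : ‖ρ • z‖ = ρ := by rw [norm_smul, hz, mul_one, Real.norm_of_nonneg hρ.le]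
  have hsec : Real.cos (halfAngle i) * ‖ρ • z‖ ≤ alongCoord j (ρ • z) := by
    rw [hn, alongCoord_smul, mul_comm]
    exact mul_le_mul_of_nonneg_left hzj hρ.le
  have hform : ∀ k, holeForm j (level j k) (ρ • z) =
      (1 - level j k * (ρ * alongCoord j z)) ^ 2 - (w * ρ) ^ 2 := by
    intro k
    rw [holeForm, hn, alongCoord_smul, mul_pow w, hw2]
    ring
  have hwρ : 0 ≤ w * ρ := by positivity
  constructor
  · rintro ⟨h1, h2⟩
    rw [regionFun_nonneg_iff hi, hn] at h2
    refine ⟨h2.1, fun k hk => ?_⟩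
    have h3 := h2.2 ⟨j, ⟨k, hk⟩⟩
    simp only [Hole.form, Hole.lev] at h3
    rw [hform, sub_nonneg] at h3
    have h4 := h1.2 k hk
    rw [alongCoord_smul] at h4
    constructor
    · intro hkl
      have := abs_le_of_sq_le_sq' h3 (by linarith [h4.1 hkl])
      linarith
    · intro hkl
      rw [← neg_sq (1 - _)] at h3
      have := abs_le_of_sq_le_sq' h3 (by linarith [h4.2 hkl])
      linarith
  · rintro ⟨h1, h2⟩
    refine ⟨⟨hsec, fun k hk => ?_⟩, ?_⟩
    · rw [alongCoord_smul]
      constructor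
      · intro hkl
        linarith [(h2 k hk).1 hkl]
      · intro hkl
        linarith [(h2 k hk).2 hkl]
    · rw [regionFun_nonneg_iff hi, hn]
      refine ⟨h1, fun h => ?_⟩
      by_cases hj : h.1 = j
      · obtain ⟨j', ⟨k, hk⟩⟩ := h
        simp only at hj
        subst hj
        simp only [Hole.form, Hole.lev]
        rw [hform, sub_nonneg]
        rcases lt_or_ge k l with hkl | hkl
        · exact pow_le_pow_left₀ hwρ (by linarith [(h2 k hk).1 hkl]) 2
        · rw [← neg_sq (1 - _)]
          exact pow_le_pow_left₀ hwρ (by linarith [(h2 k hk).2 hkl]) 2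
      · exact Hole.form_nonneg_of_ne hsec hj

/-- On each ray of the closed `j`-th sector, the part of the region in a given channel is an interval
whose outer end lies on the boundary of the region. -/
lemma exists_channel_end (hi : 2 ≤ i) {j : Fin (i + 1)} {l : ℕ} (hl : l < a j)
    {z : EuclideanSpace ℝ (Fin 2)} (hz : ‖z‖ = 1)
    (hzj : Real.cos (halfAngle i) ≤ alongCoord j z) :
    ∃ ρ₀ : ℝ, 0 < ρ₀ ∧ regionFun a (ρ₀ • z) = 0 ∧ InChannel a j l (ρ₀ • z) ∧
      ∀ ρ : ℝ, 0 < ρ → InChannel a j l (ρ • z) → 0 ≤ regionFun a (ρ • z) →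
        ∀ ρ' ∈ uIcc ρ₀ ρ, 0 < ρ' ∧ InChannel a j l (ρ' • z) ∧ 0 ≤ regionFun a (ρ' • z) := by
  have hK := half_le_cos_halfAngle hi
  set n := alongCoord j z with hn
  have hn1 : n ≤ 1 := hz ▸ alongCoord_le_norm j z
  have hdisc : 0 ≤ (n ^ 2 - Real.cos (halfAngle i) ^ 2) / 64 := by nlinarith
  obtain ⟨w, hw, hw2⟩ : ∃ w : ℝ, 0 ≤ w ∧ w ^ 2 = (n ^ 2 - Real.cos (halfAngle i) ^ 2) / 64 :=
    ⟨_, Real.sqrt_nonneg _, Real.sq_sqrt hdisc⟩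
  have hwn : 8 * w ≤ n := by
    refine abs_le_of_sq_le_sq' ?_ (by linarith) |>.2
    nlinarith
  have hB := two_le_innerBound a
  obtain ⟨ρ₀, hρ₀, hQ, hend⟩ : ∃ ρ₀ : ℝ, 0 < ρ₀ ∧ regionFun a (ρ₀ • z) = 0 ∧
      ((1 ≤ innerBound a * ρ₀ ∧ ρ₀ ≤ 4) ∧ ∀ k < a j - 1,
        (k < l → (level j k * n + w) * ρ₀ ≤ 1) ∧
        (l ≤ k → 1 ≤ (level j k * n - w) * ρ₀)) := by
    rcases Nat.eq_zero_or_pos l with h0 | h0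
    · -- The outermost channel ends on the outer circle.
      subst h0
      refine ⟨4, by norm_num, ?_, ⟨by linarith, le_rfl⟩, fun k _ => ⟨fun h => absurd h (by omega),
        fun _ => ?_⟩⟩
      · rw [regionFun, norm_smul, hz]
        norm_num
      · nlinarith [one_le_level j k]
    · -- The other channels end where the ray, followed towards the origin, leaves the preceding hole.
      have hl1 : l - 1 < a j - 1 := by omega
      set c := level j (l - 1) with hc
      have hc1 : 1 ≤ c := one_le_level _ _
      have hpos : 0 < c * n + w := by nlinarith
      have hcB : c + 2 ≤ innerBound a :=
        Hole.lev_add_two_le (a := a) ⟨j, ⟨l - 1, hl1⟩⟩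
      refine ⟨(c * n + w)⁻¹, by positivity, ?_, ⟨?_, ?_⟩, fun k _ => ⟨fun hkl => ?_, fun hkl => ?_⟩⟩
      · rw [regionFun_eq_cofactor_mul ⟨j, ⟨l - 1, hl1⟩⟩]
        simp only [Hole.form, Hole.lev, holeForm]
        rw [norm_smul, hz, alongCoord_smul, mul_one, Real.norm_of_nonneg (by positivity), ← hn, ← hc]
        have : (c * n + w)⁻¹ * (c * n + w) = 1 := inv_mul_cancel₀ hpos.ne'
        have e : (1 - c * ((c * n + w)⁻¹ * n)) = (c * n + w)⁻¹ * w := by linear_combination -this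
        rw [e, mul_pow, hw2]
        ring
      · rw [← div_eq_mul_inv, one_le_div hpos]
        nlinarith
      · rw [inv_le_comm₀ hpos (by norm_num)]
        nlinarith
      · rw [← div_eq_mul_inv, div_le_one hpos]
        nlinarith [level_mono j (show k ≤ l - 1 by omega)]
      · rw [← div_eq_mul_inv, one_le_div hpos]
        nlinarith [level_add_one_le j (show l - 1 < k by omega)]
  have hiff := fun (ρ : ℝ) (hρ : 0 < ρ) =>
    channel_ray_iff (a := a) (l := l) hi hz hzj hw hw2 hρ
  refine ⟨ρ₀, hρ₀, hQ, ((hiff ρ₀ hρ₀).2 hend).1, fun ρ hρ h1 h2 ρ' hρ' => ?_⟩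
  have h3 := (hiff ρ hρ).1 ⟨h1, h2⟩
  obtain ⟨h4, h5⟩ := mem_uIcc.1 hρ' |>.elim
    (fun h => (⟨(min_le_left _ _).trans h.1, h.2.trans (le_max_right _ _)⟩ :
      min ρ₀ ρ ≤ ρ' ∧ ρ' ≤ max ρ₀ ρ))
    (fun h => ⟨(min_le_right _ _).trans h.1, h.2.trans (le_max_left _ _)⟩)
  have hpos : 0 < ρ' := (lt_min hρ₀ hρ).trans_le h4
  refine ⟨hpos, (hiff ρ' hpos).2 ⟨⟨?_, ?_⟩, fun k hk => ⟨fun hkl => ?_, fun hkl => ?_⟩⟩⟩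
  · rcases min_choice ρ₀ ρ with h | h <;> rw [h] at h4 <;> nlinarith [hend.1.1, h3.1.1]
  · exact h5.trans (max_le hend.1.2 h3.1.2)
  · have : 0 ≤ level j k * n + w := by nlinarith [one_le_level j k]
    rcases max_choice ρ₀ ρ with h | h <;> rw [h] at h5 <;>
      nlinarith [(hend.2 k hk).1 hkl, (h3.2 k hk).1 hkl]
  · have : 0 ≤ level j k * n - w := by nlinarith [one_le_level j k]
    rcases min_choice ρ₀ ρ with h | h <;> rw [h] at h4 <;>
      nlinarith [(hend.2 k hk).2 hkl, (h3.2 k hk).2 hkl]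

end Channels

/-! ### Splitting the ambient space into a plane and its complement -/

section Parts

variable {k : ℕ}

/-- The first two coordinates of a point. -/
def planePart (p : EuclideanSpace ℝ (Fin (k + 2))) : EuclideanSpace ℝ (Fin 2) := !₂[p 0, p 1]

/-- All coordinates of a point except the first two. -/
def fibrePart (p : EuclideanSpace ℝ (Fin (k + 2))) : EuclideanSpace ℝ (Fin k) :=
  WithLp.toLp 2 fun l => p l.succ.succ

/-- The point with given first two coordinates and given remaining coordinates. -/
def joinParts (x : EuclideanSpace ℝ (Fin 2)) (y : EuclideanSpace ℝ (Fin k)) :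
    EuclideanSpace ℝ (Fin (k + 2)) :=
  WithLp.toLp 2 (Fin.cons (x 0) (Fin.cons (x 1) fun l => y l))

@[simp] lemma planePart_apply_zero (p : EuclideanSpace ℝ (Fin (k + 2))) :
    planePart p 0 = p 0 := rfl

@[simp] lemma planePart_apply_one (p : EuclideanSpace ℝ (Fin (k + 2))) :
    planePart p 1 = p 1 := rfl

@[simp] lemma fibrePart_apply (p : EuclideanSpace ℝ (Fin (k + 2))) (l : Fin k) :
    fibrePart p l = p l.succ.succ := rfl

@[simp] lemma planePart_joinParts (x : EuclideanSpace ℝ (Fin 2)) (y : EuclideanSpace ℝ (Fin k)) :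
    planePart (joinParts x y) = x := by
  ext l
  fin_cases l <;> rfl

@[simp] lemma fibrePart_joinParts (x : EuclideanSpace ℝ (Fin 2)) (y : EuclideanSpace ℝ (Fin k)) :
    fibrePart (joinParts x y) = y := by
  ext l
  rfl

@[simp] lemma joinParts_parts (p : EuclideanSpace ℝ (Fin (k + 2))) :
    joinParts (planePart p) (fibrePart p) = p := by
  ext l
  refine Fin.cases rfl (fun l => Fin.cases rfl (fun l => rfl) l) l

lemma planePart_add_smul (p v : EuclideanSpace ℝ (Fin (k + 2))) (t : ℝ) :
    planePart (p + t • v) = planePart p + t • planePart v := by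
  ext l
  fin_cases l <;> rfl

lemma fibrePart_add_smul (p v : EuclideanSpace ℝ (Fin (k + 2))) (t : ℝ) :
    fibrePart (p + t • v) = fibrePart p + t • fibrePart v := by
  ext l
  rfl

lemma norm_sq_eq_parts (p : EuclideanSpace ℝ (Fin (k + 2))) :
    ‖p‖ ^ 2 = ‖planePart p‖ ^ 2 + ‖fibrePart p‖ ^ 2 := by
  rw [norm_sq_plane, EuclideanSpace.norm_sq_eq, EuclideanSpace.norm_sq_eq, Fin.sum_univ_succ,
    Fin.sum_univ_succ]
  simp [add_assoc]

lemma contDiff_planePart : ContDiff ℝ ∞ (planePart (k := k)) := by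
  rw [contDiff_euclidean]
  intro l
  fin_cases l
  · change ContDiff ℝ ∞ fun p : EuclideanSpace ℝ (Fin (k + 2)) => p 0
    fun_prop
  · change ContDiff ℝ ∞ fun p : EuclideanSpace ℝ (Fin (k + 2)) => p 1
    fun_prop

lemma contDiff_fibrePart : ContDiff ℝ ∞ (fibrePart (k := k)) := by
  rw [contDiff_euclidean]
  intro l
  change ContDiff ℝ ∞ fun p : EuclideanSpace ℝ (Fin (k + 2)) => p l.succ.succ
  fun_prop

lemma contDiff_joinParts : ContDiff ℝ ∞
    fun q : EuclideanSpace ℝ (Fin 2) × EuclideanSpace ℝ (Fin k) => joinParts q.1 q.2 := by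
  rw [contDiff_euclidean]
  intro l
  refine Fin.cases ?_ (fun l => Fin.cases ?_ (fun l => ?_) l) l
  · change ContDiff ℝ ∞ fun q : EuclideanSpace ℝ (Fin 2) × EuclideanSpace ℝ (Fin k) => q.1 0
    fun_prop
  · change ContDiff ℝ ∞ fun q : EuclideanSpace ℝ (Fin 2) × EuclideanSpace ℝ (Fin k) => q.1 1
    fun_prop
  · change ContDiff ℝ ∞ fun q : EuclideanSpace ℝ (Fin 2) × EuclideanSpace ℝ (Fin k) => q.2 l
    fun_prop

lemma continuous_planePart : Continuous (planePart (k := k)) := contDiff_planePart.continuous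

lemma continuous_fibrePart : Continuous (fibrePart (k := k)) := contDiff_fibrePart.continuous

end Parts

/-! ### The defining polynomial -/

section Polynomial

open MvPolynomial

variable {i : ℕ} {a : Fin (i + 1) → ℕ} {k : ℕ}

/-- The squared norm of the first two coordinates, as a polynomial. -/
def normSqPoly (k : ℕ) : MvPolynomial (Fin (k + 2)) ℝ := X 0 ^ 2 + X 1 ^ 2

/-- The polynomial form of `alongCoord`. -/
def alongPoly (k : ℕ) (j : Fin (i + 1)) : MvPolynomial (Fin (k + 2)) ℝ :=
  C (Real.cos (bisectorAngle j)) * X 0 + C (Real.sin (bisectorAngle j)) * X 1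

/-- The polynomial form of `Hole.form`. -/
def Hole.poly (k : ℕ) (h : Hole a) : MvPolynomial (Fin (k + 2)) ℝ :=
  (1 - C h.lev * alongPoly k h.1) ^ 2 -
    C (1 / 64) * (alongPoly k h.1 ^ 2 - C (Real.cos (halfAngle i) ^ 2) * normSqPoly k)

/-- The polynomial whose zero set is the set of `(x, y)` with `regionFun a x = |y|²`. -/
def manifoldPoly (a : Fin (i + 1) → ℕ) (k : ℕ) : MvPolynomial (Fin (k + 2)) ℝ :=
  (C 16 - normSqPoly k) * (C (innerBound a ^ 2) * normSqPoly k - 1) * ∏ h : Hole a, h.poly k -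
    ∑ l : Fin k, X l.succ.succ ^ 2

@[simp] lemma eval_normSqPoly (p : EuclideanSpace ℝ (Fin (k + 2))) :
    eval (fun l => p l) (normSqPoly k) = ‖planePart p‖ ^ 2 := by
  simp [normSqPoly, norm_sq_plane]

lemma eval_holePoly (h : Hole a) (p : EuclideanSpace ℝ (Fin (k + 2))) :
    eval (fun l => p l) (h.poly k) = h.form (planePart p) := by
  simp [Hole.poly, alongPoly, Hole.form, holeForm, alongCoord]
  ring

lemma eval_manifoldPoly (a : Fin (i + 1) → ℕ) (p : EuclideanSpace ℝ (Fin (k + 2))) :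
    eval (fun l => p l) (manifoldPoly a k) = regionFun a (planePart p) - ‖fibrePart p‖ ^ 2 := by
  simp [manifoldPoly, regionFun, eval_holePoly, EuclideanSpace.norm_sq_eq]

lemma mem_manifold_iff {p : EuclideanSpace ℝ (Fin (k + 2))} :
    p ∈ polyZeroSet (manifoldPoly a k) ↔ regionFun a (planePart p) = ‖fibrePart p‖ ^ 2 := by
  rw [polyZeroSet, mem_ofPred_eq, eval_manifoldPoly, sub_eq_zero]

lemma joinParts_mem_manifold_iff {x : EuclideanSpace ℝ (Fin 2)} {y : EuclideanSpace ℝ (Fin k)} :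
    joinParts x y ∈ polyZeroSet (manifoldPoly a k) ↔ regionFun a x = ‖y‖ ^ 2 := by
  rw [mem_manifold_iff, planePart_joinParts, fibrePart_joinParts]

lemma regionFun_nonneg_of_mem {p : EuclideanSpace ℝ (Fin (k + 2))}
    (hp : p ∈ polyZeroSet (manifoldPoly a k)) : 0 ≤ regionFun a (planePart p) := by
  rw [mem_manifold_iff.1 hp]; positivity

lemma norm_pos_of_regionFun_nonneg (hi : 2 ≤ i) {x : EuclideanSpace ℝ (Fin 2)}
    (h : 0 ≤ regionFun a x) : 0 < ‖x‖ := by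
  have h1 := ((regionFun_nonneg_iff hi x).1 h).1.1
  by_contra hcon
  have : ‖x‖ = 0 := le_antisymm (not_lt.1 hcon) (norm_nonneg x)
  rw [this] at h1
  linarith

lemma norm_planePart_pos (hi : 2 ≤ i) {p : EuclideanSpace ℝ (Fin (k + 2))}
    (hp : p ∈ polyZeroSet (manifoldPoly a k)) : 0 < ‖planePart p‖ :=
  norm_pos_of_regionFun_nonneg hi (regionFun_nonneg_of_mem hp)

lemma isCompact_manifold (hi : 2 ≤ i) (a : Fin (i + 1) → ℕ) (k : ℕ) :
    IsCompact (polyZeroSet (manifoldPoly a k)) := by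
  have hcl : IsClosed (polyZeroSet (manifoldPoly a k)) := by
    have : polyZeroSet (manifoldPoly a k) =
        {p | regionFun a (planePart p) = ‖fibrePart p‖ ^ 2} := by
      ext p
      exact mem_manifold_iff
    rw [this]
    exact isClosed_eq ((contDiff_regionFun a).continuous.comp continuous_planePart)
      (continuous_fibrePart.norm.pow 2)
  obtain ⟨R, hR⟩ := (isCompact_closedBall (0 : EuclideanSpace ℝ (Fin 2)) 4).bddAbove_image
    (contDiff_regionFun a).continuous.continuousOn
  refine Metric.isCompact_of_isClosed_isBounded hcl
    (Metric.isBounded_closedBall (x := 0) (r := 17 + R) |>.subset fun p hp => ?_)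
  have h4 := ((regionFun_nonneg_iff hi _).1 (regionFun_nonneg_of_mem hp)).1.2
  have h5 : regionFun a (planePart p) ≤ R := hR ⟨_, by simpa using h4, rfl⟩
  have h6 := mem_manifold_iff.1 hp
  have h7 := norm_sq_eq_parts p
  rw [mem_closedBall_zero_iff]
  nlinarith [norm_nonneg p, norm_nonneg (planePart p), sq_nonneg (‖fibrePart p‖)]

lemma natDegree_finset_prod_quadratic {ι : Type*} (s : Finset ι) (f : ι → Polynomial ℝ)
    (hf : ∀ x ∈ s, (f x).natDegree = 2) : (∏ x ∈ s, f x).natDegree = 2 * s.card := by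
  rw [Polynomial.natDegree_prod _ _ fun x hx h0 => by simpa [h0] using hf x hx,
    Finset.sum_congr rfl hf, Finset.sum_const, smul_eq_mul, mul_comm]

lemma card_hole (a : Fin (i + 1) → ℕ) : Fintype.card (Hole a) = ∑ j, (a j - 1) := by
  simp [Hole]

lemma totalDegree_normSqPoly_le : (normSqPoly k).totalDegree ≤ 2 := by
  refine (totalDegree_add _ _).trans (max_le ?_ ?_) <;> simp

lemma totalDegree_alongPoly_le (j : Fin (i + 1)) : (alongPoly k j).totalDegree ≤ 1 := by
  refine (totalDegree_add _ _).trans (max_le ?_ ?_) <;>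
  · refine (totalDegree_mul _ _).trans ?_
    simp

lemma totalDegree_holePoly_le (h : Hole a) : (h.poly k).totalDegree ≤ 2 := by
  have h1 := totalDegree_alongPoly_le (k := k) h.1
  have h2 := totalDegree_normSqPoly_le (k := k)
  have hC : ∀ (r : ℝ) (q : MvPolynomial (Fin (k + 2)) ℝ), (C r * q).totalDegree ≤ q.totalDegree :=
    fun r q => (totalDegree_mul _ _).trans (by simp)
  refine (totalDegree_sub _ _).trans (max_le ?_ ?_)
  · refine (totalDegree_pow _ _).trans ?_
    have : (1 - C h.lev * alongPoly k h.1).totalDegree ≤ 1 :=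
      (totalDegree_sub _ _).trans (max_le (by simp) ((hC _ _).trans h1))
    omega
  · refine (hC _ _).trans ((totalDegree_sub _ _).trans (max_le ?_ ((hC _ _).trans h2)))
    refine (totalDegree_pow _ _).trans ?_
    omega

lemma totalDegree_manifoldPoly (hi : 2 ≤ i) (a : Fin (i + 1) → ℕ) (k : ℕ) :
    (manifoldPoly a k).totalDegree = 2 * (∑ j, (a j - 1)) + 4 := by
  apply le_antisymm
  · refine (totalDegree_sub _ _).trans (max_le ?_ ?_)
    · have h2 := totalDegree_normSqPoly_le (k := k)
      have h3 : (∏ h : Hole a, h.poly k).totalDegree ≤ 2 * ∑ j, (a j - 1) := by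
        refine (totalDegree_finsetProd _ _).trans ?_
        refine (Finset.sum_le_sum fun h _ => totalDegree_holePoly_le h).trans ?_
        rw [Finset.sum_const, Finset.card_univ, card_hole, smul_eq_mul, mul_comm]
      have h4 : (C 16 - normSqPoly k).totalDegree ≤ 2 :=
        (totalDegree_sub _ _).trans (max_le (by simp) h2)
      have h5 : (C (innerBound a ^ 2) * normSqPoly k - 1).totalDegree ≤ 2 :=
        (totalDegree_sub _ _).trans
          (max_le ((totalDegree_mul _ _).trans (by rw [totalDegree_C]; omega)) (by simp))
      refine (totalDegree_mul _ _).trans ?_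
      have h6 := totalDegree_mul (C 16 - normSqPoly k) (C (innerBound a ^ 2) * normSqPoly k - 1)
      omega
    · refine (totalDegree_finsetSum _ _).trans (Finset.sup_le fun l _ => ?_)
      rw [totalDegree_X_pow]
      omega
  · -- On the first coordinate axis every factor of `regionFun` restricts to a quadratic polynomial.
    set f : Fin (k + 2) → Polynomial ℝ := fun l => if l = 0 then Polynomial.X else 0 with hf
    have hf0 : f 0 = Polynomial.X := by simp [hf]
    have hfs : ∀ l : Fin (k + 1), f l.succ = 0 := fun l => by simp [hf]
    have hf1 : f 1 = 0 := hfs 0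
    have hdeg := aeval_natDegree_le (n := 1) (manifoldPoly a k) le_rfl f fun l => by
      by_cases hl : l = 0 <;> simp [hf, hl]
    rw [mul_one] at hdeg
    refine le_trans (le_of_eq ?_) hdeg
    have hK := half_le_cos_halfAngle hi
    have hB := two_le_innerBound a
    have hn : aeval f (normSqPoly k) = Polynomial.X ^ 2 := by simp [normSqPoly, hf0, hf1]
    have hu : ∀ j : Fin (i + 1), aeval f (alongPoly k j) =
        Polynomial.C (Real.cos (bisectorAngle j)) * Polynomial.X := by
      intro j
      simp [alongPoly, hf0, hf1, Polynomial.C_eq_algebraMap]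
    have e1 : (aeval f (C 16 - normSqPoly k)).natDegree = 2 := by
      rw [show aeval f (C 16 - normSqPoly k) = Polynomial.C (-1) * Polynomial.X ^ 2 +
        Polynomial.C 0 * Polynomial.X + Polynomial.C 16 by
          rw [map_sub, hn, aeval_C, ← Polynomial.C_eq_algebraMap]; simp; ring]
      exact Polynomial.natDegree_quadratic (by norm_num)
    have e2 : (aeval f (C (innerBound a ^ 2) * normSqPoly k - 1)).natDegree = 2 := by
      rw [show aeval f (C (innerBound a ^ 2) * normSqPoly k - 1) =
        Polynomial.C (innerBound a ^ 2) * Polynomial.X ^ 2 +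
        Polynomial.C 0 * Polynomial.X + Polynomial.C (-1) by
          rw [map_sub, map_mul, hn, aeval_C, ← Polynomial.C_eq_algebraMap]; simp; ring]
      exact Polynomial.natDegree_quadratic (by positivity)
    have e3 : ∀ h ∈ (Finset.univ : Finset (Hole a)), (aeval f (h.poly k)).natDegree = 2 := by
      intro h _
      have hc : 1 ≤ h.lev := h.one_le_lev
      rw [show aeval f (h.poly k) =
        Polynomial.C (h.lev ^ 2 * Real.cos (bisectorAngle h.1) ^ 2 - 1 / 64 *
          (Real.cos (bisectorAngle h.1) ^ 2 - Real.cos (halfAngle i) ^ 2)) * Polynomial.X ^ 2 +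
          Polynomial.C (-2 * h.lev * Real.cos (bisectorAngle h.1)) * Polynomial.X +
          Polynomial.C 1 by
          rw [Hole.poly]
          simp only [map_sub, map_mul, map_pow, hn, hu, aeval_C, ← Polynomial.C_eq_algebraMap,
            map_one, map_ofNat, map_neg]
          ring]
      refine Polynomial.natDegree_quadratic (ne_of_gt ?_)
      have : Real.cos (bisectorAngle h.1) ^ 2 ≤ h.lev ^ 2 * Real.cos (bisectorAngle h.1) ^ 2 :=
        le_mul_of_one_le_left (sq_nonneg _) (one_le_pow₀ hc)
      nlinarith [sq_nonneg (Real.cos (bisectorAngle h.1))]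
    have e4 : aeval f (∑ l : Fin k, (X l.succ.succ : MvPolynomial (Fin (k + 2)) ℝ) ^ 2) = 0 := by
      simp [hfs]
    have e5 := natDegree_finset_prod_quadratic Finset.univ _ e3
    rw [Finset.card_univ, card_hole] at e5
    rw [manifoldPoly, map_sub, e4, sub_zero, map_mul, map_mul, map_prod,
      Polynomial.natDegree_mul, Polynomial.natDegree_mul, e1, e2, e5]
    · ring
    · exact Polynomial.ne_zero_of_natDegree_gt (n := 0) (by omega)
    · exact Polynomial.ne_zero_of_natDegree_gt (n := 0) (by omega)
    · exact mul_ne_zero (Polynomial.ne_zero_of_natDegree_gt (n := 0) (by omega))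
        (Polynomial.ne_zero_of_natDegree_gt (n := 0) (by omega))
    · exact Finset.prod_ne_zero_iff.2 fun h hh =>
        Polynomial.ne_zero_of_natDegree_gt (n := 0) (by rw [e3 h hh]; norm_num)

/-- The derivative of a polynomial function along a line. -/
lemma hasDerivAt_eval_line {k : ℕ} (P : MvPolynomial (Fin k) ℝ) (p v : EuclideanSpace ℝ (Fin k)) :
    HasDerivAt (fun t : ℝ => eval (fun l => (p + t • v) l) P)
      (∑ l, v l * eval (fun l => p l) (pderiv l P)) 0 := by
  induction P using MvPolynomial.induction_on with
  | C r => simpa using hasDerivAt_const (0 : ℝ) r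
  | add P Q hP hQ =>
    simpa [mul_add, Finset.sum_add_distrib] using hP.fun_add hQ
  | mul_X P j hP =>
    have hX : HasDerivAt (fun t : ℝ => (p + t • v) j) (v j) 0 := by
      simpa using ((hasDerivAt_id (0 : ℝ)).mul_const (v j)).const_add (p j)
    have hm := hP.fun_mul hX
    simp only [zero_smul, add_zero] at hm
    have e : ∑ l, v l * eval (fun l => p l) (pderiv l (P * X j)) =
        (∑ l, v l * eval (fun l => p l) (pderiv l P)) * p j + eval (fun l => p l) P * v j := by
      have : ∀ l, v l * eval (fun l => p l) (pderiv l (P * X j)) =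
          v l * eval (fun l => p l) (pderiv l P) * p j +
            (if l = j then eval (fun l => p l) P * v j else 0) := by
        intro l
        rw [Derivation.leibniz, pderiv_X]
        by_cases hl : l = j
        · subst hl; simp; ring
        · simp [hl, Ne.symm hl]; ring
      rw [Finset.sum_congr rfl fun l _ => this l, Finset.sum_add_distrib, Finset.sum_mul]
      simp
    rw [e]
    simpa using hm

lemma exists_pderiv_ne_zero {k : ℕ} {P : MvPolynomial (Fin k) ℝ} {p v : EuclideanSpace ℝ (Fin k)}
    {d : ℝ} (h : HasDerivAt (fun t : ℝ => eval (fun l => (p + t • v) l) P) d 0) (hd : d ≠ 0) :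
    ∃ j, eval (fun l => p l) (pderiv j P) ≠ 0 := by
  by_contra hcon
  push Not at hcon
  have h1 := h.unique (hasDerivAt_eval_line P p v)
  rw [Finset.sum_eq_zero fun l _ => by rw [hcon l, mul_zero]] at h1
  exact hd h1

lemma hasDerivAt_alongCoord_line (j : Fin (i + 1)) (x v : EuclideanSpace ℝ (Fin 2)) :
    HasDerivAt (fun t : ℝ => alongCoord j (x + t • v)) (alongCoord j v) 0 := by
  have : ∀ t : ℝ, alongCoord j (x + t • v) = alongCoord j x + t * alongCoord j v := by
    intro t
    simp only [alongCoord, PiLp.add_apply, PiLp.smul_apply, smul_eq_mul]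
    ring
  simp_rw [this]
  simpa using ((hasDerivAt_id (0 : ℝ)).mul_const (alongCoord j v)).const_add (alongCoord j x)

lemma hasDerivAt_norm_sq_line (x v : EuclideanSpace ℝ (Fin 2)) :
    HasDerivAt (fun t : ℝ => ‖x + t • v‖ ^ 2) (2 * (x 0 * v 0 + x 1 * v 1)) 0 := by
  have : ∀ t : ℝ, ‖x + t • v‖ ^ 2 = (x 0 + t * v 0) ^ 2 + (x 1 + t * v 1) ^ 2 := by
    intro t
    rw [norm_sq_plane]
    simp
  simp_rw [this]
  have hl : ∀ l : Fin 2, HasDerivAt (fun t : ℝ => x l + t * v l) (v l) 0 := fun l => by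
    simpa using ((hasDerivAt_id (0 : ℝ)).mul_const (v l)).const_add (x l)
  have := ((hl 0).pow 2).add ((hl 1).pow 2)
  refine this.congr_deriv ?_
  simp
  ring

lemma hasDerivAt_holeForm_line (j : Fin (i + 1)) (c : ℝ) (x v : EuclideanSpace ℝ (Fin 2)) :
    HasDerivAt (fun t : ℝ => holeForm j c (x + t • v))
      (-2 * c * (1 - c * alongCoord j x) * alongCoord j v - (alongCoord j x * alongCoord j v -
        Real.cos (halfAngle i) ^ 2 * (x 0 * v 0 + x 1 * v 1)) / 32) 0 := by
  have h1 := hasDerivAt_alongCoord_line j x v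
  have h2 := hasDerivAt_norm_sq_line x v
  have h3 := (((h1.const_mul c).const_sub 1).pow 2).sub
    (((h1.pow 2).sub (h2.const_mul (Real.cos (halfAngle i) ^ 2))).div_const 64)
  refine h3.congr_deriv ?_
  simp
  ring

/-- If a product vanishes at a point because of its second factor only, its derivative there is the
first factor times the derivative of the second. -/
lemma hasDerivAt_mul_of_eq_zero {f g : ℝ → ℝ} {d : ℝ} (hf : ContinuousAt f 0) (hg : HasDerivAt g d 0)
    (h0 : g 0 = 0) : HasDerivAt (fun t => f t * g t) (f 0 * d) 0 := by
  rw [hasDerivAt_iff_tendsto_slope] at hg ⊢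
  have h1 : Filter.Tendsto (fun t => f t * slope g 0 t) (𝓝[≠] 0) (𝓝 (f 0 * d)) :=
    (hf.tendsto.mono_left nhdsWithin_le_nhds).mul hg
  refine h1.congr fun t => ?_
  simp only [slope, h0, vsub_eq_sub, smul_eq_mul, mul_zero, sub_zero]
  ring

/-- A boundary point of the region lies on one of the circles or on the boundary of a hole. -/
lemma regionFun_eq_zero_cases (hi : 2 ≤ i) {x : EuclideanSpace ℝ (Fin 2)}
    (h : regionFun a x = 0) :
    (∃ h : Hole a, h.form x = 0) ∨
      (‖x‖ ^ 2 = 16 ∨ innerBound a ^ 2 * ‖x‖ ^ 2 = 1) ∧ ∀ h : Hole a, 0 < h.form x := by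
  by_cases hz : ∃ h : Hole a, h.form x = 0
  · exact Or.inl hz
  · right
    push Not at hz
    have hall := ((regionFun_nonneg_iff hi x).1 h.ge).2
    refine ⟨?_, fun h => lt_of_le_of_ne (hall h) (Ne.symm (hz h))⟩
    rcases mul_eq_zero.1 h with h | h
    · rcases mul_eq_zero.1 h with h | h
      · left; linarith
      · right; linarith
    · obtain ⟨h, -, hh⟩ := Finset.prod_eq_zero_iff.1 h
      exact absurd hh (hz h)

/-- The gradient of `regionFun` does not vanish on the boundary of the region. -/
lemma exists_hasDerivAt_regionFun (hi : 2 ≤ i) {x : EuclideanSpace ℝ (Fin 2)}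
    (h : regionFun a x = 0) : ∃ (v : EuclideanSpace ℝ (Fin 2)) (d : ℝ), d ≠ 0 ∧
      HasDerivAt (fun t : ℝ => regionFun a (x + t • v)) d 0 := by
  have hx := norm_pos_of_regionFun_nonneg hi h.ge
  have hline : ∀ v : EuclideanSpace ℝ (Fin 2), Continuous fun t : ℝ => x + t • v := by
    intro v; fun_prop
  have hB := two_le_innerBound a
  rcases regionFun_eq_zero_cases hi h with ⟨h, hh⟩ | ⟨hc, hpos⟩
  · have hG := Hole.cofactor_pos hi hh.le
    have hG0 : ∀ v : EuclideanSpace ℝ (Fin 2), h.cofactor (x + (0 : ℝ) • v) ≠ 0 := by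
      intro v
      simpa using hG.ne'
    have hder : ∀ (v : EuclideanSpace ℝ (Fin 2)) (d : ℝ), d ≠ 0 →
        HasDerivAt (fun t : ℝ => h.form (x + t • v)) d 0 →
        ∃ (v : EuclideanSpace ℝ (Fin 2)) (d : ℝ), d ≠ 0 ∧
          HasDerivAt (fun t : ℝ => regionFun a (x + t • v)) d 0 := by
      intro v d hd hv
      refine ⟨v, _, mul_ne_zero (hG0 v) hd, ?_⟩
      simp_rw [regionFun_eq_cofactor_mul h]
      exact hasDerivAt_mul_of_eq_zero
        (h.contDiff_cofactor.continuous.comp (hline v)).continuousAt hv (by simpa using hh)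
    set u := alongCoord h.1 x with hu
    set c := h.lev
    have hform : (1 - c * u) ^ 2 - (u ^ 2 - Real.cos (halfAngle i) ^ 2 * ‖x‖ ^ 2) / 64 = 0 := hh
    have hu0 := (of_holeForm_nonpos h.one_le_lev hh.le).1
    by_cases hcu : 1 - c * u = 0
    · -- At a point of tangency the derivative along the bisector does not vanish.
      refine hder (ofSectorCoords h.1 1 0) _ ?_ (hasDerivAt_holeForm_line h.1 c x _)
      have e : x 0 * ofSectorCoords h.1 1 0 0 + x 1 * ofSectorCoords h.1 1 0 1 = u := by
        simp [hu, alongCoord]; ring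
      rw [e, alongCoord_ofSectorCoords, ← hu, hcu]
      have h1 := Real.sin_sq_add_cos_sq (halfAngle i)
      have h2 := sin_halfAngle_pos hi
      have h3 : 0 < u * Real.sin (halfAngle i) ^ 2 := by positivity
      intro h4
      have h5 : u * Real.sin (halfAngle i) ^ 2 = 0 := by
        linear_combination -32 * h4 + u * h1
      exact h3.ne' h5
    · -- Elsewhere the radial derivative does not vanish, by Euler's identity.
      refine hder x _ ?_ (hasDerivAt_holeForm_line h.1 c x x)
      have e : x 0 * x 0 + x 1 * x 1 = ‖x‖ ^ 2 := by rw [norm_sq_plane]; ring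
      rw [e, ← hu]
      intro h4
      apply hcu
      linear_combination hform - 1 / 2 * h4
  · -- On the circles the radial derivative does not vanish.
    have hP : 0 < ∏ h : Hole a, h.form x := Finset.prod_pos fun h _ => hpos h
    have hcont : Continuous fun x : EuclideanSpace ℝ (Fin 2) => ∏ h : Hole a, h.form x :=
      continuous_finsetProd _ fun h _ => continuous_holeForm _ _
    have hN := hasDerivAt_norm_sq_line x x
    have e : x 0 * x 0 + x 1 * x 1 = ‖x‖ ^ 2 := by rw [norm_sq_plane]; ring
    rw [e] at hN
    rcases hc with hc | hc
    · refine ⟨x, _, ?_, (hasDerivAt_mul_of_eq_zero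
        (f := fun t => (innerBound a ^ 2 * ‖x + t • x‖ ^ 2 - 1) * ∏ h : Hole a, h.form (x + t • x))
        (g := fun t => 16 - ‖x + t • x‖ ^ 2) ?_ (hN.const_sub 16) ?_).congr_of_eventuallyEq
          (Filter.Eventually.of_forall fun t => ?_)⟩
      · simp only [zero_smul, add_zero, hc]
        have : (innerBound a ^ 2 * 16 - 1) ≠ 0 := by nlinarith
        exact mul_ne_zero (mul_ne_zero this hP.ne') (by norm_num)
      · have := hcont.comp (hline x)
        have h2 := hline x
        exact Continuous.continuousAt (by fun_prop)
      · simp [hc]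
      · simp only [regionFun]; ring
    · refine ⟨x, _, ?_, (hasDerivAt_mul_of_eq_zero
        (f := fun t => (16 - ‖x + t • x‖ ^ 2) * ∏ h : Hole a, h.form (x + t • x))
        (g := fun t => innerBound a ^ 2 * ‖x + t • x‖ ^ 2 - 1) ?_
          ((hN.const_mul (innerBound a ^ 2)).sub_const 1) ?_).congr_of_eventuallyEq
          (Filter.Eventually.of_forall fun t => ?_)⟩
      · simp only [zero_smul, add_zero]
        have : 16 - ‖x‖ ^ 2 ≠ 0 := by nlinarith [sq_nonneg ‖x‖]
        refine mul_ne_zero (mul_ne_zero this hP.ne') (by positivity)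
      · have := hcont.comp (hline x)
        have h2 := hline x
        exact Continuous.continuousAt (by fun_prop)
      · simp [hc]
      · simp only [regionFun]; ring

lemma isNonsingularPoly_manifoldPoly (hi : 2 ≤ i) (a : Fin (i + 1) → ℕ) (k : ℕ) :
    IsNonsingularPoly (manifoldPoly a k) := by
  intro p hp
  rw [mem_manifold_iff] at hp
  by_cases hy : fibrePart p = 0
  · obtain ⟨v, d, hd, hv⟩ := exists_hasDerivAt_regionFun hi (x := planePart p) (a := a)
      (by rw [hp, hy]; simp)
    refine exists_pderiv_ne_zero (v := joinParts v 0) (d := d) ?_ hd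
    simp_rw [eval_manifoldPoly, planePart_add_smul, fibrePart_add_smul, planePart_joinParts,
      fibrePart_joinParts, hy]
    simpa using hv
  · -- Off the plane, the derivative along the complementary coordinates does not vanish.
    refine exists_pderiv_ne_zero (v := joinParts 0 (fibrePart p)) (d := -(2 * ‖fibrePart p‖ ^ 2))
      ?_ (neg_ne_zero.2 (by positivity))
    have e : ∀ t : ℝ, eval (fun l => (p + t • joinParts 0 (fibrePart p)) l) (manifoldPoly a k) =
        regionFun a (planePart p) - (1 + t) ^ 2 * ‖fibrePart p‖ ^ 2 := by
      intro t
      rw [eval_manifoldPoly, planePart_add_smul, fibrePart_add_smul, planePart_joinParts,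
        fibrePart_joinParts, smul_zero, add_zero,
        show fibrePart p + t • fibrePart p = (1 + t) • fibrePart p by rw [add_smul, one_smul],
        norm_smul, mul_pow, Real.norm_eq_abs, sq_abs]
    simp_rw [e]
    have h1 := ((((hasDerivAt_id (0 : ℝ)).const_add 1).pow 2).mul_const
      (‖fibrePart p‖ ^ 2)).const_sub (regionFun a (planePart p))
    refine h1.congr_deriv ?_
    simp

end Polynomial

/-! ### The map to the annulus -/

/-- The embedding of the punctured plane into the annulus that preserves all rays from the origin
and turns the radius `ρ` into `1 + r (ρ² - 1) / (ρ² + 1)`. -/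
def annulusMap (r : ℝ) (x : EuclideanSpace ℝ (Fin 2)) : EuclideanSpace ℝ (Fin 2) :=
  ((1 + r * ((‖x‖ ^ 2 - 1) / (‖x‖ ^ 2 + 1))) * ‖x‖⁻¹) • x

section AnnulusMap

variable {r : ℝ}

lemma abs_annulus_factor_le (x : EuclideanSpace ℝ (Fin 2)) :
    |(‖x‖ ^ 2 - 1) / (‖x‖ ^ 2 + 1)| ≤ 1 := by
  rw [abs_le, le_div_iff₀ (by positivity), div_le_iff₀ (by positivity)]
  constructor <;> nlinarith [sq_nonneg ‖x‖]

lemma annulus_factor_bounds (hr : 0 < r) (x : EuclideanSpace ℝ (Fin 2)) :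
    1 - r ≤ 1 + r * ((‖x‖ ^ 2 - 1) / (‖x‖ ^ 2 + 1)) ∧
      1 + r * ((‖x‖ ^ 2 - 1) / (‖x‖ ^ 2 + 1)) ≤ 1 + r := by
  have := abs_le.1 (abs_annulus_factor_le x)
  constructor <;> nlinarith

lemma norm_annulusMap (hr : 0 < r) (hr1 : r < 1) {x : EuclideanSpace ℝ (Fin 2)} (hx : x ≠ 0) :
    ‖annulusMap r x‖ = 1 + r * ((‖x‖ ^ 2 - 1) / (‖x‖ ^ 2 + 1)) := by
  have hn : ‖x‖ ≠ 0 := norm_ne_zero_iff.2 hx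
  have h0 : 0 < 1 + r * ((‖x‖ ^ 2 - 1) / (‖x‖ ^ 2 + 1)) := by
    linarith [(annulus_factor_bounds hr x).1]
  rw [annulusMap, norm_smul, norm_mul, norm_inv, norm_norm, Real.norm_of_nonneg h0.le, mul_assoc,
    inv_mul_cancel₀ hn, mul_one]

lemma annulusMap_mem (hr : 0 < r) (hr1 : r < 1) {x : EuclideanSpace ℝ (Fin 2)} (hx : x ≠ 0) :
    annulusMap r x ∈ planeAnnulus r := by
  have := annulus_factor_bounds hr x
  rw [← norm_annulusMap hr hr1 hx] at this
  exact this

lemma radialProj_annulusMap (hr : 0 < r) (hr1 : r < 1) (x : EuclideanSpace ℝ (Fin 2)) :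
    radialProj (annulusMap r x) = radialProj x := by
  by_cases hx : x = 0
  · simp [hx, annulusMap]
  · have h0 : 1 + r * ((‖x‖ ^ 2 - 1) / (‖x‖ ^ 2 + 1)) ≠ 0 :=
      ne_of_gt (by linarith [(annulus_factor_bounds hr x).1])
    rw [radialProj, norm_annulusMap hr hr1 hx, annulusMap, smul_smul, ← mul_assoc,
      inv_mul_cancel₀ h0, one_mul, radialProj]

lemma contDiffAt_annulusMap {x : EuclideanSpace ℝ (Fin 2)} (hx : x ≠ 0) :
    ContDiffAt ℝ ∞ (annulusMap r) x := by
  have h1 : ContDiffAt ℝ ∞ (fun x : EuclideanSpace ℝ (Fin 2) => ‖x‖) x := contDiffAt_norm ℝ hx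
  have h2 : ContDiffAt ℝ ∞ (fun x : EuclideanSpace ℝ (Fin 2) => ‖x‖⁻¹) x :=
    h1.inv (norm_ne_zero_iff.2 hx)
  have h3 : ContDiffAt ℝ ∞
      (fun x : EuclideanSpace ℝ (Fin 2) => (‖x‖ ^ 2 - 1) / (‖x‖ ^ 2 + 1)) x :=
    ((h1.pow 2).sub contDiffAt_const).div ((h1.pow 2).add contDiffAt_const) (by positivity)
  exact ((contDiffAt_const.add (contDiffAt_const.mul h3)).mul h2).smul contDiffAt_id

open MvPolynomial in
/-- With `N = |x|²`, the coordinates `q` of `annulusMap` satisfy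
`N (N + 1)² q² = (N + 1 + r (N - 1))² x_j²`. -/
lemma isRealAlgebraicMap_annulusMap {k : ℕ} {S : Set (EuclideanSpace ℝ (Fin (k + 2)))}
    (hS : ∀ p ∈ S, planePart p ≠ 0) :
    IsRealAlgebraicMap S fun p => annulusMap r (planePart p) := by
  intro j
  constructor
  · intro p hp
    refine ⟨{q | planePart q ≠ 0}, fun q => annulusMap r (planePart q) j,
      isOpen_ne.preimage continuous_planePart, hS p hp, fun q hq => ?_, fun _ _ => rfl⟩
    exact ((contDiffAt_euclidean.1 ((contDiffAt_annulusMap (r := r) hq).comp q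
      contDiff_planePart.contDiffAt)) j).contDiffWithinAt
  · set N : MvPolynomial (Fin (k + 2)) ℝ := normSqPoly k with hN
    set L : MvPolynomial (Fin (k + 2)) ℝ := N * (N + 1) ^ 2 with hL
    set l : Fin (k + 2) := if j = 0 then 0 else 1 with hl
    set T : MvPolynomial (Fin (k + 2)) ℝ := -((N + 1 + C r * (N - 1)) ^ 2 * X l ^ 2) with hT
    have eN : ∀ p : EuclideanSpace ℝ (Fin (k + 2)),
        eval (fun j => p j) N = ‖planePart p‖ ^ 2 := eval_normSqPoly
    have eL : ∀ p : EuclideanSpace ℝ (Fin (k + 2)), eval (fun j => p j) L =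
        ‖planePart p‖ ^ 2 * (‖planePart p‖ ^ 2 + 1) ^ 2 := by
      intro p
      simp [hL, eN]
    have hpl : ∀ p : EuclideanSpace ℝ (Fin (k + 2)), planePart p j = p l := by
      intro p
      fin_cases j <;> simp [hl]
    have hL0 : L ≠ 0 := by
      intro h0
      have := eL (EuclideanSpace.single 0 1)
      rw [h0, norm_sq_plane] at this
      simp at this
      norm_num at this
    refine ⟨Polynomial.C L * Polynomial.X ^ 2 + Polynomial.C 0 * Polynomial.X + Polynomial.C T,
      ?_, ?_, ?_⟩
    · rw [Polynomial.natDegree_quadratic hL0]; norm_num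
    · rw [Polynomial.leadingCoeff_quadratic hL0]
      intro p hp
      refine subset_closure ⟨hp, ?_⟩
      rw [eL]
      have : ‖planePart p‖ ≠ 0 := norm_ne_zero_iff.2 (hS p hp)
      positivity
    · intro p hp
      have h1 : ‖planePart p‖ ≠ 0 := norm_ne_zero_iff.2 (hS p hp)
      have h2 : ‖planePart p‖ ^ 2 + 1 ≠ 0 := by positivity
      simp only [Polynomial.map_add, Polynomial.map_mul, Polynomial.map_pow, Polynomial.map_C,
        Polynomial.map_X, Polynomial.eval_add, Polynomial.eval_mul, Polynomial.eval_pow,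
        Polynomial.eval_C, Polynomial.eval_X, map_zero, zero_mul, add_zero]
      rw [eL, hT]
      simp only [map_neg, map_mul, map_pow, map_add, map_sub, eN, eval_X, eval_C, map_one]
      rw [annulusMap, PiLp.smul_apply, smul_eq_mul, hpl]
      field_simp
      ring

end AnnulusMap

/-! ### Regular points -/

section Regular

lemma contDiffAt_radialProj {x : EuclideanSpace ℝ (Fin 2)} (hx : x ≠ 0) :
    ContDiffAt ℝ ∞ radialProj x :=
  ((contDiffAt_norm ℝ hx).inv (norm_ne_zero_iff.2 hx)).smul contDiffAt_id

lemma norm_radialProj {x : EuclideanSpace ℝ (Fin 2)} (hx : x ≠ 0) : ‖radialProj x‖ = 1 := by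
  rw [radialProj, norm_smul, norm_inv, norm_norm, inv_mul_cancel₀ (norm_ne_zero_iff.2 hx)]

lemma norm_smul_radialProj (x : EuclideanSpace ℝ (Fin 2)) : ‖x‖ • radialProj x = x := by
  by_cases hx : x = 0
  · simp [hx]
  · rw [radialProj, smul_smul, mul_inv_cancel₀ (norm_ne_zero_iff.2 hx), one_smul]

lemma radialProj_smul {t : ℝ} (ht : 0 < t) (x : EuclideanSpace ℝ (Fin 2)) :
    radialProj (t • x) = radialProj x := by
  rw [radialProj, radialProj, norm_smul, Real.norm_of_nonneg ht.le, mul_inv, smul_smul, mul_right_comm,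
    inv_mul_cancel₀ ht.ne', one_mul]

lemma radialProj_of_norm_eq_one {x : EuclideanSpace ℝ (Fin 2)} (hx : ‖x‖ = 1) :
    radialProj x = x := by
  rw [radialProj, hx, inv_one, one_smul]

/-- A point is regular if the map has non-zero speed along some curve through it. -/
lemma not_isSingularPoint_of_curve {E F : Type*} [NormedAddCommGroup E] [NormedSpace ℝ E]
    [NormedAddCommGroup F] [NormedSpace ℝ F] {S : Set E} {d : ℕ} {c : E → F} {p : E}
    (hc : DifferentiableAt ℝ c p) {γ : ℝ → E} (hγ : DifferentiableAt ℝ γ 0) (h0 : γ 0 = p)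
    (hS : ∀ᶠ t in 𝓝 0, γ t ∈ S) {w : F} (hw : HasDerivAt (fun t => c (γ t)) w 0) (hw0 : w ≠ 0) :
    ¬ IsSingularPoint S d c p := by
  rintro ⟨U, φ, u, ⟨hU, hφ, V, ψ, hV, hψ, h1, h2, h3, h4⟩, hu, hφu, hd⟩
  apply hw0
  have hpV : p ∈ V := hφu ▸ (h1 hu).1
  have hψp : ψ (γ 0) = u := by rw [h0, ← hφu, h3 u hu]
  have hφd : DifferentiableAt ℝ φ u :=
    (hφ.contDiffAt (hU.mem_nhds hu)).differentiableAt (by simp)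
  have hcφ : HasFDerivAt (fun z => c (φ z)) (0 : EuclideanSpace ℝ (Fin d) →L[ℝ] F) (ψ (γ 0)) := by
    rw [hψp, ← hd]
    refine DifferentiableAt.hasFDerivAt ?_
    exact DifferentiableAt.comp u (by rwa [hφu]) hφd
  have hψd : DifferentiableAt ℝ ψ (γ 0) := by
    rw [h0]
    exact (hψ.contDiffAt (hV.mem_nhds hpV)).differentiableAt (by simp)
  have hcomp := hcφ.comp_hasDerivAt (0 : ℝ) (DifferentiableAt.comp (0 : ℝ) hψd hγ).hasDerivAt
  have hev : (fun t => c (γ t)) =ᶠ[𝓝 0] (fun z => c (φ z)) ∘ (ψ ∘ γ) := by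
    filter_upwards [hS, hγ.continuousAt.preimage_mem_nhds (hV.mem_nhds (h0.symm ▸ hpV))] with t ht ht'
    simp only [Function.comp_apply]
    rw [h4 _ ⟨ht', ht⟩]
  have := hw.unique (hcomp.congr_of_eventuallyEq hev)
  simpa using this

variable {i : ℕ} {a : Fin (i + 1) → ℕ} {k : ℕ}

/-- The angular coordinate as a map from the ambient space to the circle. -/
def angularMap (p : EuclideanSpace ℝ (Fin (k + 2))) : EuclideanSpace ℝ (Fin 2) :=
  radialProj (planePart p)

lemma contDiffAt_angularMap {p : EuclideanSpace ℝ (Fin (k + 2))} (hp : planePart p ≠ 0) :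
    ContDiffAt ℝ ∞ angularMap p :=
  (contDiffAt_radialProj hp).comp p contDiff_planePart.contDiffAt

/-- The rotation of the plane by a right angle. -/
def rightTurn (x : EuclideanSpace ℝ (Fin 2)) : EuclideanSpace ℝ (Fin 2) := !₂[-x 1, x 0]

/-- The angular coordinate has non-zero speed along curves `(λ(t) (x + t x^⊥), y(t))`. -/
lemma not_isSingularPoint_of_scaling {S : Set (EuclideanSpace ℝ (Fin (k + 2)))} {d : ℕ}
    {p : EuclideanSpace ℝ (Fin (k + 2))} (hp : planePart p ≠ 0) {lam : ℝ → ℝ}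
    {y : ℝ → EuclideanSpace ℝ (Fin k)} (hlam : DifferentiableAt ℝ lam 0)
    (hy : DifferentiableAt ℝ y 0) (hlam0 : lam 0 = 1) (hy0 : y 0 = fibrePart p)
    (hS : ∀ᶠ t : ℝ in 𝓝 0,
      joinParts (lam t • (planePart p + t • rightTurn (planePart p))) (y t) ∈ S) :
    ¬ IsSingularPoint S d angularMap p := by
  set x := planePart p with hx
  have hz : Differentiable ℝ fun t : ℝ => x + t • rightTurn x := by fun_prop
  set z : ℝ → EuclideanSpace ℝ (Fin 2) := fun t => x + t • rightTurn x with hzdef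
  have hz0 : z 0 = x := by simp [hzdef]
  have hγ : DifferentiableAt ℝ (fun t => joinParts (lam t • z t) (y t)) 0 := by
    have h1 : DifferentiableAt ℝ
        (fun q : EuclideanSpace ℝ (Fin 2) × EuclideanSpace ℝ (Fin k) => joinParts q.1 q.2)
        (lam 0 • z 0, y 0) := (contDiff_joinParts.differentiable (by simp)).differentiableAt
    exact DifferentiableAt.comp (0 : ℝ) (f := fun t => (lam t • z t, y t)) h1
      ((hlam.smul hz.differentiableAt).prodMk hy)
  have hrad : DifferentiableAt ℝ (fun t => radialProj (z t)) 0 := by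
    refine DifferentiableAt.comp (0 : ℝ) (g := radialProj) (f := z) ?_ hz.differentiableAt
    exact (contDiffAt_radialProj (hz0.symm ▸ hp)).differentiableAt (by simp)
  obtain ⟨w, hw⟩ : ∃ w, HasDerivAt (fun t => radialProj (z t)) w 0 := ⟨_, hrad.hasDerivAt⟩
  refine not_isSingularPoint_of_curve (w := w)
    ((contDiffAt_angularMap hp).differentiableAt (by simp)) hγ ?_ hS ?_ ?_
  · rw [hlam0, one_smul, hz0, hy0, joinParts_parts]
  · refine hw.congr_of_eventuallyEq ?_
    have hpos : ∀ᶠ t in 𝓝 0, 0 < lam t :=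
      hlam.continuousAt.eventually (lt_mem_nhds (by rw [hlam0]; exact one_pos))
    filter_upwards [hpos] with t ht
    rw [angularMap, planePart_joinParts, radialProj_smul ht]
  · -- The component along `x^⊥` of the speed does not vanish.
    intro hw0
    have h1 : ∀ l : Fin 2, HasDerivAt (fun t => radialProj (z t) l) 0 0 := by
      intro l
      have := (EuclideanSpace.proj (𝕜 := ℝ) l).hasFDerivAt.comp_hasDerivAt (0 : ℝ) hw
      rwa [hw0, map_zero] at this
    have h2 := ((h1 1).const_mul (x 0)).sub ((h1 0).const_mul (x 1))
    have hn : ‖x‖ ≠ 0 := norm_ne_zero_iff.2 hp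
    have hcont : ContinuousAt (fun t => ‖z t‖⁻¹ * ‖x‖ ^ 2) 0 := by
      refine ContinuousAt.mul (ContinuousAt.inv₀ hz.continuous.norm.continuousAt ?_)
        continuousAt_const
      rwa [hz0]
    have h3 := hasDerivAt_mul_of_eq_zero hcont (hasDerivAt_id (0 : ℝ)) rfl
    have h4 : HasDerivAt (fun t => (‖z t‖⁻¹ * ‖x‖ ^ 2) * id t) (x 0 * 0 - x 1 * 0) 0 := by
      refine h2.congr_of_eventuallyEq (Filter.Eventually.of_forall fun t => ?_)
      have e0 : z t 0 = x 0 - t * x 1 := by simp [hzdef, rightTurn]; ring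
      have e1 : z t 1 = x 1 + t * x 0 := by simp [hzdef, rightTurn]
      simp only [Pi.sub_apply, radialProj, PiLp.smul_apply, smul_eq_mul, e0, e1, norm_sq_plane x, id]
      ring
    have h5 := h3.unique h4
    rw [hz0] at h5
    simp only [mul_zero, sub_zero, mul_one] at h5
    exact (mul_ne_zero (inv_ne_zero hn) (pow_ne_zero 2 hn)) h5

/-- All singular points lie over the points of tangency of the holes. -/
lemma exists_hole_of_isSingularPoint (hi : 2 ≤ i) {d : ℕ} {p : EuclideanSpace ℝ (Fin (k + 2))}
    (hp : p ∈ polyZeroSet (manifoldPoly a k))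
    (hs : IsSingularPoint (polyZeroSet (manifoldPoly a k)) d angularMap p) :
    ∃ h : Hole a, h.form (planePart p) = 0 ∧
      alongCoord h.1 (planePart p) = Real.cos (halfAngle i) * ‖planePart p‖ := by
  have hx := norm_planePart_pos hi hp
  have hx0 : planePart p ≠ 0 := norm_pos_iff.1 hx
  by_contra hcon
  push Not at hcon
  have hQ := mem_manifold_iff.1 hp
  set x := planePart p with hxdef
  have hz : Differentiable ℝ fun t : ℝ => x + t • rightTurn x := by fun_prop
  revert hs
  rcases (regionFun_nonneg_of_mem hp).lt_or_eq with hpos | hzero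
  · -- Over the interior of the region, rescaling the complementary part compensates for the change
    -- of `regionFun` along a curve in the plane.
    have hq : Differentiable ℝ fun t : ℝ => regionFun a (x + t • rightTurn x) / regionFun a x :=
      (((contDiff_regionFun a).differentiable (by simp)).comp hz).div_const _
    have hq0 : regionFun a (x + (0 : ℝ) • rightTurn x) / regionFun a x = 1 := by
      rw [zero_smul, add_zero, div_self hpos.ne']
    refine not_isSingularPoint_of_scaling (lam := fun _ => 1)
      (y := fun t => √(regionFun a (x + t • rightTurn x) / regionFun a x) • fibrePart p) hx0
      (differentiableAt_const _) ?_ rfl ?_ ?_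
    · refine (DifferentiableAt.sqrt hq.differentiableAt ?_).smul_const _
      rw [hq0]; exact one_ne_zero
    · simp only [hq0, Real.sqrt_one, one_smul]
    · have hev := (hq.continuous.continuousAt (x := 0)).eventually
        (lt_mem_nhds (show (0 : ℝ) < _ by simp only [hq0, zero_lt_one]))
      filter_upwards [hev] with t ht
      rw [joinParts_mem_manifold_iff, one_smul, norm_smul, mul_pow, Real.norm_eq_abs, sq_abs,
        Real.sq_sqrt ht.le, ← hQ, div_mul_cancel₀ _ hpos.ne']
  · have hy : fibrePart p = 0 := by
      rw [← hzero] at hQ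
      exact norm_eq_zero.1 (pow_eq_zero_iff two_ne_zero |>.1 hQ.symm)
    have hmem : ∀ t lam : ℝ, joinParts (lam • (x + t • rightTurn x)) 0 ∈
        polyZeroSet (manifoldPoly a k) ↔ regionFun a (lam • (x + t • rightTurn x)) = 0 := by
      intro t lam
      rw [joinParts_mem_manifold_iff]
      simp
    have hn0 : ‖x + (0 : ℝ) • rightTurn x‖ ≠ 0 := by simpa using hx.ne'
    rcases regionFun_eq_zero_cases hi hzero.symm with ⟨h, hh⟩ | ⟨hc, -⟩
    · -- Follow the boundary of the hole, on which the radius is an explicit function of the angle.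
      obtain ⟨hu0, hu1, -⟩ := of_holeForm_nonpos h.one_le_lev hh.le
      have hlt := lt_of_le_of_ne hu1 (Ne.symm (hcon h hh))
      set u : ℝ → ℝ := fun t => alongCoord h.1 (x + t • rightTurn x) with hu
      set D : ℝ → ℝ := fun t => u t ^ 2 -
        Real.cos (halfAngle i) ^ 2 * ‖x + t • rightTurn x‖ ^ 2 with hD
      have hK := half_le_cos_halfAngle hi
      have hx' : x + (0 : ℝ) • rightTurn x = x := by simp
      have hD0 : 0 < D 0 := by
        simp only [hD, hu, hx', ← mul_pow, sub_pos]
        exact pow_lt_pow_left₀ hlt (by positivity) two_ne_zero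
      have hud : Differentiable ℝ u :=
        ((contDiff_alongCoord h.1).differentiable (by simp)).comp hz
      have hnd : Differentiable ℝ fun t : ℝ => ‖x + t • rightTurn x‖ ^ 2 :=
        Differentiable.comp (g := fun x : EuclideanSpace ℝ (Fin 2) => ‖x‖ ^ 2)
          ((contDiff_norm_sq ℝ (n := ∞)).differentiable (by simp)) hz
      have hDd : Differentiable ℝ D := by fun_prop
      obtain ⟨e, he, he0⟩ : ∃ e : ℝ, e ^ 2 = 1 ∧ h.lev * u 0 + e * (√(D 0) / 8) = 1 := by
        have h1 : (1 - h.lev * u 0) ^ 2 = (√(D 0) / 8) ^ 2 := by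
          rw [div_pow, Real.sq_sqrt hD0.le]
          have := hh
          unfold Hole.form holeForm at this
          simp only [hD, hu, hx']
          linear_combination this
        rcases sq_eq_sq_iff_eq_or_eq_neg.1 h1 with h1 | h1
        · exact ⟨1, by norm_num, by linarith⟩
        · exact ⟨-1, by norm_num, by linarith⟩
      have hden : DifferentiableAt ℝ (fun t => h.lev * u t + e * (√(D t) / 8)) 0 :=
        (hud.differentiableAt.const_mul _).add
          (((hDd.differentiableAt.sqrt hD0.ne').div_const 8).const_mul e)
      refine not_isSingularPoint_of_scaling
        (lam := fun t => (h.lev * u t + e * (√(D t) / 8))⁻¹) (y := fun _ => 0) hx0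
        (hden.inv (by rw [he0]; exact one_ne_zero)) (differentiableAt_const _)
        (by simp only [he0, inv_one]) hy.symm ?_
      have hev1 := hden.continuousAt.eventually
        (lt_mem_nhds (show (0 : ℝ) < _ by simp only [he0, zero_lt_one]))
      have hev2 := hDd.continuous.continuousAt.eventually (lt_mem_nhds hD0)
      filter_upwards [hev1, hev2] with t ht1 ht2
      rw [hmem, regionFun_eq_cofactor_mul h]
      refine mul_eq_zero_of_right _ ?_
      set den := h.lev * u t + e * (√(D t) / 8) with hdendef
      have hinv : den⁻¹ * den = 1 := inv_mul_cancel₀ ht1.ne'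
      have h1 : 1 - h.lev * (den⁻¹ * u t) = den⁻¹ * (e * (√(D t) / 8)) := by
        rw [hdendef] at hinv ⊢
        linear_combination -hinv
      have h2 : √(D t) ^ 2 = D t := Real.sq_sqrt ht2.le
      unfold Hole.form holeForm
      rw [alongCoord_smul, norm_smul, mul_pow ‖_‖, Real.norm_eq_abs, sq_abs]
      change (1 - h.lev * (den⁻¹ * u t)) ^ 2 - ((den⁻¹ * u t) ^ 2 -
        Real.cos (halfAngle i) ^ 2 * (den⁻¹ ^ 2 * ‖x + t • rightTurn x‖ ^ 2)) / 64 = 0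
      rw [h1]
      have h3 : D t = u t ^ 2 - Real.cos (halfAngle i) ^ 2 * ‖x + t • rightTurn x‖ ^ 2 := rfl
      rw [h3] at h2
      linear_combination den⁻¹ ^ 2 / 64 * h2 + den⁻¹ ^ 2 * √(D t) ^ 2 / 64 * he
    · -- Follow the circle.
      have hnd : DifferentiableAt ℝ (fun t : ℝ => ‖x + t • rightTurn x‖) 0 :=
        hz.differentiableAt.norm ℝ (norm_ne_zero_iff.1 hn0)
      refine not_isSingularPoint_of_scaling (lam := fun t => ‖x‖ * ‖x + t • rightTurn x‖⁻¹)
        (y := fun _ => 0) hx0 ((hnd.inv hn0).const_mul _) (differentiableAt_const _) ?_ hy.symm ?_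
      · simp [hx.ne']
      · have hev := hnd.continuousAt.eventually (isOpen_ne.mem_nhds hn0)
        filter_upwards [hev] with t ht
        rw [hmem]
        have hnorm : ‖(‖x‖ * ‖x + t • rightTurn x‖⁻¹) • (x + t • rightTurn x)‖ = ‖x‖ := by
          rw [norm_smul, norm_mul, norm_inv, norm_norm, norm_norm, mul_assoc, inv_mul_cancel₀ ht,
            mul_one]
        unfold regionFun
        rw [hnorm]
        rw [← hxdef] at hc
        rcases hc with hc | hc
        · simp [hc]
        · simp [hc]

end Regular

/-! ### Morse charts at the points of tangency -/

section CircleChart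

variable {i : ℕ}

/-- The inverse of the local coordinate `τ = (cos² δ - u²) / 64` of the circle on a quadrant, where `u`
is the coordinate along the bisector of the `j`-th sector, and the sign `e` of the coordinate across
it selects the quadrant. The point with `τ = 0` lies on a side of the sector. -/
def circleChart (j : Fin (i + 1)) (e : ℝ) (τ : ℝ) : EuclideanSpace ℝ (Fin 2) :=
  ofSectorCoords j (√(Real.cos (halfAngle i) ^ 2 - 64 * τ))
    (e * √(Real.sin (halfAngle i) ^ 2 + 64 * τ))

/-- The domain of `circleChart`. -/
def circleChartDomain (i : ℕ) : Set ℝ :=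
  Ioo (-(Real.sin (halfAngle i) ^ 2 / 64)) (Real.cos (halfAngle i) ^ 2 / 64)

lemma mem_circleChartDomain {τ : ℝ} : τ ∈ circleChartDomain i ↔
    0 < Real.cos (halfAngle i) ^ 2 - 64 * τ ∧ 0 < Real.sin (halfAngle i) ^ 2 + 64 * τ := by
  rw [circleChartDomain, mem_Ioo]
  constructor <;> rintro ⟨h1, h2⟩ <;> constructor <;> linarith

lemma isOpen_circleChartDomain : IsOpen (circleChartDomain i) := isOpen_Ioo

lemma zero_mem_circleChartDomain (hi : 2 ≤ i) : (0 : ℝ) ∈ circleChartDomain i := by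
  have h1 := half_le_cos_halfAngle hi
  have h2 := sin_halfAngle_pos hi
  rw [mem_circleChartDomain]
  constructor
  · nlinarith
  · nlinarith

lemma contDiffAt_circleChart (j : Fin (i + 1)) (e : ℝ) {τ : ℝ} (hτ : τ ∈ circleChartDomain i) :
    ContDiffAt ℝ ∞ (circleChart j e) τ := by
  rw [mem_circleChartDomain] at hτ
  have h1 : ContDiffAt ℝ ∞ (fun τ : ℝ => √(Real.cos (halfAngle i) ^ 2 - 64 * τ)) τ :=
    ContDiffAt.sqrt (by fun_prop) hτ.1.ne'
  have h2 : ContDiffAt ℝ ∞ (fun τ : ℝ => e * √(Real.sin (halfAngle i) ^ 2 + 64 * τ)) τ :=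
    contDiffAt_const.mul (ContDiffAt.sqrt (by fun_prop) hτ.2.ne')
  have := (contDiff_ofSectorCoords j).comp_contDiffAt τ (h1.prodMk h2)
  exact this

lemma norm_circleChart (j : Fin (i + 1)) {e : ℝ} (he : e ^ 2 = 1) {τ : ℝ}
    (hτ : τ ∈ circleChartDomain i) : ‖circleChart j e τ‖ = 1 := by
  rw [mem_circleChartDomain] at hτ
  have : ‖circleChart j e τ‖ ^ 2 = 1 := by
    rw [circleChart, norm_ofSectorCoords_sq, mul_pow, he, Real.sq_sqrt hτ.1.le,
      Real.sq_sqrt hτ.2.le]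
    linear_combination Real.sin_sq_add_cos_sq (halfAngle i)
  nlinarith [norm_nonneg (circleChart j e τ)]

/-- A unit vector of the quadrant is recovered from its coordinate. -/
lemma circleChart_coord (j : Fin (i + 1)) {e : ℝ} (he : e ^ 2 = 1) {z : EuclideanSpace ℝ (Fin 2)}
    (hz : ‖z‖ = 1) (h1 : 0 < alongCoord j z) (h2 : 0 < e * acrossCoord j z) :
    (Real.cos (halfAngle i) ^ 2 - alongCoord j z ^ 2) / 64 ∈ circleChartDomain i ∧
      circleChart j e ((Real.cos (halfAngle i) ^ 2 - alongCoord j z ^ 2) / 64) = z := by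
  have hn := norm_sq_eq_coords j z
  rw [hz] at hn
  have hcs := Real.sin_sq_add_cos_sq (halfAngle i)
  have e1 : Real.cos (halfAngle i) ^ 2 - 64 * ((Real.cos (halfAngle i) ^ 2 - alongCoord j z ^ 2) / 64)
      = alongCoord j z ^ 2 := by ring
  have e2 : Real.sin (halfAngle i) ^ 2 + 64 * ((Real.cos (halfAngle i) ^ 2 - alongCoord j z ^ 2) / 64)
      = (e * acrossCoord j z) ^ 2 := by
    linear_combination hcs + hn - acrossCoord j z ^ 2 * he
  constructor
  · rw [mem_circleChartDomain, e1, e2]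
    exact ⟨by positivity, by positivity⟩
  · rw [circleChart, e1, e2, Real.sqrt_sq h1.le, Real.sqrt_sq h2.le, ← mul_assoc, ← pow_two, he,
      one_mul, ofSectorCoords_coords]

lemma isLocalParam_circleChart (j : Fin (i + 1)) {e : ℝ} (he : e ^ 2 = 1) :
    IsLocalParam unitCircle (circleChartDomain i) (circleChart j e) := by
  have hU := continuous_alongCoord j
  have hV := continuous_acrossCoord j
  refine ⟨isOpen_circleChartDomain, fun τ hτ => (contDiffAt_circleChart j e hτ).contDiffWithinAt,
    {z | 0 < alongCoord j z ∧ 0 < e * acrossCoord j z},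
    fun z => (Real.cos (halfAngle i) ^ 2 - alongCoord j z ^ 2) / 64, ?_, ?_, ?_, ?_, ?_, ?_⟩
  · exact (isOpen_lt continuous_const hU).inter (isOpen_lt continuous_const (continuous_const.mul hV))
  · have := contDiff_alongCoord j
    exact ContDiff.contDiffOn (by fun_prop)
  · intro τ hτ
    have hτ' := mem_circleChartDomain.1 hτ
    refine ⟨⟨?_, ?_⟩, norm_circleChart j he hτ⟩
    · rw [circleChart, alongCoord_ofSectorCoords]
      exact Real.sqrt_pos.2 hτ'.1
    · rw [circleChart, acrossCoord_ofSectorCoords, ← mul_assoc, ← pow_two, he, one_mul]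
      exact Real.sqrt_pos.2 hτ'.2
  · rintro z ⟨⟨h1, h2⟩, hz⟩
    exact (circleChart_coord j he hz h1 h2).1
  · intro τ hτ
    simp only [circleChart, alongCoord_ofSectorCoords]
    rw [Real.sq_sqrt (mem_circleChartDomain.1 hτ).1.le]
    ring
  · rintro z ⟨⟨h1, h2⟩, hz⟩
    exact (circleChart_coord j he hz h1 h2).2

end CircleChart

section Chart

variable {i : ℕ} {a : Fin (i + 1) → ℕ} {k : ℕ}

/-- All coordinates of a vector except the last one. -/
def initPart (X : EuclideanSpace ℝ (Fin (k + 1))) : EuclideanSpace ℝ (Fin k) :=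
  WithLp.toLp 2 fun l => X l.castSucc

lemma morseForm_one (X : EuclideanSpace ℝ (Fin (k + 1))) :
    morseForm (k + 1) 1 X = ‖initPart X‖ ^ 2 - X (Fin.last k) ^ 2 := by
  rw [morseForm, Fin.sum_univ_castSucc, EuclideanSpace.norm_sq_eq]
  simp [initPart, sub_eq_add_neg]

lemma contDiff_initPart : ContDiff ℝ ∞ (initPart (k := k)) := by
  rw [contDiff_euclidean]
  intro l
  change ContDiff ℝ ∞ fun X : EuclideanSpace ℝ (Fin (k + 1)) => X l.castSucc
  fun_prop

lemma contDiff_morseForm_one : ContDiff ℝ ∞ (morseForm (k + 1) 1) := by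
  have h : morseForm (k + 1) 1 = fun X : EuclideanSpace ℝ (Fin (k + 1)) =>
      ‖initPart X‖ ^ 2 - X (Fin.last k) ^ 2 := funext morseForm_one
  rw [h]
  have := (contDiff_norm_sq ℝ (E := EuclideanSpace ℝ (Fin k)) (n := ∞)).comp
    (contDiff_initPart (k := k))
  exact this.sub (by fun_prop)

lemma morseForm_zero (d l : ℕ) : morseForm d l 0 = 0 := by
  simp [morseForm]

lemma hasFDerivAt_morseForm_zero (d l : ℕ) :
    HasFDerivAt (morseForm d l) (0 : EuclideanSpace ℝ (Fin d) →L[ℝ] ℝ) 0 := by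
  have h1 : ∀ j : Fin d, HasFDerivAt (fun X : EuclideanSpace ℝ (Fin d) =>
      if (j : ℕ) < d - l then X j ^ 2 else -(X j ^ 2))
      (0 : EuclideanSpace ℝ (Fin d) →L[ℝ] ℝ) 0 := by
    intro j
    have h2 : HasFDerivAt (fun X : EuclideanSpace ℝ (Fin d) => X j ^ 2)
        (0 : EuclideanSpace ℝ (Fin d) →L[ℝ] ℝ) 0 := by
      have := ((EuclideanSpace.proj (𝕜 := ℝ) j).hasFDerivAt
        (x := (0 : EuclideanSpace ℝ (Fin d)))).pow 2
      refine this.congr_fderiv ?_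
      ext v
      simp
    split_ifs
    · exact h2
    · simpa using h2.fun_neg
  have := HasFDerivAt.fun_sum (u := Finset.univ) fun j _ => h1 j
  rw [Finset.sum_const_zero] at this
  exact this

/-- The inverse of the radius of the point with Morse coordinates `X`. -/
def Hole.chartInvRadius (h : Hole a) (X : EuclideanSpace ℝ (Fin (k + 1))) : ℝ :=
  X (Fin.last k) + h.lev * √(Real.cos (halfAngle i) ^ 2 - 64 * morseForm (k + 1) 1 X)

/-- The plane part of the point with Morse coordinates `X`. -/
def Hole.chartPlane (h : Hole a) (e : ℝ) (X : EuclideanSpace ℝ (Fin (k + 1))) :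
    EuclideanSpace ℝ (Fin 2) :=
  (h.chartInvRadius X)⁻¹ • circleChart h.1 e (morseForm (k + 1) 1 X)

/-- The inverse of Morse coordinates of the manifold around a point of tangency of the given hole.
In terms of `q` the form of the hole and `G` the product of the other factors, so that the manifold
is `|y|² = G q`, the coordinates of `(x, y)` are `y / (√G |x|)` and `(1 - c u) / |x|`. The squared norm
of the first minus the square of the second is `(cos² δ - (u / |x|)²) / 64`, which depends only on
the angle of `x` and is a local coordinate of the circle. -/
def Hole.chart (h : Hole a) (e : ℝ) (X : EuclideanSpace ℝ (Fin (k + 1))) :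
    EuclideanSpace ℝ (Fin (k + 2)) :=
  joinParts (h.chartPlane e X)
    ((√(h.cofactor (h.chartPlane e X)) * (h.chartInvRadius X)⁻¹) • initPart X)

/-- The domain of `Hole.chart`. -/
def Hole.chartDomain (h : Hole a) (e : ℝ) (k : ℕ) : Set (EuclideanSpace ℝ (Fin (k + 1))) :=
  {X | morseForm (k + 1) 1 X ∈ circleChartDomain i ∧ 0 < h.chartInvRadius X ∧
    0 < h.cofactor (h.chartPlane e X)}

/-- The Morse coordinates around a point of tangency. -/
def Hole.coords (h : Hole a) (p : EuclideanSpace ℝ (Fin (k + 2))) :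
    EuclideanSpace ℝ (Fin (k + 1)) :=
  WithLp.toLp 2 (Fin.snoc (α := fun _ => ℝ)
    (fun l => (√(h.cofactor (planePart p)) * ‖planePart p‖)⁻¹ * fibrePart p l)
    ((1 - h.lev * alongCoord h.1 (planePart p)) * ‖planePart p‖⁻¹))

lemma Hole.initPart_coords (h : Hole a) (p : EuclideanSpace ℝ (Fin (k + 2))) :
    initPart (h.coords p) = (√(h.cofactor (planePart p)) * ‖planePart p‖)⁻¹ • fibrePart p := by
  ext l
  simp [initPart, Hole.coords]

lemma Hole.coords_last (h : Hole a) (p : EuclideanSpace ℝ (Fin (k + 2))) :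
    h.coords p (Fin.last k) =
      (1 - h.lev * alongCoord h.1 (planePart p)) * ‖planePart p‖⁻¹ := by
  simp [Hole.coords]

lemma eq_of_initPart_eq {X Y : EuclideanSpace ℝ (Fin (k + 1))} (h1 : initPart X = initPart Y)
    (h2 : X (Fin.last k) = Y (Fin.last k)) : X = Y := by
  ext l
  refine Fin.lastCases h2 (fun l => ?_) l
  have : initPart X l = initPart Y l := by rw [h1]
  exact this

lemma Hole.contDiffAt_chartInvRadius (h : Hole a) {X : EuclideanSpace ℝ (Fin (k + 1))}
    (hX : morseForm (k + 1) 1 X ∈ circleChartDomain i) :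
    ContDiffAt ℝ ∞ (h.chartInvRadius (k := k)) X := by
  have hm := (contDiff_morseForm_one (k := k)).contDiffAt (x := X)
  have h1 : ContDiffAt ℝ ∞ (fun X : EuclideanSpace ℝ (Fin (k + 1)) => X (Fin.last k)) X := by
    fun_prop
  exact h1.add (contDiffAt_const.mul (ContDiffAt.sqrt
    (contDiffAt_const.sub (contDiffAt_const.mul hm)) (mem_circleChartDomain.1 hX).1.ne'))

lemma Hole.contDiffAt_chartPlane (h : Hole a) (e : ℝ) {X : EuclideanSpace ℝ (Fin (k + 1))}
    (hX : morseForm (k + 1) 1 X ∈ circleChartDomain i) (hX' : 0 < h.chartInvRadius X) :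
    ContDiffAt ℝ ∞ (h.chartPlane (k := k) e) X :=
  ((h.contDiffAt_chartInvRadius hX).inv hX'.ne').smul
    (ContDiffAt.comp (g := circleChart h.1 e) X (contDiffAt_circleChart h.1 e hX)
      contDiff_morseForm_one.contDiffAt)

lemma Hole.contDiffAt_chart (h : Hole a) (e : ℝ) {X : EuclideanSpace ℝ (Fin (k + 1))}
    (hX : X ∈ h.chartDomain e k) : ContDiffAt ℝ ∞ (h.chart (k := k) e) X := by
  obtain ⟨h1, h2, h3⟩ := hX
  have hp := h.contDiffAt_chartPlane e h1 h2
  have hG : ContDiffAt ℝ ∞ (fun X => √(h.cofactor (h.chartPlane e X))) X :=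
    ContDiffAt.sqrt (ContDiffAt.comp X h.contDiff_cofactor.contDiffAt hp) h3.ne'
  have := contDiff_joinParts.comp_contDiffAt X (hp.prodMk
    ((hG.mul ((h.contDiffAt_chartInvRadius h1).inv h2.ne')).smul contDiff_initPart.contDiffAt))
  exact this

lemma Hole.isOpen_chartDomain (h : Hole a) (e : ℝ) (k : ℕ) : IsOpen (h.chartDomain e k) := by
  rw [isOpen_iff_mem_nhds]
  rintro X ⟨h1, h2, h3⟩
  have e1 := (contDiff_morseForm_one (k := k)).continuous.continuousAt.eventually
    (isOpen_circleChartDomain.mem_nhds h1)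
  have e2 := (h.contDiffAt_chartInvRadius h1).continuousAt.eventually (lt_mem_nhds h2)
  have e3 := (ContinuousAt.comp (x := X) h.contDiff_cofactor.continuous.continuousAt
    (h.contDiffAt_chartPlane e h1 h2).continuousAt).eventually (lt_mem_nhds h3)
  filter_upwards [e1, e2, e3] with Y h1 h2 h3
  exact ⟨h1, h2, h3⟩

lemma Hole.norm_chartPlane (h : Hole a) {e : ℝ} (he : e ^ 2 = 1)
    {X : EuclideanSpace ℝ (Fin (k + 1))} (hX : morseForm (k + 1) 1 X ∈ circleChartDomain i)
    (hX' : 0 < h.chartInvRadius X) : ‖h.chartPlane e X‖ = (h.chartInvRadius X)⁻¹ := by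
  rw [Hole.chartPlane, norm_smul, norm_circleChart _ he hX, mul_one,
    Real.norm_of_nonneg (inv_nonneg.2 hX'.le)]

lemma Hole.alongCoord_chartPlane (h : Hole a) (e : ℝ) (X : EuclideanSpace ℝ (Fin (k + 1))) :
    alongCoord h.1 (h.chartPlane e X) = (h.chartInvRadius X)⁻¹ *
      √(Real.cos (halfAngle i) ^ 2 - 64 * morseForm (k + 1) 1 X) := by
  rw [Hole.chartPlane, alongCoord_smul, circleChart, alongCoord_ofSectorCoords]

lemma Hole.one_sub_chartPlane (h : Hole a) (e : ℝ) {X : EuclideanSpace ℝ (Fin (k + 1))}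
    (hX' : 0 < h.chartInvRadius X) : 1 - h.lev * alongCoord h.1 (h.chartPlane e X) =
      X (Fin.last k) * (h.chartInvRadius X)⁻¹ := by
  rw [h.alongCoord_chartPlane]
  have h1 : (h.chartInvRadius X)⁻¹ * h.chartInvRadius X = 1 := inv_mul_cancel₀ hX'.ne'
  have h2 : h.chartInvRadius X = X (Fin.last k) +
    h.lev * √(Real.cos (halfAngle i) ^ 2 - 64 * morseForm (k + 1) 1 X) := rfl
  linear_combination -h1 + (h.chartInvRadius X)⁻¹ * h2

lemma Hole.form_chartPlane (h : Hole a) {e : ℝ} (he : e ^ 2 = 1)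
    {X : EuclideanSpace ℝ (Fin (k + 1))} (hX : morseForm (k + 1) 1 X ∈ circleChartDomain i)
    (hX' : 0 < h.chartInvRadius X) :
    h.form (h.chartPlane e X) = ((h.chartInvRadius X)⁻¹ * ‖initPart X‖) ^ 2 := by
  have h1 := Real.sq_sqrt (mem_circleChartDomain.1 hX).1.le
  have h2 := morseForm_one X
  rw [Hole.form, holeForm, h.one_sub_chartPlane e hX', h.norm_chartPlane he hX hX',
    h.alongCoord_chartPlane, mul_pow, mul_pow, mul_pow, h1]
  linear_combination (h.chartInvRadius X)⁻¹ ^ 2 * h2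

lemma Hole.chart_mem (h : Hole a) {e : ℝ} (he : e ^ 2 = 1) {X : EuclideanSpace ℝ (Fin (k + 1))}
    (hX : X ∈ h.chartDomain e k) : h.chart e X ∈ polyZeroSet (manifoldPoly a k) := by
  obtain ⟨h1, h2, h3⟩ := hX
  rw [Hole.chart, joinParts_mem_manifold_iff, regionFun_eq_cofactor_mul h,
    h.form_chartPlane he h1 h2, norm_smul, mul_pow ‖_‖, Real.norm_eq_abs, sq_abs,
    mul_pow √_, Real.sq_sqrt h3.le]
  ring

/-- The chart inverts the Morse coordinates. -/
lemma Hole.chart_coords (h : Hole a) {e : ℝ} (he : e ^ 2 = 1) {p : EuclideanSpace ℝ (Fin (k + 2))}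
    (hp : p ∈ polyZeroSet (manifoldPoly a k)) (h1 : 0 < alongCoord h.1 (planePart p))
    (h2 : 0 < e * acrossCoord h.1 (planePart p)) (h3 : 0 < h.cofactor (planePart p)) :
    h.coords p ∈ h.chartDomain e k ∧ h.chart e (h.coords p) = p := by
  set x := planePart p with hx
  have hρ : 0 < ‖x‖ := h1.trans_le (alongCoord_le_norm _ _)
  have hx0 : x ≠ 0 := norm_pos_iff.1 hρ
  have hQ := mem_manifold_iff.1 hp
  rw [← hx, regionFun_eq_cofactor_mul h] at hQ
  have hz1 : 0 < alongCoord h.1 (radialProj x) := by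
    rw [radialProj, alongCoord_smul]; positivity
  have hz2 : 0 < e * acrossCoord h.1 (radialProj x) := by
    rw [radialProj, acrossCoord_smul, mul_left_comm]; positivity
  obtain ⟨hc1, hc2⟩ := circleChart_coord h.1 he (norm_radialProj hx0) hz1 hz2
  have hτ : morseForm (k + 1) 1 (h.coords p) =
      (Real.cos (halfAngle i) ^ 2 - alongCoord h.1 (radialProj x) ^ 2) / 64 := by
    have hG := Real.sq_sqrt h3.le
    have hG0 : √(h.cofactor x) ≠ 0 := (Real.sqrt_pos.2 h3).ne'
    have hform : ‖fibrePart p‖ ^ 2 = √(h.cofactor x) ^ 2 * ((1 - h.lev * alongCoord h.1 x) ^ 2 -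
        (alongCoord h.1 x ^ 2 - Real.cos (halfAngle i) ^ 2 * ‖x‖ ^ 2) / 64) := by
      rw [hG, ← hQ]; rfl
    rw [morseForm_one, h.initPart_coords, h.coords_last, ← hx, norm_smul, mul_pow, hform,
      Real.norm_eq_abs, sq_abs, radialProj, alongCoord_smul]
    field_simp
    ring
  have hr : h.chartInvRadius (h.coords p) = ‖x‖⁻¹ := by
    rw [Hole.chartInvRadius, hτ, h.coords_last, ← hx]
    rw [show Real.cos (halfAngle i) ^ 2 -
      64 * ((Real.cos (halfAngle i) ^ 2 - alongCoord h.1 (radialProj x) ^ 2) / 64) =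
        alongCoord h.1 (radialProj x) ^ 2 by ring, Real.sqrt_sq hz1.le, radialProj, alongCoord_smul]
    ring
  have hpl : h.chartPlane e (h.coords p) = x := by
    rw [Hole.chartPlane, hr, hτ, hc2, inv_inv, norm_smul_radialProj]
  refine ⟨⟨hτ ▸ hc1, by rw [hr]; positivity, by rw [hpl]; exact h3⟩, ?_⟩
  rw [Hole.chart, hpl, hr, h.initPart_coords, ← hx, smul_smul, inv_inv, mul_inv_cancel₀, one_smul,
    hx, joinParts_parts]
  exact mul_ne_zero (Real.sqrt_pos.2 h3).ne' hρ.ne'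

lemma Hole.isLocalParam_chart (h : Hole a) {e : ℝ} (he : e ^ 2 = 1) :
    IsLocalParam (polyZeroSet (manifoldPoly a k)) (h.chartDomain e k) (h.chart e) := by
  have hU := (continuous_alongCoord h.1).comp (continuous_planePart (k := k))
  have hV := (continuous_acrossCoord h.1).comp (continuous_planePart (k := k))
  have hG := h.contDiff_cofactor.continuous.comp (continuous_planePart (k := k))
  refine ⟨h.isOpen_chartDomain e k, fun X hX => (h.contDiffAt_chart e hX).contDiffWithinAt,
    {p | 0 < alongCoord h.1 (planePart p) ∧ 0 < e * acrossCoord h.1 (planePart p) ∧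
      0 < h.cofactor (planePart p)}, h.coords, ?_, ?_, ?_, ?_, ?_, ?_⟩
  · exact (isOpen_lt continuous_const hU).inter
      ((isOpen_lt continuous_const (continuous_const.mul hV)).inter
        (isOpen_lt continuous_const hG))
  · rintro p ⟨h1, -, h3⟩
    have hρ : 0 < ‖planePart p‖ := h1.trans_le (alongCoord_le_norm _ _)
    have hn : ContDiffAt ℝ ∞ (fun p : EuclideanSpace ℝ (Fin (k + 2)) => ‖planePart p‖) p :=
      ContDiffAt.comp p (contDiffAt_norm ℝ (norm_pos_iff.1 hρ)) contDiff_planePart.contDiffAt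
    have hc : ContDiffAt ℝ ∞
        (fun p : EuclideanSpace ℝ (Fin (k + 2)) => √(h.cofactor (planePart p))) p :=
      ContDiffAt.sqrt (ContDiffAt.comp p h.contDiff_cofactor.contDiffAt
        contDiff_planePart.contDiffAt) h3.ne'
    have hu : ContDiffAt ℝ ∞
        (fun p : EuclideanSpace ℝ (Fin (k + 2)) => alongCoord h.1 (planePart p)) p :=
      ContDiffAt.comp p (contDiff_alongCoord h.1).contDiffAt contDiff_planePart.contDiffAt
    refine ContDiffAt.contDiffWithinAt (contDiffAt_euclidean.2 fun l => ?_)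
    refine Fin.lastCases ?_ (fun l => ?_) l
    · simp only [h.coords_last]
      exact (contDiffAt_const.sub (contDiffAt_const.mul hu)).mul (hn.inv hρ.ne')
    · have e1 : ∀ p : EuclideanSpace ℝ (Fin (k + 2)), h.coords p l.castSucc =
          (√(h.cofactor (planePart p)) * ‖planePart p‖)⁻¹ * fibrePart p l := by
        intro p
        simp [Hole.coords]
      simp only [e1]
      exact ((hc.mul hn).inv (mul_ne_zero (Real.sqrt_pos.2 h3).ne' hρ.ne')).mul
        (contDiffAt_euclidean.1 contDiff_fibrePart.contDiffAt l)
  · rintro X hX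
    refine ⟨?_, h.chart_mem he hX⟩
    obtain ⟨h1, h2, h3⟩ := hX
    have h1' := mem_circleChartDomain.1 h1
    simp only [Hole.chart, mem_ofPred_eq, planePart_joinParts]
    refine ⟨?_, ?_, h3⟩
    · rw [h.alongCoord_chartPlane]
      exact mul_pos (inv_pos.2 h2) (Real.sqrt_pos.2 h1'.1)
    · rw [Hole.chartPlane, acrossCoord_smul, circleChart, acrossCoord_ofSectorCoords,
        mul_left_comm e, ← mul_assoc e, ← pow_two, he, one_mul]
      exact mul_pos (inv_pos.2 h2) (Real.sqrt_pos.2 h1'.2)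
  · rintro p ⟨⟨h1, h2, h3⟩, hp⟩
    exact (h.chart_coords he hp h1 h2 h3).1
  · rintro X ⟨h1, h2, h3⟩
    apply eq_of_initPart_eq
    · rw [h.initPart_coords, Hole.chart, planePart_joinParts, fibrePart_joinParts,
        h.norm_chartPlane he h1 h2, smul_smul, inv_mul_cancel₀, one_smul]
      exact mul_ne_zero (Real.sqrt_pos.2 h3).ne' (inv_ne_zero h2.ne')
    · rw [h.coords_last, Hole.chart, planePart_joinParts, h.norm_chartPlane he h1 h2,
        h.one_sub_chartPlane e h2, inv_inv, mul_assoc, inv_mul_cancel₀ h2.ne', mul_one]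
  · rintro p ⟨⟨h1, h2, h3⟩, hp⟩
    exact (h.chart_coords he hp h1 h2 h3).2

lemma Hole.angularMap_chart (h : Hole a) {e : ℝ} (he : e ^ 2 = 1)
    {X : EuclideanSpace ℝ (Fin (k + 1))} (hX : X ∈ h.chartDomain e k) :
    angularMap (h.chart e X) = circleChart h.1 e (morseForm (k + 1) 1 X) := by
  rw [angularMap, Hole.chart, planePart_joinParts, Hole.chartPlane,
    radialProj_smul (inv_pos.2 hX.2.1), radialProj_of_norm_eq_one (norm_circleChart _ he hX.1)]

lemma Hole.chartInvRadius_zero (hi : 2 ≤ i) (h : Hole a) :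
    h.chartInvRadius (0 : EuclideanSpace ℝ (Fin (k + 1))) =
      h.lev * Real.cos (halfAngle i) := by
  have := half_le_cos_halfAngle hi
  rw [Hole.chartInvRadius, morseForm_zero, mul_zero, sub_zero, Real.sqrt_sq (by linarith)]
  simp

lemma Hole.chart_zero (hi : 2 ≤ i) (h : Hole a) (e : ℝ) :
    h.chart e (0 : EuclideanSpace ℝ (Fin (k + 1))) =
      joinParts ((h.lev * Real.cos (halfAngle i))⁻¹ •
        ofSectorCoords h.1 (Real.cos (halfAngle i)) (e * Real.sin (halfAngle i))) 0 := by
  have h1 := half_le_cos_halfAngle hi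
  have h2 := sin_halfAngle_pos hi
  have h3 : initPart (0 : EuclideanSpace ℝ (Fin (k + 1))) = 0 := by
    ext l
    simp [initPart]
  rw [Hole.chart, Hole.chartPlane, h.chartInvRadius_zero hi, h3, smul_zero, circleChart,
    morseForm_zero, mul_zero, sub_zero, add_zero, Real.sqrt_sq (by linarith), Real.sqrt_sq h2.le]

lemma Hole.zero_mem_chartDomain (hi : 2 ≤ i) (h : Hole a) {e : ℝ} (he : e ^ 2 = 1) :
    0 ∈ h.chartDomain e k := by
  have h1 : morseForm (k + 1) 1 0 ∈ circleChartDomain i := by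
    rw [morseForm_zero]; exact zero_mem_circleChartDomain hi
  have h2 : 0 < h.chartInvRadius (0 : EuclideanSpace ℝ (Fin (k + 1))) := by
    rw [h.chartInvRadius_zero hi]
    have := half_le_cos_halfAngle hi
    have := h.one_le_lev
    positivity
  refine ⟨h1, h2, Hole.cofactor_pos hi (le_of_eq ?_)⟩
  rw [h.form_chartPlane he h1 h2]
  have h3 : initPart (0 : EuclideanSpace ℝ (Fin (k + 1))) = 0 := by
    ext l
    simp [initPart]
  simp [h3]

/-- The points of tangency are singular points. -/
lemma Hole.isSingularPoint_chart_zero (hi : 2 ≤ i) (h : Hole a) {e : ℝ} (he : e ^ 2 = 1) :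
    IsSingularPoint (polyZeroSet (manifoldPoly a k)) (k + 1) angularMap (h.chart e 0) := by
  refine ⟨h.chartDomain e k, h.chart e, 0, h.isLocalParam_chart he, h.zero_mem_chartDomain hi he,
    rfl, ?_⟩
  have hev : (fun X => angularMap (h.chart e X)) =ᶠ[𝓝 0]
      circleChart h.1 e ∘ morseForm (k + 1) 1 := by
    filter_upwards [(h.isOpen_chartDomain e k).mem_nhds (h.zero_mem_chartDomain hi he)] with X hX
    exact h.angularMap_chart he hX
  rw [hev.fderiv_eq]
  have h1 : DifferentiableAt ℝ (circleChart h.1 e) (morseForm (k + 1) 1 0) := by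
    rw [morseForm_zero]
    exact (contDiffAt_circleChart h.1 e (zero_mem_circleChartDomain hi)).differentiableAt (by simp)
  rw [(h1.hasFDerivAt.comp 0 (hasFDerivAt_morseForm_zero (k + 1) 1)).fderiv]
  simp

/-- Every singular point is the centre of one of the Morse charts. -/
lemma exists_chart_zero_eq (hi : 2 ≤ i) {d : ℕ} {p : EuclideanSpace ℝ (Fin (k + 2))}
    (hp : p ∈ polyZeroSet (manifoldPoly a k))
    (hs : IsSingularPoint (polyZeroSet (manifoldPoly a k)) d angularMap p) :
    ∃ (h : Hole a) (e : ℝ), e ^ 2 = 1 ∧ h.chart e 0 = p := by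
  obtain ⟨h, hh, hu⟩ := exists_hole_of_isSingularPoint hi hp hs
  have hy : fibrePart p = 0 := by
    have := mem_manifold_iff.1 hp
    rw [regionFun_eq_cofactor_mul h, hh, mul_zero] at this
    exact norm_eq_zero.1 (pow_eq_zero_iff two_ne_zero |>.1 this.symm)
  have hn : (h.lev * Real.cos (halfAngle i))⁻¹ = ‖planePart p‖ := by
    have := of_holeForm_eq_zero hh hu
    rw [hu, ← mul_assoc] at this
    exact inv_eq_of_mul_eq_one_right this
  have hjoin : joinParts (planePart p) 0 = p := by
    rw [← hy, joinParts_parts]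
  rcases eq_smul_sectorRay h.1 hu with h1 | h1
  · refine ⟨h, -1, by norm_num, ?_⟩
    rw [h.chart_zero hi, hn, neg_one_mul, ← sectorRay_eq, ← h1, hjoin]
  · refine ⟨h, 1, by norm_num, ?_⟩
    rw [h.chart_zero hi, hn, one_mul, ← sectorRay_succ_eq, ← h1, hjoin]

lemma angularMap_chart_zero (hi : 2 ≤ i) (h : Hole a) {e : ℝ} (he : e ^ 2 = 1) :
    angularMap (h.chart e (0 : EuclideanSpace ℝ (Fin (k + 1)))) = sectorRay h.1 ∨
      angularMap (h.chart e (0 : EuclideanSpace ℝ (Fin (k + 1)))) = sectorRay (h.1 + 1) := by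
  have h1 := half_le_cos_halfAngle hi
  have h2 := h.one_le_lev
  rw [h.chart_zero hi, angularMap, planePart_joinParts, radialProj_smul (by positivity)]
  rcases sq_eq_one_iff.1 he with rfl | rfl
  · right
    rw [one_mul, ← sectorRay_succ_eq, radialProj_of_norm_eq_one (norm_sectorRay _)]
  · left
    rw [neg_one_mul, ← sectorRay_eq, radialProj_of_norm_eq_one (norm_sectorRay _)]

lemma isMorseFunction_angularMap (hi : 2 ≤ i) (hk : 1 ≤ k) (a : Fin (i + 1) → ℕ) :
    IsMorseFunction (polyZeroSet (manifoldPoly a k)) (k + 1) unitCircle angularMap := by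
  refine ⟨fun p hp => ?_, fun p hp => ?_, fun p hp hs => ?_⟩
  · refine ⟨{q | planePart q ≠ 0}, angularMap, isOpen_ne.preimage continuous_planePart,
      norm_pos_iff.1 (norm_planePart_pos hi hp), fun q hq => ?_, fun _ _ => rfl⟩
    exact (contDiffAt_angularMap hq).contDiffWithinAt
  · exact norm_radialProj (norm_pos_iff.1 (norm_planePart_pos hi hp))
  · obtain ⟨h, e, he, rfl⟩ := exists_chart_zero_eq hi hp hs
    refine ⟨1, h.chartDomain e k, h.chart e, circleChartDomain i, circleChart h.1 e, by omega,
      h.isLocalParam_chart he, h.zero_mem_chartDomain hi he, rfl, isLocalParam_circleChart h.1 he,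
      zero_mem_circleChartDomain hi, ?_, fun X hX => ⟨hX.1, h.angularMap_chart he hX⟩⟩
    rw [h.angularMap_chart he (h.zero_mem_chartDomain hi he), morseForm_zero]

/-- Over each ray between two sectors there is a singular point, since one of these sectors contains
a hole. -/
lemma exists_isSingularPoint_over (hi : 2 ≤ i) {a : Fin (i + 1) → ℕ} (hpos : ∀ j, 0 < a j)
    (hne : ∀ j : Fin (i + 1), (a j, a (j + 1)) ≠ (1, 1)) (j : Fin (i + 1)) :
    ∃ p ∈ polyZeroSet (manifoldPoly a k), angularMap p = sectorRay j ∧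
      IsSingularPoint (polyZeroSet (manifoldPoly a k)) (k + 1) angularMap p := by
  have key : ∀ (h : Hole a) (e : ℝ), e ^ 2 = 1 →
      ofSectorCoords h.1 (Real.cos (halfAngle i)) (e * Real.sin (halfAngle i)) = sectorRay j →
      ∃ p ∈ polyZeroSet (manifoldPoly a k), angularMap p = sectorRay j ∧
        IsSingularPoint (polyZeroSet (manifoldPoly a k)) (k + 1) angularMap p := by
    intro h e he hray
    refine ⟨h.chart e 0, h.chart_mem he (h.zero_mem_chartDomain hi he), ?_,
      h.isSingularPoint_chart_zero hi he⟩
    have h1 := half_le_cos_halfAngle hi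
    have h2 := h.one_le_lev
    rw [h.chart_zero hi, angularMap, planePart_joinParts, radialProj_smul (by positivity), hray,
      radialProj_of_norm_eq_one (norm_sectorRay _)]
  have hj := hne (j - 1)
  rw [sub_add_cancel] at hj
  by_cases h1 : a j = 1
  · have h2 : a (j - 1) ≠ 1 := fun h => hj (by rw [h, h1])
    have h3 := hpos (j - 1)
    refine key ⟨j - 1, ⟨0, by omega⟩⟩ 1 (by norm_num) ?_
    rw [one_mul, ← sectorRay_succ_eq, sub_add_cancel]
  · have h3 := hpos j
    refine key ⟨j, ⟨0, by omega⟩⟩ (-1) (by norm_num) ?_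
    rw [neg_one_mul, ← sectorRay_eq]

end Chart

/-! ### Parametrized necklace graphs -/

/-- A parametrization of a graph with cyclically ordered vertices, in which `a j` edges lead from the
`j`-th to the next vertex. -/
structure NecklaceParam (X : Type*) [TopologicalSpace X] {i : ℕ} (a : Fin (i + 1) → ℕ) where
  /-- The vertices. -/
  vert : Fin (i + 1) → X
  /-- The parametrizations of the closed edges by the interval `[-1, 1]`. -/
  edge : (j : Fin (i + 1)) → Fin (a j) → ℝ → X
  continuousOn_edge : ∀ j l, ContinuousOn (edge j l) (Icc (-1) 1)
  edge_neg_one : ∀ j l, edge j l (-1) = vert j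
  edge_one : ∀ j l, edge j l 1 = vert (j + 1)
  vert_injective : Function.Injective vert
  edge_injective : ∀ j l j' l' s t, s ∈ Ioo (-1 : ℝ) 1 → t ∈ Ioo (-1 : ℝ) 1 →
    edge j l s = edge j' l' t → (⟨j, l⟩ : Σ j, Fin (a j)) = ⟨j', l'⟩ ∧ s = t
  edge_ne_vert : ∀ j l s j', s ∈ Ioo (-1 : ℝ) 1 → edge j l s ≠ vert j'
  exists_eq : ∀ x, (∃ j, vert j = x) ∨ ∃ j l, ∃ s ∈ Ioo (-1 : ℝ) 1, edge j l s = x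

section CW

variable {X : Type*} [TopologicalSpace X] [CWComplex (univ : Set X)]

lemma const_mem_ball_iff {t : ℝ} :
    (fun _ => t : Fin 1 → ℝ) ∈ Metric.ball (0 : Fin 1 → ℝ) 1 ↔ t ∈ Ioo (-1 : ℝ) 1 := by
  rw [mem_ball_zero_iff, pi_norm_const, Real.norm_eq_abs, abs_lt, mem_Ioo]

lemma const_mem_closedBall_iff {t : ℝ} :
    (fun _ => t : Fin 1 → ℝ) ∈ Metric.closedBall (0 : Fin 1 → ℝ) 1 ↔ t ∈ Icc (-1 : ℝ) 1 := by
  rw [mem_closedBall_zero_iff, pi_norm_const, Real.norm_eq_abs, abs_le, mem_Icc]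

lemma map_mem_openCell (e : RelCWComplex.cell (univ : Set X) 1) {t : ℝ}
    (ht : t ∈ Ioo (-1 : ℝ) 1) :
    RelCWComplex.map 1 e (fun _ => t) ∈ RelCWComplex.openCell 1 e :=
  ⟨_, const_mem_ball_iff.2 ht, rfl⟩

/-- An edge joining two given vertices can be traversed from the first to the second one. -/
lemma exists_orientation {e : RelCWComplex.cell (univ : Set X) 1}
    {x y : RelCWComplex.cell (univ : Set X) 0}
    (h : (CWComplex.OneSkeletonGraph (univ : Set X)).IsLink e x y) :
    ∃ σ : ℝ, (σ = 1 ∨ σ = -1) ∧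
      RelCWComplex.map 1 e (fun _ => -σ) = RelCWComplex.map 0 x ![] ∧
      RelCWComplex.map 1 e (fun _ => σ) = RelCWComplex.map 0 y ![] := by
  rw [CWComplex.OneSkeletonGraph.isLink_iff_pair, RelCWComplex.cellFrontier_one_eq,
    image_pair, pair_eq_pair_iff] at h
  have e1 : (fun _ => -1 : Fin 1 → ℝ) = -1 := rfl
  have e2 : (fun _ => 1 : Fin 1 → ℝ) = 1 := rfl
  rcases h with ⟨h1, h2⟩ | ⟨h1, h2⟩
  · exact ⟨1, Or.inl rfl, by rw [e1, h1], by rw [e2, h2]⟩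
  · exact ⟨-1, Or.inr rfl, by rw [neg_neg, e2, h2], by rw [e1, h1]⟩

/-- An edge of a cycle with at least three vertices determines its position. -/
lemma isLink_position_unique {i : ℕ} (hi : 2 ≤ i)
    (v : Fin (i + 1) ≃ RelCWComplex.cell (univ : Set X) 0)
    {e : RelCWComplex.cell (univ : Set X) 1} {j j' : Fin (i + 1)}
    (h : (CWComplex.OneSkeletonGraph (univ : Set X)).IsLink e (v j) (v (j + 1)))
    (h' : (CWComplex.OneSkeletonGraph (univ : Set X)).IsLink e (v j') (v (j' + 1))) : j = j' := by
  rw [CWComplex.OneSkeletonGraph.isLink_iff_pair] at h h'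
  rw [h, pair_eq_pair_iff] at h'
  simp only [RelCWComplex.map_zero_eq_self_iff, v.apply_eq_iff_eq] at h'
  rcases h' with ⟨h1, -⟩ | ⟨h1, h2⟩
  · exact h1
  · exfalso
    -- Here `j = j + 2`, which is impossible modulo `i + 1 ≥ 3`.
    have h3 : (1 + 1 : Fin (i + 1)) = 0 := by
      have : j + (1 + 1) = j + 0 := by rw [add_zero, ← add_assoc, h2, ← h1]
      exact add_left_cancel this
    have h4 := congrArg Fin.val h3
    rw [Fin.val_add, Fin.val_one', Fin.val_zero, Nat.mod_eq_of_lt (by omega : 1 < i + 1),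
      Nat.mod_eq_of_lt (by omega)] at h4
    omega

/-- Numbering the edges between consecutive vertices, and orienting each of them by a sign `σ`, turns
the characteristic maps of the cells into a parametrization. -/
theorem exists_necklaceParam (hX : IsCWGraph X) {i : ℕ} (hi : 2 ≤ i)
    (v : Fin (i + 1) ≃ RelCWComplex.cell (univ : Set X) 0) (a : Fin (i + 1) → ℕ)
    (hedge : ∀ e : RelCWComplex.cell (univ : Set X) 1, ∃ j : Fin (i + 1),
      (CWComplex.OneSkeletonGraph (univ : Set X)).IsLink e (v j) (v (j + 1)))
    (hcount : ∀ j : Fin (i + 1),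
      Nat.card {e : RelCWComplex.cell (univ : Set X) 1 //
        (CWComplex.OneSkeletonGraph (univ : Set X)).IsLink e (v j) (v (j + 1))} = a j)
    (hpos : ∀ j, 0 < a j) :
    ∃ G : NecklaceParam X a,
      range G.vert = ⋃ z : RelCWComplex.cell (univ : Set X) 0, RelCWComplex.closedCell 0 z ∧
      ∀ e : RelCWComplex.cell (univ : Set X) 1, ∃ j l, ∃ σ : ℝ, (σ = 1 ∨ σ = -1) ∧
        ∀ t, RelCWComplex.map 1 e (fun _ => t) = G.edge j l (σ * t) := by
  have hfin : ∀ j, Nonempty (Fin (a j) ≃ {e : RelCWComplex.cell (univ : Set X) 1 //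
      (CWComplex.OneSkeletonGraph (univ : Set X)).IsLink e (v j) (v (j + 1))}) := by
    intro j
    have : Finite {e : RelCWComplex.cell (univ : Set X) 1 //
        (CWComplex.OneSkeletonGraph (univ : Set X)).IsLink e (v j) (v (j + 1))} :=
      Nat.finite_of_card_ne_zero (by rw [hcount]; exact (hpos j).ne')
    exact ⟨(Finite.equivFinOfCardEq (hcount j)).symm⟩
  let E := fun j => (hfin j).some
  choose σ hσ hσ0 hσ1 using fun (j : Fin (i + 1)) (l : Fin (a j)) =>
    exists_orientation (E j l).2
  have hball : ∀ j l (t : ℝ), t ∈ Ioo (-1 : ℝ) 1 → σ j l * t ∈ Ioo (-1 : ℝ) 1 := by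
    intro j l t ht
    rcases hσ j l with h | h <;> rw [h] <;> constructor <;> linarith [ht.1, ht.2]
  have hclosed : ∀ j l (t : ℝ), t ∈ Icc (-1 : ℝ) 1 → σ j l * t ∈ Icc (-1 : ℝ) 1 := by
    intro j l t ht
    rcases hσ j l with h | h <;> rw [h] <;> constructor <;> linarith [ht.1, ht.2]
  have hσσ : ∀ j l, σ j l * σ j l = 1 := by
    intro j l
    rcases hσ j l with h | h <;> rw [h] <;> norm_num
  have hEeq : ∀ j l j' l', (E j l : RelCWComplex.cell (univ : Set X) 1) = E j' l' →
      (⟨j, l⟩ : Σ j, Fin (a j)) = ⟨j', l'⟩ := by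
    intro j l j' l' h
    have hj : j = j' := isLink_position_unique hi v (E j l).2 (h ▸ (E j' l').2)
    subst hj
    rw [(E j).injective (Subtype.ext h)]
  have hEsurj : ∀ e : RelCWComplex.cell (univ : Set X) 1, ∃ j l, (E j l : _) = e := by
    intro e
    obtain ⟨j, hj⟩ := hedge e
    exact ⟨j, (E j).symm ⟨e, hj⟩, by rw [Equiv.apply_symm_apply]⟩
  refine ⟨{ vert := fun j => RelCWComplex.map 0 (v j) ![]
            edge := fun j l t => RelCWComplex.map 1 (E j l : RelCWComplex.cell (univ : Set X) 1)
              (fun _ => σ j l * t)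
            continuousOn_edge := ?_
            edge_neg_one := ?_
            edge_one := ?_
            vert_injective := ?_
            edge_injective := ?_
            edge_ne_vert := ?_
            exists_eq := ?_ }, ?_, ?_⟩
  · intro j l
    refine (RelCWComplex.continuousOn 1 _).comp (by fun_prop) fun t ht => ?_
    exact const_mem_closedBall_iff.2 (hclosed j l t ht)
  · intro j l
    simp only [mul_neg, mul_one]
    exact hσ0 j l
  · intro j l
    simp only [mul_one]
    exact hσ1 j l
  · intro j j' h
    exact v.injective (RelCWComplex.injective_map_zero _ h)
  · intro j l j' l' s t hs ht h
    have hm1 := map_mem_openCell (E j l : RelCWComplex.cell (univ : Set X) 1) (hball j l s hs)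
    have hm2 := map_mem_openCell (E j' l' : RelCWComplex.cell (univ : Set X) 1) (hball j' l' t ht)
    rw [← h] at hm2
    have hE := RelCWComplex.eq_of_not_disjoint_openCell (not_disjoint_iff.2 ⟨_, hm1, hm2⟩)
    have hE' : (E j l : RelCWComplex.cell (univ : Set X) 1) = E j' l' := by simpa using hE
    have hjl := hEeq j l j' l' hE'
    refine ⟨hjl, ?_⟩
    cases hjl
    have hinj := (RelCWComplex.map 1 (E j l : RelCWComplex.cell (univ : Set X) 1)).injOn
    rw [RelCWComplex.source_eq] at hinj
    have := congrFun (hinj (const_mem_ball_iff.2 (hball j l s hs))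
      (const_mem_ball_iff.2 (hball j l t ht)) h) 0
    have h2 := congrArg (σ j l * ·) this
    simpa [← mul_assoc, hσσ] using h2
  · intro j l s j' hs h
    have hm1 := map_mem_openCell (E j l : RelCWComplex.cell (univ : Set X) 1) (hball j l s hs)
    have hm2 : RelCWComplex.map 1 (E j l : RelCWComplex.cell (univ : Set X) 1)
        (fun _ => σ j l * s) ∈ RelCWComplex.openCell 0 (v j') := by
      rw [RelCWComplex.openCell_zero_eq_singleton, mem_singleton_iff]
      exact h
    have hE := RelCWComplex.eq_of_not_disjoint_openCell (not_disjoint_iff.2 ⟨_, hm1, hm2⟩)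
    exact absurd (congrArg Sigma.fst hE) (by simp)
  · intro x
    have hx : x ∈ ⋃ (n : ℕ) (j : RelCWComplex.cell (univ : Set X) n),
        RelCWComplex.openCell n j := by
      rw [CWComplex.iUnion_openCell_eq_complex]; exact mem_univ x
    obtain ⟨n, e, he⟩ := mem_iUnion₂.1 hx
    match n, e, he with
    | 0, e, he =>
      left
      rw [RelCWComplex.openCell_zero_eq_singleton, mem_singleton_iff] at he
      exact ⟨v.symm e, by simp only [Equiv.apply_symm_apply]; exact he.symm⟩
    | 1, e, he =>
      right
      obtain ⟨y, hy, rfl⟩ := he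
      obtain ⟨j, l, rfl⟩ := hEsurj e
      have hy' : y = fun _ => y 0 := by
        funext z
        rw [Subsingleton.elim z 0]
      rw [hy', const_mem_ball_iff] at hy
      refine ⟨j, l, σ j l * y 0, hball j l _ hy, ?_⟩
      simp only [← mul_assoc, hσσ, one_mul]
      rw [← hy']
    | n + 2, e, he => exact ((hX.dim_le_one (n + 2) (by omega)).false e).elim
  · ext x
    simp only [mem_range, mem_iUnion, RelCWComplex.closedCell_zero_eq_singleton, mem_singleton_iff]
    constructor
    · rintro ⟨j, rfl⟩
      exact ⟨v j, rfl⟩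
    · rintro ⟨z, rfl⟩
      exact ⟨v.symm z, by rw [Equiv.apply_symm_apply]⟩
  · intro e
    obtain ⟨j, l, rfl⟩ := hEsurj e
    refine ⟨j, l, σ j l, hσ j l, fun t => ?_⟩
    simp only [← mul_assoc, hσσ, one_mul]

end CW

/-! ### The angular parameter of a sector -/

section SectorParam

variable {i : ℕ}

/-- The quotient of the coordinates across and along the bisector, scaled such that its range on the
closed sector is `[-1, 1]`. -/
def sectorParam (j : Fin (i + 1)) (x : EuclideanSpace ℝ (Fin 2)) : ℝ :=
  acrossCoord j x * Real.cos (halfAngle i) / (alongCoord j x * Real.sin (halfAngle i))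

/-- The unit vector with the given angular parameter. -/
def sectorDir (j : Fin (i + 1)) (t : ℝ) : EuclideanSpace ℝ (Fin 2) :=
  radialProj (ofSectorCoords j (Real.cos (halfAngle i)) (t * Real.sin (halfAngle i)))

lemma sectorParam_smul (j : Fin (i + 1)) {ρ : ℝ} (hρ : ρ ≠ 0) (x : EuclideanSpace ℝ (Fin 2)) :
    sectorParam j (ρ • x) = sectorParam j x := by
  rw [sectorParam, sectorParam, acrossCoord_smul, alongCoord_smul, mul_assoc, mul_assoc,
    mul_div_mul_left _ _ hρ]

lemma sectorParam_radialProj (j : Fin (i + 1)) {x : EuclideanSpace ℝ (Fin 2)} (hx : x ≠ 0) :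
    sectorParam j (radialProj x) = sectorParam j x :=
  sectorParam_smul j (inv_ne_zero (norm_ne_zero_iff.2 hx)) x

lemma sectorParam_ofSectorCoords (hi : 2 ≤ i) (j : Fin (i + 1)) (t : ℝ) :
    sectorParam j (ofSectorCoords j (Real.cos (halfAngle i)) (t * Real.sin (halfAngle i))) = t := by
  have h1 := half_le_cos_halfAngle hi
  have h2 := sin_halfAngle_pos hi
  have h3 : Real.cos (halfAngle i) ≠ 0 := by linarith
  rw [sectorParam, alongCoord_ofSectorCoords, acrossCoord_ofSectorCoords]
  field_simp

lemma ofSectorCoords_ne_zero (hi : 2 ≤ i) (j : Fin (i + 1)) (v : ℝ) :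
    ofSectorCoords j (Real.cos (halfAngle i)) v ≠ 0 := by
  intro h
  have h1 := norm_ofSectorCoords_sq j (Real.cos (halfAngle i)) v
  rw [h, norm_zero] at h1
  nlinarith [half_le_cos_halfAngle hi, sq_nonneg v]

lemma sectorParam_sectorDir (hi : 2 ≤ i) (j : Fin (i + 1)) (t : ℝ) :
    sectorParam j (sectorDir j t) = t := by
  rw [sectorDir, sectorParam_radialProj j (ofSectorCoords_ne_zero hi j _),
    sectorParam_ofSectorCoords hi]

lemma norm_sectorDir (hi : 2 ≤ i) (j : Fin (i + 1)) (t : ℝ) : ‖sectorDir j t‖ = 1 :=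
  norm_radialProj (ofSectorCoords_ne_zero hi j _)

lemma sectorDir_sectorParam (hi : 2 ≤ i) (j : Fin (i + 1)) {x : EuclideanSpace ℝ (Fin 2)}
    (hx : 0 < alongCoord j x) : sectorDir j (sectorParam j x) = radialProj x := by
  have h1 := half_le_cos_halfAngle hi
  have h2 := sin_halfAngle_pos hi
  have h3 : 0 < Real.cos (halfAngle i) / alongCoord j x := div_pos (by linarith) hx
  rw [← radialProj_smul h3, sectorDir]
  congr 1
  apply eq_of_coords_eq j
  · rw [alongCoord_ofSectorCoords, alongCoord_smul]
    field_simp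
  · rw [acrossCoord_ofSectorCoords, acrossCoord_smul, sectorParam]
    field_simp

lemma sectorDir_neg_one (j : Fin (i + 1)) : sectorDir j (-1) = sectorRay j := by
  rw [sectorDir, neg_one_mul, ← sectorRay_eq, radialProj_of_norm_eq_one (norm_sectorRay j)]

lemma sectorDir_one (j : Fin (i + 1)) : sectorDir j 1 = sectorRay (j + 1) := by
  rw [sectorDir, one_mul, ← sectorRay_succ_eq, radialProj_of_norm_eq_one (norm_sectorRay _)]

/-- The sector is the set where the parameter lies in `[-1, 1]`. -/
lemma sector_iff_sq_le (hi : 2 ≤ i) (j : Fin (i + 1)) {x : EuclideanSpace ℝ (Fin 2)}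
    (hx : 0 < alongCoord j x) :
    (Real.cos (halfAngle i) * ‖x‖ ≤ alongCoord j x ↔ sectorParam j x ^ 2 ≤ 1) ∧
    (Real.cos (halfAngle i) * ‖x‖ < alongCoord j x ↔ sectorParam j x ^ 2 < 1) := by
  have h1 := half_le_cos_halfAngle hi
  have h2 := sin_halfAngle_pos hi
  have h3 : 0 < Real.cos (halfAngle i) := by linarith
  have hn := norm_sq_eq_coords j x
  have hcs := Real.sin_sq_add_cos_sq (halfAngle i)
  have hpos : 0 < (alongCoord j x * Real.sin (halfAngle i)) ^ 2 := by positivity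
  have key : (alongCoord j x * Real.sin (halfAngle i)) ^ 2 -
      (acrossCoord j x * Real.cos (halfAngle i)) ^ 2 =
      alongCoord j x ^ 2 - (Real.cos (halfAngle i) * ‖x‖) ^ 2 := by
    linear_combination Real.cos (halfAngle i) ^ 2 * hn + alongCoord j x ^ 2 * hcs
  rw [sectorParam, div_pow, div_le_one hpos, div_lt_one hpos,
    ← pow_le_pow_iff_left₀ (by positivity) hx.le two_ne_zero,
    ← pow_lt_pow_iff_left₀ (by positivity) hx.le two_ne_zero]
  constructor <;> constructor <;> intro h <;> linarith

lemma alongCoord_sectorDir_pos (hi : 2 ≤ i) (j : Fin (i + 1)) (t : ℝ) :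
    0 < alongCoord j (sectorDir j t) := by
  rw [sectorDir, radialProj, alongCoord_smul, alongCoord_ofSectorCoords]
  exact mul_pos (inv_pos.2 (norm_pos_iff.2 (ofSectorCoords_ne_zero hi j _)))
    (by linarith [half_le_cos_halfAngle hi])

lemma cos_le_alongCoord_sectorDir (hi : 2 ≤ i) (j : Fin (i + 1)) {t : ℝ} (ht : t ∈ Icc (-1 : ℝ) 1) :
    Real.cos (halfAngle i) ≤ alongCoord j (sectorDir j t) := by
  have h := (sector_iff_sq_le hi j (alongCoord_sectorDir_pos hi j t)).1.2
  rw [sectorParam_sectorDir hi, norm_sectorDir hi, mul_one] at h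
  exact h (by nlinarith [ht.1, ht.2])

lemma contDiff_sectorDir (hi : 2 ≤ i) (j : Fin (i + 1)) : ContDiff ℝ ∞ (sectorDir j) := by
  rw [contDiff_iff_contDiffAt]
  intro t
  have h1 : ContDiffAt ℝ ∞ (fun t : ℝ => ofSectorCoords j (Real.cos (halfAngle i))
      (t * Real.sin (halfAngle i))) t :=
    (contDiff_ofSectorCoords j).comp_contDiffAt t
      (contDiffAt_const.prodMk (contDiffAt_id.mul contDiffAt_const))
  exact ContDiffAt.comp (g := radialProj) t
    (contDiffAt_radialProj (ofSectorCoords_ne_zero hi j _)) h1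

/-- The direction moves with non-zero speed, since the parameter is a left inverse. -/
lemma sectorDir_regular (hi : 2 ≤ i) (j : Fin (i + 1)) (σ t : ℝ) (hσ : σ ≠ 0)
    {w : EuclideanSpace ℝ (Fin 2)} (hw : HasDerivAt (fun t => sectorDir j (σ * t)) w t) : w ≠ 0 := by
  rintro rfl
  have h2 := sin_halfAngle_pos hi
  have hd : DifferentiableAt ℝ (sectorParam j) (sectorDir j (σ * t)) := by
    have hne : alongCoord j (sectorDir j (σ * t)) * Real.sin (halfAngle i) ≠ 0 :=
      (mul_pos (alongCoord_sectorDir_pos hi j _) h2).ne'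
    have e : ContDiffAt ℝ ∞ (sectorParam j) (sectorDir j (σ * t)) :=
      ((contDiff_acrossCoord j).contDiffAt.mul contDiffAt_const).div
        ((contDiff_alongCoord j).contDiffAt.mul contDiffAt_const) hne
    exact e.differentiableAt (by simp)
  have h3 := hd.hasFDerivAt.comp_hasDerivAt t hw
  rw [map_zero] at h3
  have h4 : HasDerivAt (fun t : ℝ => σ * t) 0 t := by
    refine h3.congr_of_eventuallyEq (Filter.Eventually.of_forall fun s => ?_)
    exact (sectorParam_sectorDir hi j (σ * s)).symm
  have h5 : HasDerivAt (fun t : ℝ => σ * t) σ t := by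
    simpa using (hasDerivAt_id t).const_mul σ
  exact hσ (h5.unique h4)

/-- An edge of a graph over the circle traversing a sector is piecewise regular. -/
lemma isPiecewiseRegular_sectorDir (hi : 2 ≤ i) (j : Fin (i + 1)) {σ : ℝ} (hσ : σ ≠ 0)
    {γ : ℝ → EuclideanSpace ℝ (Fin 2)} (hγ : ∀ t ∈ Icc (-1 : ℝ) 1, γ t = sectorDir j (σ * t)) :
    IsPiecewiseRegular γ := by
  have hc : ContDiff ℝ ∞ fun t => sectorDir j (σ * t) :=
    (contDiff_sectorDir hi j).comp (contDiff_const.mul contDiff_id)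
  refine ⟨∅, fun s t hs hst ht _ => ?_⟩
  have heq : EqOn γ (fun t => sectorDir j (σ * t)) (Icc s t) := fun τ hτ =>
    hγ τ ⟨hs.trans hτ.1, hτ.2.trans ht⟩
  refine ⟨hc.contDiffOn.congr heq, fun τ hτ => ?_⟩
  have hd := (hc.differentiable (by simp) τ).hasDerivAt
  rw [derivWithin_congr heq (heq hτ),
    hd.hasDerivWithinAt.derivWithin (uniqueDiffOn_Icc hst τ hτ)]
  exact sectorDir_regular hi j σ τ hσ hd

end SectorParam

/-! ### The Reeb space -/

section Reeb

variable {X : Type*} [TopologicalSpace X] {i : ℕ} {a : Fin (i + 1) → ℕ} {k : ℕ}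

/-- The angular coordinate on the manifold. -/
abbrev angularOn (a : Fin (i + 1) → ℕ) (k : ℕ) :
    polyZeroSet (manifoldPoly a k) → EuclideanSpace ℝ (Fin 2) :=
  (polyZeroSet (manifoldPoly a k)).domRestrict angularMap

/-- A point of the manifold is in the same component of its fibre as a boundary point of the region,
if the segment between their plane parts lies in the region: the curve over the segment with constant
direction in the complement of the plane connects them. -/
lemma reebSetoid_of_segment (hk : 1 ≤ k) {z : EuclideanSpace ℝ (Fin 2)} {ρ₀ ρ : ℝ}
    (p b : polyZeroSet (manifoldPoly a k)) (hp : planePart p.1 = ρ • z)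
    (hb : b.1 = joinParts (ρ₀ • z) 0)
    (hseg : ∀ ρ' ∈ uIcc ρ₀ ρ, 0 < ρ' ∧ 0 ≤ regionFun a (ρ' • z)) :
    (reebSetoid (angularOn a k)) p b := by
  have hρ₀ := hseg ρ₀ left_mem_uIcc
  have hρ := hseg ρ right_mem_uIcc
  obtain ⟨s, hs, hys⟩ : ∃ s : EuclideanSpace ℝ (Fin k), ‖s‖ = 1 ∧
      ‖fibrePart p.1‖ • s = fibrePart p.1 := by
    by_cases hy : fibrePart p.1 = 0
    · exact ⟨EuclideanSpace.single ⟨0, hk⟩ 1, by simp, by simp [hy]⟩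
    · exact ⟨‖fibrePart p.1‖⁻¹ • fibrePart p.1,
        by rw [norm_smul, norm_inv, norm_norm, inv_mul_cancel₀ (norm_ne_zero_iff.2 hy)],
        by rw [smul_smul, mul_inv_cancel₀ (norm_ne_zero_iff.2 hy), one_smul]⟩
  set γ : ℝ → EuclideanSpace ℝ (Fin (k + 2)) := fun ρ' =>
    joinParts (ρ' • z) (√(regionFun a (ρ' • z)) • s) with hγ
  have hcont : Continuous γ := by
    have h1 := (contDiff_regionFun a).continuous
    have h2 : Continuous fun ρ' : ℝ => (ρ' • z, √(regionFun a (ρ' • z)) • s) := by fun_prop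
    exact contDiff_joinParts.continuous.comp h2
  have hmem : ∀ ρ' ∈ uIcc ρ₀ ρ, γ ρ' ∈ polyZeroSet (manifoldPoly a k) := by
    intro ρ' hρ'
    rw [hγ, joinParts_mem_manifold_iff, norm_smul, hs, mul_one, Real.norm_eq_abs, sq_abs,
      Real.sq_sqrt (hseg ρ' hρ').2]
  have hang : ∀ ρ' ∈ uIcc ρ₀ ρ, angularMap (γ ρ') = radialProj z := by
    intro ρ' hρ'
    rw [hγ, angularMap, planePart_joinParts, radialProj_smul (hseg ρ' hρ').1]
  have hγp : γ ρ = p.1 := by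
    have h1 := mem_manifold_iff.1 p.2
    rw [hp] at h1
    rw [hγ]
    simp only
    rw [h1, Real.sqrt_sq (norm_nonneg _), hys, ← hp, joinParts_parts]
  have hγb : γ ρ₀ = b.1 := by
    have h1 := mem_manifold_iff.1 b.2
    rw [hb, planePart_joinParts, fibrePart_joinParts] at h1
    rw [hb, hγ]
    simp [h1]
  have hcp : angularMap p.1 = radialProj z := hγp ▸ hang ρ right_mem_uIcc
  have hcb : angularMap b.1 = radialProj z := hγb ▸ hang ρ₀ left_mem_uIcc
  refine ⟨hcp.trans hcb.symm, ?_⟩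
  set T : Set (polyZeroSet (manifoldPoly a k)) := Subtype.val ⁻¹' (γ '' uIcc ρ₀ ρ) with hT
  have hTconn : IsPreconnected T := by
    rw [← IsInducing.subtypeVal.isPreconnected_image, hT, Subtype.image_preimage_coe,
      inter_eq_self_of_subset_right]
    · exact isPreconnected_uIcc.image γ hcont.continuousOn
    · rintro _ ⟨ρ', hρ', rfl⟩
      exact hmem ρ' hρ'
  refine hTconn.subset_connectedComponentIn ⟨ρ, right_mem_uIcc, hγp⟩ ?_
    ⟨ρ₀, left_mem_uIcc, hγb⟩
  rintro q ⟨ρ', hρ', hq⟩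
  change angularMap q.1 = angularMap p.1
  rw [hcp, ← hq, hang ρ' hρ']

/-- Two points of the manifold with the same angle in the same channel are in the same component of
their fibre. -/
lemma reebSetoid_of_channel (hi : 2 ≤ i) (hk : 1 ≤ k) {j : Fin (i + 1)} {l : ℕ} (hl : l < a j)
    {p q : polyZeroSet (manifoldPoly a k)} (hpq : angularMap p.1 = angularMap q.1)
    (hp : InChannel a j l (planePart p.1)) (hq : InChannel a j l (planePart q.1)) :
    (reebSetoid (angularOn a k)) p q := by
  set z := angularMap p.1 with hz
  have hpn := norm_planePart_pos hi p.2
  have hqn := norm_planePart_pos hi q.2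
  have hp' : planePart p.1 = ‖planePart p.1‖ • z := (norm_smul_radialProj _).symm
  have hq' : planePart q.1 = ‖planePart q.1‖ • z := by
    rw [hpq]; exact (norm_smul_radialProj _).symm
  have hz1 : ‖z‖ = 1 := norm_radialProj (norm_pos_iff.1 hpn)
  have hzj : Real.cos (halfAngle i) ≤ alongCoord j z := by
    have h := hp.1
    rw [hp', norm_smul, hz1, alongCoord_smul, norm_norm, mul_one, mul_comm] at h
    exact le_of_mul_le_mul_left h hpn
  obtain ⟨ρ₀, hρ₀, hQ, -, hend⟩ := exists_channel_end hi hl hz1 hzj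
  have hbmem : joinParts (ρ₀ • z) 0 ∈ polyZeroSet (manifoldPoly a k) := by
    rw [joinParts_mem_manifold_iff, hQ]; simp
  have key : ∀ q : polyZeroSet (manifoldPoly a k), InChannel a j l (planePart q.1) →
      planePart q.1 = ‖planePart q.1‖ • z →
      (reebSetoid (angularOn a k)) q ⟨joinParts (ρ₀ • z) 0, hbmem⟩ := by
    intro q hq hq'
    refine reebSetoid_of_segment hk q _ hq' rfl fun ρ' hρ' => ?_
    have := hend ‖planePart q.1‖ (norm_planePart_pos hi q.2) (hq' ▸ hq)
      (hq' ▸ regionFun_nonneg_of_mem q.2) ρ' hρ'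
    exact ⟨this.1, this.2.2⟩
  exact (reebSetoid _).trans (key p hp hp') ((reebSetoid _).symm (key q hq hq'))

/-- The fibres over the rays between the sectors are connected: there the region is the whole segment
between the circles. -/
lemma reebSetoid_of_ray (hi : 2 ≤ i) (hk : 1 ≤ k) {j : Fin (i + 1)}
    {p q : polyZeroSet (manifoldPoly a k)} (hp : angularMap p.1 = sectorRay j)
    (hq : angularMap q.1 = sectorRay j) : (reebSetoid (angularOn a k)) p q := by
  have hB := two_le_innerBound a
  have hbmem : joinParts ((4 : ℝ) • sectorRay j) 0 ∈ polyZeroSet (manifoldPoly a k) := by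
    rw [joinParts_mem_manifold_iff, regionFun, norm_smul, norm_sectorRay]
    norm_num
  have key : ∀ q : polyZeroSet (manifoldPoly a k), angularMap q.1 = sectorRay j →
      (reebSetoid (angularOn a k)) q ⟨joinParts ((4 : ℝ) • sectorRay j) 0, hbmem⟩ := by
    intro q hq
    have hq' : planePart q.1 = ‖planePart q.1‖ • sectorRay j := by
      rw [← hq]; exact (norm_smul_radialProj _).symm
    refine reebSetoid_of_segment hk q _ hq' rfl fun ρ' hρ' => ?_
    have hn := ((regionFun_nonneg_iff hi _).1 (regionFun_nonneg_of_mem q.2)).1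
    rw [uIcc_of_ge hn.2] at hρ'
    refine ⟨(norm_planePart_pos hi q.2).trans_le hρ'.1,
      regionFun_sectorRay_nonneg hi j ?_ hρ'.2⟩
    nlinarith [hρ'.1, hn.1]
  exact (reebSetoid _).trans (key p hp) ((reebSetoid _).symm (key q hq))

namespace NecklaceParam

variable (G : NecklaceParam X a)

/-- A point on the boundary of a sector goes to a vertex. -/
lemma edge_sectorParam_of_ray (hi : 2 ≤ i) (j : Fin (i + 1)) (l : Fin (a j))
    {x : EuclideanSpace ℝ (Fin 2)} (hx0 : x ≠ 0)
    (hx : alongCoord j x = Real.cos (halfAngle i) * ‖x‖) :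
    ∃ j', radialProj x = sectorRay j' ∧ G.edge j l (sectorParam j x) = G.vert j' := by
  have hn : 0 < ‖x‖ := norm_pos_iff.2 hx0
  have h1 : sectorParam j x = sectorParam j (radialProj x) := (sectorParam_radialProj j hx0).symm
  rcases eq_smul_sectorRay j hx with h | h
  · have h2 : radialProj x = sectorRay j := by
      rw [h, radialProj_smul hn, radialProj_of_norm_eq_one (norm_sectorRay j)]
    refine ⟨j, h2, ?_⟩
    rw [h1, h2, ← sectorDir_neg_one, sectorParam_sectorDir hi, G.edge_neg_one]
  · have h2 : radialProj x = sectorRay (j + 1) := by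
      rw [h, radialProj_smul hn, radialProj_of_norm_eq_one (norm_sectorRay _)]
    refine ⟨j + 1, h2, ?_⟩
    rw [h1, h2, ← sectorDir_one, sectorParam_sectorDir hi, G.edge_one]

/-- A point of the manifold that belongs to several channels has the same image for all of them. -/
lemma edge_sectorParam_unique (hi : 2 ≤ i) {p : EuclideanSpace ℝ (Fin (k + 2))}
    (hp : p ∈ polyZeroSet (manifoldPoly a k)) {j j' : Fin (i + 1)} {l : Fin (a j)}
    {l' : Fin (a j')} (h : InChannel a j l (planePart p)) (h' : InChannel a j' l' (planePart p)) :
    G.edge j l (sectorParam j (planePart p)) = G.edge j' l' (sectorParam j' (planePart p)) := by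
  have hx0 : planePart p ≠ 0 := norm_pos_iff.1 (norm_planePart_pos hi hp)
  have hall := ((regionFun_nonneg_iff hi _).1 (regionFun_nonneg_of_mem hp)).2
  by_cases hu : alongCoord j (planePart p) = Real.cos (halfAngle i) * ‖planePart p‖
  · have hu' : alongCoord j' (planePart p) = Real.cos (halfAngle i) * ‖planePart p‖ := by
      by_contra hne
      have := sector_unique (lt_of_le_of_ne h'.1 (Ne.symm hne)) h.1
      subst this
      exact hne hu
    obtain ⟨J, hJ, e1⟩ := G.edge_sectorParam_of_ray hi j l hx0 hu
    obtain ⟨J', hJ', e2⟩ := G.edge_sectorParam_of_ray hi j' l' hx0 hu'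
    rw [e1, e2, sectorRay_injective (hJ.symm.trans hJ')]
  · have hj := sector_unique (lt_of_le_of_ne h.1 (Ne.symm hu)) h'.1
    subst hj
    rcases lt_trichotomy (l : ℕ) l' with hl | hl | hl
    · exact absurd (h.eq_of_lt hi h' hl l'.2 hall) hu
    · rw [Fin.ext hl]
    · exact absurd (h'.eq_of_lt hi h hl l.2 hall) hu

lemma exists_channel (hi : 2 ≤ i) (hpos : ∀ j, 0 < a j)
    (p : polyZeroSet (manifoldPoly a k)) :
    ∃ (j : Fin (i + 1)) (l : Fin (a j)), InChannel a j l (planePart p.1) := by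
  obtain ⟨j, hj⟩ := exists_mem_sector (i := i) (planePart p.1)
  have hK := half_le_cos_halfAngle hi
  obtain ⟨l, hl⟩ := exists_inChannel hpos hj ((by positivity : (0 : ℝ) ≤ _).trans hj)
  exact ⟨j, l, hl⟩

open Classical in
/-- The map from the manifold to the graph whose fibres are the components of the fibres of the angular
coordinate: each channel goes to an edge, according to the angle. The choice of the channel does not
matter by `edge_sectorParam_unique`, and every point lies in a channel, so that the value `G.vert 0`
is not taken by default. -/
def toGraph (k : ℕ) (p : polyZeroSet (manifoldPoly a k)) : X :=
  if h : ∃ jl : Σ j, Fin (a j), InChannel a jl.1 jl.2 (planePart p.1) then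
    G.edge h.choose.1 h.choose.2 (sectorParam h.choose.1 (planePart p.1))
  else G.vert 0

lemma toGraph_eq (hi : 2 ≤ i) {p : polyZeroSet (manifoldPoly a k)} {j : Fin (i + 1)}
    {l : Fin (a j)} (h : InChannel a j l (planePart p.1)) :
    G.toGraph k p = G.edge j l (sectorParam j (planePart p.1)) := by
  have hex : ∃ jl : Σ j, Fin (a j), InChannel a jl.1 jl.2 (planePart p.1) := ⟨⟨j, l⟩, h⟩
  rw [toGraph, dif_pos hex]
  exact G.edge_sectorParam_unique hi p.2 hex.choose_spec h

lemma alongCoord_pos_of_sector (hi : 2 ≤ i) {p : polyZeroSet (manifoldPoly a k)} {j : Fin (i + 1)}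
    (h : Real.cos (halfAngle i) * ‖planePart p.1‖ ≤ alongCoord j (planePart p.1)) :
    0 < alongCoord j (planePart p.1) := by
  have h1 := half_le_cos_halfAngle hi
  have h2 := norm_planePart_pos hi p.2
  nlinarith

lemma toGraph_cases (hi : 2 ≤ i) (hpos : ∀ j, 0 < a j) (p : polyZeroSet (manifoldPoly a k)) :
    (∃ j, angularMap p.1 = sectorRay j ∧ G.toGraph k p = G.vert j) ∨
      ∃ (j : Fin (i + 1)) (l : Fin (a j)), InChannel a j l (planePart p.1) ∧
        sectorParam j (planePart p.1) ∈ Ioo (-1 : ℝ) 1 ∧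
        G.toGraph k p = G.edge j l (sectorParam j (planePart p.1)) := by
  obtain ⟨j, l, hjl⟩ := exists_channel hi hpos p
  have hx0 : planePart p.1 ≠ 0 := norm_pos_iff.1 (norm_planePart_pos hi p.2)
  by_cases hu : alongCoord j (planePart p.1) = Real.cos (halfAngle i) * ‖planePart p.1‖
  · left
    obtain ⟨J, hJ, e1⟩ := G.edge_sectorParam_of_ray hi j l hx0 hu
    exact ⟨J, hJ, (G.toGraph_eq hi hjl).trans e1⟩
  · right
    refine ⟨j, l, hjl, ?_, G.toGraph_eq hi hjl⟩
    have := (sector_iff_sq_le hi j (alongCoord_pos_of_sector hi hjl.1)).2.1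
      (lt_of_le_of_ne hjl.1 (Ne.symm hu))
    rw [← one_pow 2] at this
    exact abs_lt.1 (by simpa using sq_lt_sq.1 this)

lemma toGraph_of_ray (hi : 2 ≤ i) (hpos : ∀ j, 0 < a j) {p : polyZeroSet (manifoldPoly a k)}
    {j : Fin (i + 1)} (h : angularMap p.1 = sectorRay j) : G.toGraph k p = G.vert j := by
  rcases G.toGraph_cases hi hpos p with ⟨J, hJ, e⟩ | ⟨J, l, hJ, ht, -⟩
  · rw [e, sectorRay_injective (hJ.symm.trans h)]
  · exfalso
    have hx0 : planePart p.1 ≠ 0 := norm_pos_iff.1 (norm_planePart_pos hi p.2)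
    have h1 := alongCoord_pos_of_sector hi hJ.1
    have h2 := (sector_iff_sq_le hi J h1).2.2 (by nlinarith [ht.1, ht.2])
    rw [show planePart p.1 = ‖planePart p.1‖ • sectorRay j by
      rw [← h]; exact (norm_smul_radialProj _).symm] at h2
    rw [norm_smul, norm_norm, norm_sectorRay, mul_one, alongCoord_smul, mul_comm] at h2
    exact absurd (alongCoord_sectorRay_le j J)
      (not_le.2 (lt_of_mul_lt_mul_left h2 (norm_nonneg _)))

/-- The closed channels form a finite cover, and the map is continuous on each of them. -/
lemma continuous_toGraph (hi : 2 ≤ i) (hpos : ∀ j, 0 < a j) : Continuous (G.toGraph k) := by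
  have hplane : Continuous fun p : polyZeroSet (manifoldPoly a k) => planePart p.1 :=
    continuous_planePart.comp continuous_subtype_val
  refine LocallyFinite.continuous
    (f := fun jl : Σ j, Fin (a j) =>
      {p : polyZeroSet (manifoldPoly a k) | InChannel a jl.1 jl.2 (planePart p.1)})
    (locallyFinite_of_finite _) ?_ (fun jl => (isClosed_inChannel jl.1 jl.2).preimage hplane) ?_
  · rw [eq_univ_iff_forall]
    intro p
    obtain ⟨j, l, h⟩ := exists_channel hi hpos p
    exact mem_iUnion.2 ⟨⟨j, l⟩, h⟩
  · rintro ⟨j, l⟩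
    have h1 : ContinuousOn (fun p : polyZeroSet (manifoldPoly a k) =>
        G.edge j l (sectorParam j (planePart p.1)))
        {p | InChannel a j l (planePart p.1)} := by
      refine (G.continuousOn_edge j l).comp ?_ ?_
      · have h2 := (continuous_alongCoord j).comp hplane
        have h3 := (continuous_acrossCoord j).comp hplane
        refine ContinuousOn.div (h3.mul continuous_const).continuousOn
          (h2.mul continuous_const).continuousOn fun p hp => ?_
        exact (mul_pos (alongCoord_pos_of_sector hi hp.1) (sin_halfAngle_pos hi)).ne'
      · intro p hp
        have := (sector_iff_sq_le hi j (alongCoord_pos_of_sector hi hp.1)).1.1 hp.1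
        rw [← one_pow 2] at this
        exact abs_le.1 (by simpa using sq_le_sq.1 this)
    exact h1.congr fun p hp => G.toGraph_eq hi hp

/-- A point of the manifold with given image. -/
lemma exists_toGraph_eq_edge (hi : 2 ≤ i) (j : Fin (i + 1)) (l : Fin (a j)) {t : ℝ}
    (ht : t ∈ Icc (-1 : ℝ) 1) : ∃ p : polyZeroSet (manifoldPoly a k),
      angularMap p.1 = sectorDir j t ∧ G.toGraph k p = G.edge j l t := by
  obtain ⟨ρ₀, hρ₀, hQ, hch, -⟩ := exists_channel_end hi l.2 (norm_sectorDir hi j t)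
    (cos_le_alongCoord_sectorDir hi j ht)
  have hbmem : joinParts (ρ₀ • sectorDir j t) 0 ∈ polyZeroSet (manifoldPoly a k) := by
    rw [joinParts_mem_manifold_iff, hQ]; simp
  refine ⟨⟨_, hbmem⟩, ?_, ?_⟩
  · rw [angularMap, planePart_joinParts, radialProj_smul hρ₀,
      radialProj_of_norm_eq_one (norm_sectorDir hi j t)]
  · rw [G.toGraph_eq (p := ⟨_, hbmem⟩) (j := j) (l := l) hi (by simpa using hch)]
    simp only [planePart_joinParts]
    rw [sectorParam_smul j hρ₀.ne', sectorParam_sectorDir hi]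

lemma toGraph_surjective (hi : 2 ≤ i) (hpos : ∀ j, 0 < a j) :
    Function.Surjective (G.toGraph k) := by
  intro x
  rcases G.exists_eq x with ⟨j, rfl⟩ | ⟨j, l, s, hs, rfl⟩
  · obtain ⟨p, -, hp⟩ := G.exists_toGraph_eq_edge (k := k) hi j ⟨0, hpos j⟩
      (t := -1) ⟨le_rfl, by norm_num⟩
    exact ⟨p, by rw [hp, G.edge_neg_one]⟩
  · obtain ⟨p, -, hp⟩ := G.exists_toGraph_eq_edge (k := k) hi j l (Ioo_subset_Icc_self hs)
    exact ⟨p, hp⟩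

/-- The fibres of `toGraph` are the points of the Reeb space. -/
lemma toGraph_eq_iff [T1Space X] (hi : 2 ≤ i) (hk : 1 ≤ k) (hpos : ∀ j, 0 < a j)
    (p q : polyZeroSet (manifoldPoly a k)) :
    G.toGraph k p = G.toGraph k q ↔ (reebSetoid (angularOn a k)) p q := by
  constructor
  · intro h
    rcases G.toGraph_cases hi hpos p with ⟨j, hj, e⟩ | ⟨j, l, hj, ht, e⟩ <;>
      rcases G.toGraph_cases hi hpos q with ⟨j', hj', e'⟩ | ⟨j', l', hj', ht', e'⟩ <;>
      rw [e, e'] at h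
    · have := G.vert_injective h
      subst this
      exact reebSetoid_of_ray hi hk hj hj'
    · exact absurd h.symm (G.edge_ne_vert _ _ _ _ ht')
    · exact absurd h (G.edge_ne_vert _ _ _ _ ht)
    · obtain ⟨h1, h2⟩ := G.edge_injective _ _ _ _ _ _ ht ht' h
      cases h1
      refine reebSetoid_of_channel hi hk l.2 ?_ hj hj'
      rw [angularMap, angularMap,
        ← sectorDir_sectorParam hi j (alongCoord_pos_of_sector hi hj.1), h2,
        sectorDir_sectorParam hi j (alongCoord_pos_of_sector hi hj'.1)]
  · rintro ⟨-, hq⟩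
    -- The image of a component of a fibre is connected, and contained in the finite set of points
    -- of the edges with the given angle.
    set F := angularOn a k ⁻¹' {angularOn a k p} with hF
    have hconn : IsPreconnected (G.toGraph k '' connectedComponentIn F p) :=
      isPreconnected_connectedComponentIn.image _ (G.continuous_toGraph hi hpos).continuousOn
    have hfin : (G.toGraph k '' connectedComponentIn F p).Finite := by
      refine Set.Finite.subset (Set.finite_range fun jl : Σ j, Fin (a j) =>
        G.edge jl.1 jl.2 (sectorParam jl.1 (angularMap p.1))) ?_
      rintro _ ⟨q, hq, rfl⟩
      have hq' : angularMap q.1 = angularMap p.1 := connectedComponentIn_subset F p hq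
      obtain ⟨j, l, hjl⟩ := exists_channel hi hpos q
      refine ⟨⟨j, l⟩, ?_⟩
      simp only
      rw [G.toGraph_eq hi hjl, ← hq', angularMap,
        sectorParam_radialProj j (norm_pos_iff.1 (norm_planePart_pos hi q.2))]
    have hsub : (G.toGraph k '' connectedComponentIn F p).Subsingleton := by
      rw [← not_nontrivial_iff]
      exact fun h => hconn.infinite_of_nontrivial h hfin
    exact hsub ⟨p, mem_connectedComponentIn rfl, rfl⟩ ⟨q, hq, rfl⟩

/-- The Reeb space is homeomorphic to the graph. -/
def reebHomeomorph [T2Space X] (hi : 2 ≤ i) (hk : 1 ≤ k) (hpos : ∀ j, 0 < a j) :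
    ReebSpace (angularOn a k) ≃ₜ X :=
  haveI : CompactSpace (polyZeroSet (manifoldPoly a k)) :=
    isCompact_iff_compactSpace.1 (isCompact_manifold hi a k)
  Continuous.homeoOfEquivCompactToT2
    (f := Equiv.ofBijective
      (Quotient.lift (G.toGraph k) fun p q h => (G.toGraph_eq_iff hi hk hpos p q).2 h)
      ⟨by
        rintro ⟨p⟩ ⟨q⟩ h
        exact Quotient.sound ((G.toGraph_eq_iff hi hk hpos p q).1 h),
      fun x => by
        obtain ⟨p, hp⟩ := G.toGraph_surjective (k := k) hi hpos x
        exact ⟨Quotient.mk _ p, hp⟩⟩)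
    ((G.continuous_toGraph hi hpos).quotient_lift _)

@[simp] lemma reebHomeomorph_mk [T2Space X] (hi : 2 ≤ i) (hk : 1 ≤ k) (hpos : ∀ j, 0 < a j)
    (p : polyZeroSet (manifoldPoly a k)) :
    G.reebHomeomorph hi hk hpos (Quotient.mk _ p) = G.toGraph k p := rfl

/-- The manifold is connected, since it maps onto the connected graph with connected fibres. -/
lemma isConnected_manifold [T2Space X] [ConnectedSpace X] (G : NecklaceParam X a) (hi : 2 ≤ i)
    (hk : 1 ≤ k) (hpos : ∀ j, 0 < a j) : IsConnected (polyZeroSet (manifoldPoly a k)) := by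
  have : CompactSpace (polyZeroSet (manifoldPoly a k)) :=
    isCompact_iff_compactSpace.1 (isCompact_manifold hi a k)
  have hcont := G.continuous_toGraph (k := k) hi hpos
  have hsurj := G.toGraph_surjective (k := k) hi hpos
  have hquot : IsQuotientMap (G.toGraph k) := hcont.isClosedMap.isQuotientMap hcont hsurj
  have hfib : ∀ x, IsConnected (G.toGraph k ⁻¹' {x}) := by
    intro x
    obtain ⟨p, rfl⟩ := hsurj x
    have : G.toGraph k ⁻¹' {G.toGraph k p} =
        connectedComponentIn (angularOn a k ⁻¹' {angularOn a k p}) p := by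
      ext q
      constructor
      · intro hq
        exact ((G.toGraph_eq_iff hi hk hpos p q).1 (Eq.symm hq)).2
      · intro hq
        have h1 : angularOn a k q = angularOn a k p :=
          connectedComponentIn_subset (angularOn a k ⁻¹' {angularOn a k p}) p hq
        exact ((G.toGraph_eq_iff hi hk hpos p q).2 ⟨h1.symm, hq⟩).symm
    rw [this]
    exact ⟨⟨p, mem_connectedComponentIn rfl⟩, isPreconnected_connectedComponentIn⟩
  have huniv := hquot.isCoinducing.isConnected_preimage_of_isClosed hfib isClosed_univ
    isConnected_univ
  rw [preimage_univ] at huniv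
  exact isConnected_iff_connectedSpace.2 (connectedSpace_iff_univ.2 huniv)

lemma image_reebVertices [T2Space X] (hi : 2 ≤ i) (hk : 1 ≤ k) (hpos : ∀ j, 0 < a j)
    (hne : ∀ j : Fin (i + 1), (a j, a (j + 1)) ≠ (1, 1)) :
    G.reebHomeomorph hi hk hpos ''
      reebVertices (polyZeroSet (manifoldPoly a k)) (k + 1) angularMap = range G.vert := by
  ext x
  constructor
  · rintro ⟨_, ⟨p, rfl, hs⟩, rfl⟩
    obtain ⟨h, e, he, hp⟩ := exists_chart_zero_eq hi p.2 hs
    rw [reebHomeomorph_mk]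
    rcases angularMap_chart_zero (k := k) hi h he with h1 | h1
    · exact ⟨_, (G.toGraph_of_ray hi hpos (hp ▸ h1)).symm⟩
    · exact ⟨_, (G.toGraph_of_ray hi hpos (hp ▸ h1)).symm⟩
  · rintro ⟨j, rfl⟩
    obtain ⟨p, hp, hj, hs⟩ := exists_isSingularPoint_over (k := k) hi hpos hne j
    refine ⟨Quotient.mk _ ⟨p, hp⟩, ⟨⟨p, hp⟩, rfl, hs⟩, ?_⟩
    rw [reebHomeomorph_mk]
    exact G.toGraph_of_ray hi hpos hj

end NecklaceParam

lemma finite_singularValues (hi : 2 ≤ i) (a : Fin (i + 1) → ℕ) (k d : ℕ) :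
    (angularMap '' {p | p ∈ polyZeroSet (manifoldPoly a k) ∧
      IsSingularPoint (polyZeroSet (manifoldPoly a k)) d angularMap p}).Finite := by
  refine (Set.finite_range (sectorRay (i := i))).subset ?_
  rintro _ ⟨p, ⟨hp, hs⟩, rfl⟩
  obtain ⟨h, e, he, rfl⟩ := exists_chart_zero_eq hi hp hs
  rcases angularMap_chart_zero (k := k) hi h he with h1 | h1
  · exact ⟨_, h1.symm⟩
  · exact ⟨_, h1.symm⟩

lemma reebGraphIsomorphic_angularMap [T2Space X] [CWComplex (univ : Set X)]
    (G : NecklaceParam X a) (hi : 2 ≤ i) (hk : 1 ≤ k) (hpos : ∀ j, 0 < a j)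
    (hne : ∀ j : Fin (i + 1), (a j, a (j + 1)) ≠ (1, 1))
    (hvert : range G.vert =
      ⋃ z : RelCWComplex.cell (univ : Set X) 0, RelCWComplex.closedCell 0 z)
    (hedge : ∀ e : RelCWComplex.cell (univ : Set X) 1, ∃ j l, ∃ σ : ℝ, (σ = 1 ∨ σ = -1) ∧
      ∀ t, RelCWComplex.map 1 e (fun _ => t) = G.edge j l (σ * t)) :
    ReebGraphIsomorphic (polyZeroSet (manifoldPoly a k)) (k + 1) angularMap X := by
  refine ⟨finite_singularValues hi a k _, G.reebHomeomorph hi hk hpos, ?_, fun e => ?_⟩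
  · rw [G.image_reebVertices hi hk hpos hne, hvert]
  · obtain ⟨j, l, σ, hσ, he⟩ := hedge e
    refine isPiecewiseRegular_sectorDir hi j (σ := σ) (by rcases hσ with h | h <;> simp [h])
      fun t ht => ?_
    have hσt : σ * t ∈ Icc (-1 : ℝ) 1 := by
      rcases hσ with h | h <;> rw [h] <;> constructor <;> linarith [ht.1, ht.2]
    obtain ⟨p, hp1, hp2⟩ := G.exists_toGraph_eq_edge (k := k) hi j l hσt
    have hp3 : (G.reebHomeomorph hi hk hpos).symm (RelCWComplex.map 1 e fun _ => t) =
        Quotient.mk _ p := by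
      rw [Homeomorph.symm_apply_eq, NecklaceParam.reebHomeomorph_mk, hp2, he]
    rw [hp3]
    exact hp1

end Reeb

end

theorem theorem2 {X : Type*} [TopologicalSpace X] [T2Space X] [CWComplex (univ : Set X)]
    (hX : IsCWGraph X) (i : ℕ) (hi : 2 < i + 1)
    (v : Fin (i + 1) ≃ RelCWComplex.cell (univ : Set X) 0) (a : Fin (i + 1) → ℕ)
    (hedge : ∀ e : RelCWComplex.cell (univ : Set X) 1, ∃ j : Fin (i + 1),
      (CWComplex.OneSkeletonGraph (univ : Set X)).IsLink e (v j) (v (j + 1)))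
    (hcount : ∀ j : Fin (i + 1),
      Nat.card {e : RelCWComplex.cell (univ : Set X) 1 //
        (CWComplex.OneSkeletonGraph (univ : Set X)).IsLink e (v j) (v (j + 1))} = a j)
    (hpos : ∀ j, 0 < a j) (hne : ∀ j : Fin (i + 1), (a j, a (j + 1)) ≠ (1, 1))
    (m : ℕ) (hm : 1 < m) (r : ℝ) (hr0 : 0 < r) (hr1 : r < 1) :
    ∃ P : MvPolynomial (Fin (m + 1)) ℝ,
      P.totalDegree = 2 * (∑ j, (a j - 1)) + 4 ∧
      IsNonsingularPoly P ∧ IsCompact (polyZeroSet P) ∧ IsConnected (polyZeroSet P) ∧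
      ∃ f : EuclideanSpace ℝ (Fin (m + 1)) → EuclideanSpace ℝ (Fin 2),
        IsRealAlgebraicMap (polyZeroSet P) f ∧
        MapsTo f (polyZeroSet P) (planeAnnulus r) ∧
        IsMorseFunction (polyZeroSet P) m unitCircle (fun x => radialProj (f x)) ∧
        ReebGraphIsomorphic (polyZeroSet P) m (fun x => radialProj (f x)) X := by
  have hi' : 2 ≤ i := by omega
  obtain ⟨k, rfl⟩ : ∃ k, m = k + 1 := ⟨m - 1, by omega⟩
  have hk : 1 ≤ k := by omega
  obtain ⟨G, hvert, hG⟩ := exists_necklaceParam hX hi' v a hedge hcount hpos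
  have := hX.connected
  have h0 : ∀ p ∈ polyZeroSet (manifoldPoly a k), planePart p ≠ 0 := fun p hp =>
    norm_pos_iff.1 (norm_planePart_pos hi' hp)
  have hang : (fun p : EuclideanSpace ℝ (Fin (k + 2)) =>
      radialProj (annulusMap r (planePart p))) = angularMap :=
    funext fun p => radialProj_annulusMap hr0 hr1 _
  refine ⟨manifoldPoly a k, totalDegree_manifoldPoly hi' a k, isNonsingularPoly_manifoldPoly hi' a k,
    isCompact_manifold hi' a k, G.isConnected_manifold hi' hk hpos,
    fun p => annulusMap r (planePart p), isRealAlgebraicMap_annulusMap h0,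
    fun p hp => annulusMap_mem hr0 hr1 (h0 p hp), ?_, ?_⟩
  · rw [hang]
    exact isMorseFunction_angularMap hi' hk a
  · rw [hang]
    exact reebGraphIsomorphic_angularMap G hi' hk hpos hne hvert hG
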